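/- **Notation.** For $a>0$ let $I^a f(t)=\frac1{\Gamma(a)}\int_0^t (t-z)^{a-1}f(z)\,dz$, and $I^0f=f$. For $0<a<1$, $0\le b\le 1$ let $D^{a,b}f=I^{b(1-a)}\frac{d}{dt}I^{(1-b)(1-a)}f$ be the Hilfer derivative in $t$. Let $$E_{(a-b,a),r}(x,y)=\sum_{n=0}^\infty\sum_{i=0}^n \binom ni\frac{x^iy^{n-i}}{\Gamma(r+an-bi)} .$$ A function $f(t,x)$ is said to be in $C_{-1}[0,T]$ if $f(t,x)=t^pF(t,x)$ for $0<t\le T$, $0\le x\le1$, with some $p>-1$ and some $F$ continuous on $[0,T]\times[0,1]$; it is said to be in $C^1_{-1}[0,T]$ if $\partial_tf$ exists for $0<t<T$, $0\le x\le 1$ and equals there $t^pF(t,x)$ with such $p$ and $F$. **Problem.** Let $T>0$, $0<\alpha_2<\alpha_1<1$, $\beta_1,\beta_2\in[0,1]$, $\mu\in\mathbb R$. Given $\bar g$ on $[0,T]\times[0,1]$, find $u$ with $$D^{\alpha_1,\beta_1}u+\mu D^{\alpha_2,\beta_2}u-u_{xx}=\bar g(t,x)\qquad(0<t<T,\ 0<x<1),$$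 $$u(t,0)=u(t,1)=0\quad(0\le t\le T),\qquad \lim_{t\to+0}I^{(1-\beta_i)(1-\alpha_i)}u(t,x)=0\quad(0\le x\le1,\ i=1,2),$$ such that $u\in C_{-1}[0,T]$, $I^{(1-\beta_1)(1-\alpha_1)}u\in C^1_{-1}[0,T]$, $u_{xx}(t,\cdot)$ exists and is continuous on $(0,1)$ for every $t\in(0,T]$, and $D^{\alpha_2,\beta_2}u$ exists (for $0<x<1$, the function $I^{(1-\beta_2)(1-\alpha_2)}u(\cdot,x)$ is differentiable on $(0,T)$ and its derivative is integrable on $(0,t)$ for every $t<T$). **Theorem 2.** Suppose that $\bar g$ and $\bar g_{xx}$ are continuous on $[0,T]\times[0,1]$ and that, for every $t\in[0,T]$, $\bar g_{xx}(t,\cdot)$ is absolutely continuous with $\bar g_{xxx}(t,\cdot)\in L_2(0,1)$ and $$\bar g(t,0)=\bar g(t,1)=\bar g_{xx}(t,0)=\bar g_{xx}(t,1)=0 .$$ If $\beta_1>0$ or $\beta_2(1-\alpha_2)>\alpha_1-\alpha_2$, suppose also that $\bar g\in C^1_{-1}[0,T]$. Then the problem has a solution; any two solutions coincide on $(0,T]\times[0,1]$;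 and the solution is given for $0<t\le T$, $0\le x\le 1$ by the convergent series $$u(t,x)=\sum_{k=1}^\infty \sin k\pi x\int_0^t z^{\alpha_1-1}E_{(\alpha_1-\alpha_2,\alpha_1),\alpha_1}\left(-\mu z^{\alpha_1-\alpha_2},-(k\pi)^2z^{\alpha_1}\right)\bar g_k(t-z)\,dz ,$$ where $\bar g_k(t)=2\int_0^1\bar g(t,x)\sin k\pi x\,dx$, all the integrals being convergent. -/

import Mathlib

open Set Filter Topology

noncomputable section

/-- The Riemann–Liouville fractional integral `I^a f` of order `a ≥ 0` with base point `0`;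
`I^0 f = f`. -/
def fracInt (a : ℝ) (f : ℝ → ℝ) (t : ℝ) : ℝ :=
  if a = 0 then f t else (1 / Real.Gamma a) * ∫ z in (0 : ℝ)..t, (t - z) ^ (a - 1) * f z

/-- The Hilfer derivative of order `a ∈ (0,1)` and type `b ∈ [0,1]`:
`I^{b(1-a)} (d/dt) I^{(1-b)(1-a)} f`. -/
def hilferDeriv (a b : ℝ) (f : ℝ → ℝ) (t : ℝ) : ℝ :=
  fracInt (b * (1 - a)) (deriv (fracInt ((1 - b) * (1 - a)) f)) t

/-- The Hilfer derivative of order `a` and type `b` of `f` exists on `(0,T)`: the inner derivative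
exists at every point, and the outer fractional integral is taken of an integrable function. -/
def HilferDifferentiable (T a b : ℝ) (f : ℝ → ℝ) : Prop :=
  ∀ t ∈ Ioo 0 T, DifferentiableAt ℝ (fracInt ((1 - b) * (1 - a)) f) t ∧
    IntervalIntegrable (deriv (fracInt ((1 - b) * (1 - a)) f)) MeasureTheory.volume 0 t

/-- The space `C_{-1}[0,T]` for functions of `(t,x)`, `0 < t ≤ T`, `0 ≤ x ≤ 1`:
`f(t,x) = t^p F(t,x)` with `p > -1` and `F` continuous on `[0,T] × [0,1]`. -/
def MemC (T : ℝ) (f : ℝ → ℝ → ℝ) : Prop :=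
  ∃ p : ℝ, -1 < p ∧ ∃ F : ℝ → ℝ → ℝ,
    ContinuousOn (fun q : ℝ × ℝ => F q.1 q.2) (Icc 0 T ×ˢ Icc 0 1) ∧
    ∀ t ∈ Ioc 0 T, ∀ x ∈ Icc (0 : ℝ) 1, f t x = t ^ p * F t x

/-- The space `C^1_{-1}[0,T]` for functions of `(t,x)`: the `t`-derivative exists for `0 < t < T`
and equals `t^p F(t,x)` with `p > -1` and `F` continuous on `[0,T] × [0,1]`. -/
def MemCOne (T : ℝ) (f : ℝ → ℝ → ℝ) : Prop :=
  ∃ p : ℝ, -1 < p ∧ ∃ F : ℝ → ℝ → ℝ,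
    ContinuousOn (fun q : ℝ × ℝ => F q.1 q.2) (Icc 0 T ×ˢ Icc 0 1) ∧
    ∀ t ∈ Ioo 0 T, ∀ x ∈ Icc (0 : ℝ) 1,
      HasDerivAt (fun s => f s x) (t ^ p * F t x) t

/-- The Mittag-Leffler function of two variables `E_{(a-b,a),r}(x,y)`. -/
def mittagLefflerTwo (a b r x y : ℝ) : ℝ :=
  ∑' n : ℕ, ∑ i ∈ Finset.range (n + 1),
    (n.choose i : ℝ) * x ^ i * y ^ (n - i) / Real.Gamma (r + a * n - b * i)

/-- The `k`-th sine coefficient of `g(t,·)` on `(0,1)`. -/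
def sineCoeff (g : ℝ → ℝ → ℝ) (k : ℕ) (t : ℝ) : ℝ :=
  2 * ∫ x in (0 : ℝ)..1, g t x * Real.sin (k * Real.pi * x)

/-- The conditions in `x` on the source term: `g` and `g_xx` are continuous on `[0,T] × [0,1]` and
vanish at `x = 0` and `x = 1`, and for every `t` the function `g_xx(t,·)` is absolutely continuous
with derivative in `L²(0,1)`. -/
structure SourceCondition (T : ℝ) (g : ℝ → ℝ → ℝ) : Prop where
  cont : ContinuousOn (fun q : ℝ × ℝ => g q.1 q.2) (Icc 0 T ×ˢ Icc 0 1)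
  contDiff : ∀ t ∈ Icc 0 T, ContDiffOn ℝ 2 (g t) (Icc 0 1)
  cont_xx : ContinuousOn (fun q : ℝ × ℝ => iteratedDerivWithin 2 (g q.1) (Icc 0 1) q.2)
    (Icc 0 T ×ˢ Icc 0 1)
  memLp_xxx : ∀ t ∈ Icc 0 T, ∃ h : ℝ → ℝ,
    MeasureTheory.MemLp h 2 (MeasureTheory.volume.restrict (Ioo 0 1)) ∧
    ∀ x ∈ Icc (0 : ℝ) 1, iteratedDerivWithin 2 (g t) (Icc 0 1) x =
      iteratedDerivWithin 2 (g t) (Icc 0 1) 0 + ∫ y in (0 : ℝ)..x, h y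
  bdry : ∀ t ∈ Icc 0 T, g t 0 = 0 ∧ g t 1 = 0
  bdry_xx : ∀ t ∈ Icc 0 T, iteratedDerivWithin 2 (g t) (Icc 0 1) 0 = 0 ∧
    iteratedDerivWithin 2 (g t) (Icc 0 1) 1 = 0

/-- `u` is a solution of the direct problem
`D^{α₁,β₁} u + μ D^{α₂,β₂} u - u_xx = g` in `(0,T) × (0,1)` with homogeneous Dirichlet conditions
and homogeneous fractional initial conditions. -/
structure IsDirectSolution (α₁ α₂ β₁ β₂ μ T : ℝ) (g u : ℝ → ℝ → ℝ) : Prop where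
  /-- `u ∈ C_{-1}[0,T]`, and `u ∈ C[0,1]` in `x` -/
  memC : MemC T u
  /-- `I^{(1-β₁)(1-α₁)} u ∈ C^1_{-1}[0,T]` -/
  memCOne : MemCOne T (fun t x => fracInt ((1 - β₁) * (1 - α₁)) (fun s => u s x) t)
  /-- `u_xx ∈ C(0,1)` -/
  contDiff : ∀ t ∈ Ioc 0 T, ContDiffOn ℝ 2 (u t) (Ioo 0 1)
  /-- the lower-order Hilfer derivative, too, makes sense -/
  hilfer : ∀ x ∈ Ioo (0 : ℝ) 1, HilferDifferentiable T α₂ β₂ (fun s => u s x)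
  equation : ∀ t ∈ Ioo 0 T, ∀ x ∈ Ioo (0 : ℝ) 1,
    hilferDeriv α₁ β₁ (fun s => u s x) t + μ * hilferDeriv α₂ β₂ (fun s => u s x) t
      - iteratedDeriv 2 (u t) x = g t x
  bdry : ∀ t ∈ Icc 0 T, u t 0 = 0 ∧ u t 1 = 0
  initial₁ : ∀ x ∈ Icc (0 : ℝ) 1,
    Tendsto (fracInt ((1 - β₁) * (1 - α₁)) (fun s => u s x)) (𝓝[>] 0) (𝓝 0)
  initial₂ : ∀ x ∈ Icc (0 : ℝ) 1,
    Tendsto (fracInt ((1 - β₂) * (1 - α₂)) (fun s => u s x)) (𝓝[>] 0) (𝓝 0)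

/-- The integrand, as a function of `z`, of the `k`-th coefficient of the solution at time `t`. -/
def directIntegrand (α₁ α₂ μ : ℝ) (g : ℝ → ℝ → ℝ) (k : ℕ) (t z : ℝ) : ℝ :=
  z ^ (α₁ - 1) *
    mittagLefflerTwo α₁ α₂ α₁ (-μ * z ^ (α₁ - α₂)) (-(k * Real.pi) ^ 2 * z ^ α₁) *
    sineCoeff g k (t - z)

end

/-!
Write `I^b f = k_b * f`, where `k_b = t^{b-1} / Γ(b)` and `*` is the convolution on `(0,T]`, and put
`a = α₁`, `c = α₂`, `λ_k = ((k+1)π)²`. All functions of `t` lie in the algebra `Sing T` of functions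
that are continuous on `(0,T]` with an integrable power singularity at `0`; it is commutative and
associative under `*`, and closed under sums of suitably dominated series.

**Kernels.** The Mittag-Leffler series is the Neumann series of a Volterra equation: the kernel
`G_l(t) = t^{a-1} E(-μ t^{a-c}, -l t^a)` satisfies `G_l + μ k_{a-c} * G_l + l k_a * G_l = k_a`
(`mlKernel_volterra`). Everything else rests on the bound `|G_l(t)| ≤ C l^{-3/4} t^{a/4-1}` with
`C` independent of `l > 0` (`exists_mlKernel_decay`). For `μ = 0` the kernel is positive
(`resolvent_pos`), hence at most `k_a`, and `t G_l(t) ≤ 1 / l` (`resolvent_le_inv`); interpolation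
between the two gives the bound. For general `μ` the kernel is a perturbation, which is a
contraction in an exponentially weighted norm whose weight does not depend on `l`.

**Uniqueness and representation.** Let `u` be a solution and `φ` its Hilfer derivative of order
`a`. Then `u = I^a φ`, and the derivative of order `c` is `I^{a-c} φ` almost everywhere
(`ae_hilferDeriv_eq`). So the `k`-th sine coefficients satisfy
`φ_k + μ I^{a-c} φ_k + λ_k I^a φ_k = g_k`, and convolution with `G_{λ_k}` yields `u_k = G_{λ_k} * g_k`
(`sineCoeff_of_isDirectSolution`). These are summable, so `u` is the sum of its sine series.

**Existence.** The assumptions on `g` give `g_k = O(1 / λ_k)`, so `λ_k u_k = O(λ_k^{-3/4})`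
uniformly in `t` and the series for `u` may be differentiated twice in `x`. Summing the modal
equations gives `u = I^a h` with `h + μ I^{a-c} h = g + u_xx`
(`exists_eq_fracInt_seriesSolution`). What remains is that `I^γ u` has a `t`-derivative in `C_{-1}`
for the orders `γ = (1-β_i)(1-α_i)`; then the Hilfer derivatives of `u` are `h` and `I^{a-c} h`
(`hilferDeriv_fracInt`). If `γ + a ≥ 1` the derivative is `I^{γ+a-1} h`. Otherwise `g` has a
`t`-derivative in `C_{-1}`, and the differentiated series converges by the decay of the kernels
(`exists_fracInt_seriesSolution_eq_of_memCOne`).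
-/

namespace Hilfer

open MeasureTheory

/-! ### Functions with an integrable singularity at `0` -/

/-- The convolution `∫₀ᵗ f (t - s) g s ds` of functions on the half-line. -/
noncomputable def causalConv (f g : ℝ → ℝ) (t : ℝ) : ℝ := ∫ s in (0 : ℝ)..t, f (t - s) * g s

/-- The Riemann–Liouville kernel `t^{b-1} / Γ(b)`, for which `I^b f = rlKernel b * f`. -/
noncomputable def rlKernel (b t : ℝ) : ℝ := t ^ (b - 1) / Real.Gamma b

/-- Functions that are continuous on `(0,T]` with at most an integrable power singularity at `0`.
This class is the algebra in which all convolutions take place. -/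
def Sing (T : ℝ) (f : ℝ → ℝ) : Prop :=
  ContinuousOn f (Ioc 0 T) ∧ ∃ p : ℝ, -1 < p ∧ ∃ C : ℝ, ∀ t ∈ Ioc 0 T, |f t| ≤ C * t ^ p

/-- A function of `(t,x)` lies in `C_{-1}[0,T]` precisely if it is continuous for `t > 0` and
bounded by an integrable power of `t`: a slightly smaller power absorbs the missing limit at
`t = 0`. -/
lemma memC_iff {T : ℝ} {f : ℝ → ℝ → ℝ} : MemC T f ↔
    ContinuousOn (fun q : ℝ × ℝ => f q.1 q.2) (Ioc 0 T ×ˢ Icc 0 1) ∧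
    ∃ p : ℝ, -1 < p ∧ ∃ C : ℝ, ∀ t ∈ Ioc 0 T, ∀ x ∈ Icc (0 : ℝ) 1, |f t x| ≤ C * t ^ p := by
  constructor
  · rintro ⟨p, hp, F, hF, h⟩
    refine ⟨?_, p, hp, ?_⟩
    · have h1 : ContinuousOn (fun q : ℝ × ℝ => q.1 ^ p * F q.1 q.2) (Ioc 0 T ×ˢ Icc 0 1) := by
        refine ContinuousOn.mul ?_ (hF.mono (prod_mono Ioc_subset_Icc_self le_rfl))
        exact ContinuousOn.rpow_const continuousOn_fst fun q hq => Or.inl hq.1.1.ne'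
      exact h1.congr fun q hq => h _ hq.1 _ hq.2
    · obtain ⟨C, hC⟩ := (isCompact_Icc.prod isCompact_Icc).exists_bound_of_continuousOn hF
      refine ⟨C, fun t ht x hx => ?_⟩
      rw [h t ht x hx, abs_mul, abs_of_pos (Real.rpow_pos_of_pos ht.1 p), mul_comm]
      exact mul_le_mul_of_nonneg_right (hC (t, x) ⟨Ioc_subset_Icc_self ht, hx⟩)
        (Real.rpow_nonneg ht.1.le _)
  · rintro ⟨hc, p, hp, C, hC⟩
    obtain ⟨r, hr1, hr2⟩ := exists_between hp
    refine ⟨r, hr1, fun t x => if t ≤ 0 then 0 else t ^ (-r) * f t x, ?_, ?_⟩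
    · rintro ⟨t, x⟩ ⟨ht, hx⟩
      simp only at ht hx
      rcases ht.1.eq_or_lt with h0 | h0
      · subst h0
        rw [ContinuousWithinAt]
        simp only [le_refl, if_true]
        have hlim : Tendsto (fun q : ℝ × ℝ => |C| * |q.1| ^ (p - r))
            (𝓝[Icc 0 T ×ˢ Icc 0 1] (0, x)) (𝓝 0) := by
          have : Continuous fun q : ℝ × ℝ => |C| * |q.1| ^ (p - r) :=
            continuous_const.mul ((continuous_abs.comp continuous_fst).rpow_const
              fun _ => Or.inr (by linarith))
          have h2 := this.tendsto (0, x)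
          simp only [abs_zero, Real.zero_rpow (by linarith : p - r ≠ 0), mul_zero] at h2
          exact h2.mono_left nhdsWithin_le_nhds
        refine squeeze_zero_norm' ?_ hlim
        filter_upwards [self_mem_nhdsWithin] with q hq
        split_ifs with h
        · simpa using by positivity
        · push Not at h
          rw [norm_mul, Real.norm_eq_abs, Real.norm_eq_abs,
            abs_of_pos (Real.rpow_pos_of_pos h _), abs_of_pos h, sub_eq_add_neg,
            Real.rpow_add h]
          have := hC q.1 ⟨h, hq.1.2⟩ q.2 hq.2
          have h3 : C * q.1 ^ p ≤ |C| * q.1 ^ p :=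
            mul_le_mul_of_nonneg_right (le_abs_self _) (Real.rpow_nonneg h.le _)
          calc q.1 ^ (-r) * |f q.1 q.2| ≤ q.1 ^ (-r) * (|C| * q.1 ^ p) :=
                mul_le_mul_of_nonneg_left (this.trans h3) (Real.rpow_nonneg h.le _)
            _ = _ := by ring
      · have h1 : ContinuousWithinAt (fun q : ℝ × ℝ => q.1 ^ (-r) * f q.1 q.2)
            (Ioc 0 T ×ˢ Icc 0 1) (t, x) :=
          ContinuousWithinAt.mul (continuousWithinAt_fst.rpow_const (Or.inl h0.ne'))
            (hc (t, x) ⟨⟨h0, ht.2⟩, hx⟩)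
        have hm : ∀ᶠ q : ℝ × ℝ in 𝓝 (t, x), 0 < q.1 :=
          continuous_fst.continuousAt.eventually (lt_mem_nhds h0)
        have h2 : ContinuousWithinAt (fun q : ℝ × ℝ => q.1 ^ (-r) * f q.1 q.2)
            (Icc 0 T ×ˢ Icc 0 1) (t, x) := by
          refine h1.mono_of_mem_nhdsWithin ?_
          filter_upwards [self_mem_nhdsWithin, nhdsWithin_le_nhds hm] with q hq hq2
          exact ⟨⟨hq2, hq.1.2⟩, hq.2⟩
        refine h2.congr_of_eventuallyEq ?_ (by simp [h0.not_ge])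
        filter_upwards [nhdsWithin_le_nhds hm] with q hq
        simp [hq.not_ge]
    · intro t ht x hx
      simp only [ht.1.not_ge, if_false]
      rw [← mul_assoc, ← Real.rpow_add ht.1]
      simp

lemma sing_iff {T : ℝ} {f : ℝ → ℝ} : Sing T f ↔ MemC T (fun t _ => f t) := by
  rw [memC_iff, Sing]
  constructor
  · rintro ⟨hc, p, hp, C, hC⟩
    exact ⟨hc.comp continuousOn_fst fun q hq => hq.1, p, hp, C, fun t ht x _ => hC t ht⟩
  · rintro ⟨hc, p, hp, C, hC⟩
    refine ⟨?_, p, hp, C, fun t ht => hC t ht 0 (by simp)⟩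
    exact hc.comp (f := fun t => (t, (0 : ℝ))) (by fun_prop) fun t ht => ⟨ht, by simp⟩

lemma _root_.MemC.slice {T : ℝ} {f : ℝ → ℝ → ℝ} (hf : MemC T f) {x : ℝ} (hx : x ∈ Icc (0 : ℝ) 1) :
    Sing T (fun t => f t x) := by
  obtain ⟨hc, p, hp, C, hC⟩ := memC_iff.1 hf
  exact ⟨hc.comp (f := fun t => (t, x)) (by fun_prop) fun t ht => ⟨ht, hx⟩, p, hp, C,
    fun t ht => hC t ht x hx⟩

lemma _root_.MemC.congr {T : ℝ} {f g : ℝ → ℝ → ℝ} (hf : MemC T f)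
    (h : ∀ t ∈ Ioc 0 T, ∀ x ∈ Icc (0 : ℝ) 1, g t x = f t x) : MemC T g := by
  obtain ⟨p, hp, F, hF, hf⟩ := hf
  exact ⟨p, hp, F, hF, fun t ht x hx => (h t ht x hx).trans (hf t ht x hx)⟩

lemma rpow_le_mul_rpow {T p r t : ℝ} (hrp : r ≤ p) (ht : t ∈ Ioc 0 T) :
    t ^ p ≤ T ^ (p - r) * t ^ r := by
  have : t ^ p = t ^ (p - r) * t ^ r := by rw [← Real.rpow_add ht.1]; ring_nf
  rw [this]
  exact mul_le_mul_of_nonneg_right (Real.rpow_le_rpow ht.1.le ht.2 (by linarith))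
    (Real.rpow_nonneg ht.1.le _)

lemma _root_.MemC.add {T : ℝ} {f g : ℝ → ℝ → ℝ} (hf : MemC T f) (hg : MemC T g) :
    MemC T (fun t x => f t x + g t x) := by
  obtain ⟨hc, p, hp, C, hC⟩ := memC_iff.1 hf
  obtain ⟨hd, q, hq, D, hD⟩ := memC_iff.1 hg
  refine memC_iff.2 ⟨hc.add hd, min p q, lt_min hp hq,
    |C| * T ^ (p - min p q) + |D| * T ^ (q - min p q), fun t ht x hx => ?_⟩
  have h1 := rpow_le_mul_rpow (min_le_left p q) ht
  have h2 := rpow_le_mul_rpow (min_le_right p q) ht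
  have t1 := Real.rpow_nonneg ht.1.le p
  have t2 := Real.rpow_nonneg ht.1.le q
  calc |f t x + g t x| ≤ |f t x| + |g t x| := abs_add_le _ _
    _ ≤ C * t ^ p + D * t ^ q := add_le_add (hC t ht x hx) (hD t ht x hx)
    _ ≤ |C| * t ^ p + |D| * t ^ q := by gcongr <;> exact le_abs_self _
    _ ≤ |C| * (T ^ (p - min p q) * t ^ min p q) + |D| * (T ^ (q - min p q) * t ^ min p q) := by
        gcongr
    _ = _ := by ring

lemma _root_.MemC.const_mul {T : ℝ} {f : ℝ → ℝ → ℝ} (c : ℝ) (hf : MemC T f) :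
    MemC T (fun t x => c * f t x) := by
  obtain ⟨p, hp, F, hF, hf⟩ := hf
  refine ⟨p, hp, fun t x => c * F t x, continuousOn_const.mul hF, fun t ht x hx => ?_⟩
  simp only [hf t ht x hx]
  ring

lemma _root_.MemC.sub {T : ℝ} {f g : ℝ → ℝ → ℝ} (hf : MemC T f) (hg : MemC T g) :
    MemC T (fun t x => f t x - g t x) :=
  (hf.add (hg.const_mul (-1))).congr fun t _ x _ => by ring

namespace Sing

variable {T : ℝ} {f g : ℝ → ℝ}

lemma congr (hf : Sing T f) (h : ∀ t ∈ Ioc 0 T, g t = f t) : Sing T g :=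
  sing_iff.2 ((sing_iff.1 hf).congr fun t ht _ _ => h t ht)

lemma add (hf : Sing T f) (hg : Sing T g) : Sing T (fun t => f t + g t) :=
  sing_iff.2 ((sing_iff.1 hf).add (sing_iff.1 hg))

lemma sub (hf : Sing T f) (hg : Sing T g) : Sing T (fun t => f t - g t) :=
  sing_iff.2 ((sing_iff.1 hf).sub (sing_iff.1 hg))

lemma const_mul (c : ℝ) (hf : Sing T f) : Sing T (fun t => c * f t) :=
  sing_iff.2 ((sing_iff.1 hf).const_mul c)

lemma abs (hf : Sing T f) : Sing T (fun t => |f t|) := by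
  obtain ⟨hc, p, hp, C, hC⟩ := hf
  exact ⟨hc.abs, p, hp, C, fun t ht => by simpa using hC t ht⟩

lemma mono {S : ℝ} (hS : S ≤ T) (hf : Sing T f) : Sing S f := by
  obtain ⟨hc, p, hp, C, hC⟩ := hf
  exact ⟨hc.mono (Ioc_subset_Ioc_right hS), p, hp, C, fun t ht => hC t ⟨ht.1, ht.2.trans hS⟩⟩

end Sing

lemma _root_.ContinuousOn.sing {T : ℝ} {f : ℝ → ℝ} (hf : ContinuousOn f (Icc 0 T)) : Sing T f := by
  obtain ⟨C, hC⟩ := isCompact_Icc.exists_bound_of_continuousOn hf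
  refine ⟨hf.mono Ioc_subset_Icc_self, 0, by norm_num, C, fun t ht => ?_⟩
  simpa using hC t (Ioc_subset_Icc_self ht)

lemma memC_of_continuousOn {T : ℝ} {f : ℝ → ℝ → ℝ}
    (hf : ContinuousOn (fun q : ℝ × ℝ => f q.1 q.2) (Icc 0 T ×ˢ Icc 0 1)) : MemC T f :=
  ⟨0, by norm_num, f, hf, fun t _ x _ => by simp⟩

lemma sing_rlKernel (T : ℝ) {b : ℝ} (hb : 0 < b) : Sing T (rlKernel b) := by
  refine ⟨?_, b - 1, by linarith, 1 / Real.Gamma b, fun t ht => ?_⟩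
  · exact (continuousOn_id.rpow_const fun t ht => Or.inl ht.1.ne').div_const _
  · rw [rlKernel, abs_of_nonneg]
    · exact le_of_eq (by ring)
    · exact div_nonneg (Real.rpow_nonneg ht.1.le _) (Real.Gamma_nonneg_of_nonneg hb.le)

lemma rlKernel_nonneg {b t : ℝ} (hb : 0 < b) (ht : 0 ≤ t) : 0 ≤ rlKernel b t :=
  div_nonneg (Real.rpow_nonneg ht _) (Real.Gamma_nonneg_of_nonneg hb.le)

lemma rlKernel_one (t : ℝ) : rlKernel 1 t = 1 := by simp [rlKernel]

/-! ### Beta integrals -/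

lemma intervalIntegrable_rpow_mul_rpow {p q t : ℝ} (hp : -1 < p) (hq : -1 < q) (ht : 0 ≤ t) :
    IntervalIntegrable (fun s => (t - s) ^ p * s ^ q) volume 0 t := by
  have base : IntervalIntegrable (fun s : ℝ => (1 - s) ^ p * s ^ q) volume 0 1 := by
    have h := (Complex.betaIntegral_convergent (u := ((q + 1 : ℝ) : ℂ)) (v := ((p + 1 : ℝ) : ℂ))
      (by simp; linarith) (by simp; linarith)).norm
    rw [intervalIntegrable_iff_integrableOn_Ioo_of_le zero_le_one] at h ⊢
    refine h.congr_fun (fun s hs => ?_) measurableSet_Ioo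
    have h1 : (0 : ℝ) < 1 - s := by linarith [hs.2]
    simp only [norm_mul]
    rw [Complex.norm_cpow_eq_rpow_re_of_pos hs.1,
      show (1 : ℂ) - (s : ℂ) = ((1 - s : ℝ) : ℂ) by push_cast; rfl,
      Complex.norm_cpow_eq_rpow_re_of_pos h1]
    simp [mul_comm]
  rcases ht.eq_or_lt with rfl | ht
  · simp
  have h := (base.comp_mul_left (c := t⁻¹)).const_mul (t ^ (p + q))
  simp only [zero_div, one_div, inv_inv] at h
  rw [intervalIntegrable_iff_integrableOn_Ioo_of_le ht.le] at h ⊢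
  refine h.congr_fun (fun s hs => ?_) measurableSet_Ioo
  have h1 : (0 : ℝ) < t - s := by linarith [hs.2]
  have e1 : 1 - t⁻¹ * s = (t - s) / t := by field_simp
  have e2 : t⁻¹ * s = s / t := by field_simp
  beta_reduce
  rw [e1, e2]
  rw [Real.div_rpow h1.le ht.le, Real.div_rpow hs.1.le ht.le, Real.rpow_add ht]
  have := (Real.rpow_pos_of_pos ht p).ne'
  have := (Real.rpow_pos_of_pos ht q).ne'
  field_simp

lemma integral_rpow_mul_rpow {p q t : ℝ} (hp : -1 < p) (hq : -1 < q) (ht : 0 < t) :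
    ∫ s in (0 : ℝ)..t, (t - s) ^ p * s ^ q =
      ProbabilityTheory.beta (q + 1) (p + 1) * t ^ (p + q + 1) := by
  have h := Complex.betaIntegral_scaled ((q + 1 : ℝ) : ℂ) ((p + 1 : ℝ) : ℂ) ht
  have h2 : (∫ s in (0 : ℝ)..t, ((s : ℂ) ^ (((q + 1 : ℝ) : ℂ) - 1)
      * ((t : ℂ) - s) ^ (((p + 1 : ℝ) : ℂ) - 1))) =
      ((∫ s in (0 : ℝ)..t, (t - s) ^ p * s ^ q : ℝ) : ℂ) := by
    rw [← intervalIntegral.integral_ofReal]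
    refine intervalIntegral.integral_congr_Ioo_of_le ht.le fun s hs => ?_
    have h1 : (0 : ℝ) < t - s := by linarith [hs.2]
    rw [← Complex.ofReal_one, ← Complex.ofReal_sub, ← Complex.ofReal_sub, ← Complex.ofReal_sub,
      ← Complex.ofReal_cpow hs.1.le, ← Complex.ofReal_cpow h1.le]
    push_cast
    simp [mul_comm]
  rw [h2] at h
  have h3 := congrArg Complex.re h
  rw [Complex.ofReal_re, ← Complex.ofReal_add, ← Complex.ofReal_one, ← Complex.ofReal_sub,
    ← Complex.ofReal_cpow ht.le, Complex.re_ofReal_mul,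
    ← ProbabilityTheory.beta_eq_betaIntegralReal _ _ (by linarith) (by linarith)] at h3
  rw [h3, mul_comm]
  ring_nf

lemma causalConv_rlKernel {a b t : ℝ} (ha : 0 < a) (hb : 0 < b) (ht : 0 < t) :
    causalConv (rlKernel a) (rlKernel b) t = rlKernel (a + b) t := by
  have h : causalConv (rlKernel a) (rlKernel b) t = (1 / (Real.Gamma a * Real.Gamma b)) *
      ∫ s in (0 : ℝ)..t, (t - s) ^ (a - 1) * s ^ (b - 1) := by
    rw [causalConv, ← intervalIntegral.integral_const_mul]
    refine intervalIntegral.integral_congr fun s _ => ?_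
    simp only [rlKernel]
    ring
  rw [h, integral_rpow_mul_rpow (by linarith) (by linarith) ht, ProbabilityTheory.beta, rlKernel]
  have := (Real.Gamma_pos_of_pos ha).ne'
  have := (Real.Gamma_pos_of_pos hb).ne'
  have := (Real.Gamma_pos_of_pos (add_pos ha hb)).ne'
  simp only [sub_add_cancel]
  rw [show a - 1 + (b - 1) + 1 = a + b - 1 by ring, add_comm b a]
  field_simp

/-! ### The convolution algebra -/

lemma causalConv_comm (f g : ℝ → ℝ) (t : ℝ) : causalConv f g t = causalConv g f t := by
  have h := intervalIntegral.integral_comp_sub_left (a := 0) (b := t)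
    (fun s => f (t - s) * g s) t
  simp only [sub_zero, sub_self, sub_sub_cancel] at h
  rw [causalConv, ← h, causalConv]
  simp only [mul_comm]

lemma causalConv_congr {T t : ℝ} {f f' g g' : ℝ → ℝ} (ht : t ∈ Icc 0 T)
    (hf : ∀ s ∈ Ioo 0 T, f s = f' s) (hg : ∀ s ∈ Ioo 0 T, g s = g' s) :
    causalConv f g t = causalConv f' g' t := by
  refine intervalIntegral.integral_congr_Ioo_of_le ht.1 fun s hs => ?_
  rw [hf (t - s) ⟨by linarith [hs.2], by linarith [hs.1, ht.2]⟩,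
    hg s ⟨hs.1, by linarith [hs.2, ht.2]⟩]

lemma causalConv_eq_mul (f g : ℝ → ℝ) (t : ℝ) :
    causalConv f g t = t * ∫ r in (0 : ℝ)..1, f (t - t * r) * g (t * r) := by
  have h := intervalIntegral.smul_integral_comp_mul_left (a := 0) (b := 1)
    (fun s => f (t - s) * g s) t
  simp only [mul_zero, mul_one, smul_eq_mul] at h
  rw [h, causalConv]

lemma causalConv_one_left (f : ℝ → ℝ) (t : ℝ) :
    causalConv (rlKernel 1) f t = ∫ s in (0 : ℝ)..t, f s := by
  simp [causalConv, rlKernel_one]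

lemma causalConv_const_mul_right (c : ℝ) (f g : ℝ → ℝ) (t : ℝ) :
    causalConv f (fun s => c * g s) t = c * causalConv f g t := by
  simp only [causalConv]
  rw [← intervalIntegral.integral_const_mul]
  exact intervalIntegral.integral_congr fun s _ => by ring

lemma causalConv_const_mul_left (c : ℝ) (f g : ℝ → ℝ) (t : ℝ) :
    causalConv (fun s => c * f s) g t = c * causalConv f g t := by
  rw [causalConv_comm, causalConv_const_mul_right, causalConv_comm]

/-- Continuity of `t ↦ ∫₀ᵗ f (t-s,x) g (s,x) ds` follows from dominated convergence after the
substitution `s = tr`, which moves the singularities to the fixed points `r = 0, 1`. -/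
lemma _root_.MemC.causalConv {T : ℝ} {f g : ℝ → ℝ → ℝ} (hf : MemC T f) (hg : MemC T g) :
    MemC T (fun t x => causalConv (fun s => f s x) (fun s => g s x) t) := by
  obtain ⟨p, hp, F, hF, hf⟩ := hf
  obtain ⟨q, hq, G, hG, hg⟩ := hg
  refine ⟨p + q + 1, by linarith, fun t x => ∫ r in (0 : ℝ)..1,
    ((1 - r) ^ p * r ^ q) * (F (t - t * r) x * G (t * r) x), ?_, ?_⟩
  · obtain ⟨C, hC⟩ := (isCompact_Icc.prod isCompact_Icc).exists_bound_of_continuousOn hF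
    obtain ⟨D, hD⟩ := (isCompact_Icc.prod isCompact_Icc).exists_bound_of_continuousOn hG
    have mem1 : ∀ y ∈ Icc (0:ℝ) T ×ˢ Icc (0:ℝ) 1, ∀ r ∈ Ioc (0:ℝ) 1,
        (y.1 - y.1 * r, y.2) ∈ Icc (0:ℝ) T ×ˢ Icc (0:ℝ) 1 := fun y hy r hr =>
      ⟨⟨by nlinarith [hy.1.1, hr.2], by nlinarith [hy.1.1, hy.1.2, hr.1, hr.2]⟩, hy.2⟩
    have mem2 : ∀ y ∈ Icc (0:ℝ) T ×ˢ Icc (0:ℝ) 1, ∀ r ∈ Ioc (0:ℝ) 1,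
        (y.1 * r, y.2) ∈ Icc (0:ℝ) T ×ˢ Icc (0:ℝ) 1 := fun y hy r hr =>
      ⟨⟨by nlinarith [hy.1.1, hr.1], by nlinarith [hy.1.1, hy.1.2, hr.1, hr.2]⟩, hy.2⟩
    have hw : IntegrableOn (fun r : ℝ => (1 - r) ^ p * r ^ q) (Ioc 0 1) :=
      (intervalIntegrable_iff_integrableOn_Ioc_of_le zero_le_one).1
        (intervalIntegrable_rpow_mul_rpow hp hq zero_le_one)
    have := continuousOn_of_dominated (μ := volume.restrict (Ioc (0:ℝ) 1))
      (F := fun (y : ℝ × ℝ) (r : ℝ) =>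
        ((1 - r) ^ p * r ^ q) * (F (y.1 - y.1 * r) y.2 * G (y.1 * r) y.2))
      (bound := fun r => (C * D) * ((1 - r) ^ p * r ^ q)) (s := Icc (0:ℝ) T ×ˢ Icc (0:ℝ) 1)
      ?_ ?_ (hw.const_mul _) ?_
    · simpa only [intervalIntegral.integral_of_le zero_le_one] using this
    · intro y hy
      refine hw.aestronglyMeasurable.mul (ContinuousOn.aestronglyMeasurable ?_ measurableSet_Ioc)
      refine ContinuousOn.mul ?_ ?_
      · exact hF.comp (f := fun r => (y.1 - y.1 * r, y.2)) (by fun_prop) fun r hr => mem1 y hy r hr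
      · exact hG.comp (f := fun r => (y.1 * r, y.2)) (by fun_prop) fun r hr => mem2 y hy r hr
    · intro y hy
      refine (ae_restrict_iff' measurableSet_Ioc).2 (Eventually.of_forall fun r hr => ?_)
      have h0 : 0 ≤ (1 - r) ^ p * r ^ q :=
        mul_nonneg (Real.rpow_nonneg (by linarith [hr.2]) _) (Real.rpow_nonneg hr.1.le _)
      rw [norm_mul, norm_mul (F _ _), Real.norm_of_nonneg h0, mul_comm]
      have h1 := hC _ (mem1 y hy r hr)
      have h2 := hD _ (mem2 y hy r hr)
      exact mul_le_mul_of_nonneg_right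
        (mul_le_mul h1 h2 (norm_nonneg _) ((norm_nonneg _).trans h1)) h0
    · refine (ae_restrict_iff' measurableSet_Ioc).2 (Eventually.of_forall fun r hr => ?_)
      refine continuousOn_const.mul (ContinuousOn.mul ?_ ?_)
      · exact hF.comp (f := fun y : ℝ × ℝ => (y.1 - y.1 * r, y.2)) (by fun_prop)
          fun y hy => mem1 y hy r hr
      · exact hG.comp (f := fun y : ℝ × ℝ => (y.1 * r, y.2)) (by fun_prop)
          fun y hy => mem2 y hy r hr
  · intro t ht x hx
    beta_reduce
    rw [causalConv_eq_mul, ← intervalIntegral.integral_const_mul,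
      ← intervalIntegral.integral_const_mul]
    refine intervalIntegral.integral_congr_Ioo_of_le zero_le_one fun r hr => ?_
    have h1 : 0 < 1 - r := by linarith [hr.2]
    have m1 : t - t * r ∈ Ioc 0 T :=
      ⟨by nlinarith [ht.1, hr.2], by nlinarith [ht.1, ht.2, hr.1]⟩
    have m2 : t * r ∈ Ioc 0 T :=
      ⟨mul_pos ht.1 hr.1, by nlinarith [ht.1, ht.2, hr.2]⟩
    rw [hf _ m1 x hx, hg _ m2 x hx, Real.mul_rpow ht.1.le hr.1.le,
      show t - t * r = t * (1 - r) by ring, Real.mul_rpow ht.1.le h1.le,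
      Real.rpow_add ht.1, Real.rpow_add ht.1, Real.rpow_one]
    ring

lemma causalConv_integrand_intervalIntegrable {T t : ℝ} {f g : ℝ → ℝ} (hf : Sing T f)
    (hg : Sing T g) (ht : t ∈ Icc 0 T) :
    IntervalIntegrable (fun s => f (t - s) * g s) volume 0 t := by
  obtain ⟨hc, p, hp, C, hC⟩ := hf
  obtain ⟨hd, q, hq, D, hD⟩ := hg
  rw [intervalIntegrable_iff_integrableOn_Ioo_of_le ht.1]
  have hb := (intervalIntegrable_iff_integrableOn_Ioo_of_le ht.1).1
    (intervalIntegrable_rpow_mul_rpow hp hq ht.1)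
  have m1 : ∀ s ∈ Ioo 0 t, t - s ∈ Ioc 0 T := fun s hs =>
    ⟨by linarith [hs.2], by linarith [hs.1, ht.2]⟩
  have m2 : ∀ s ∈ Ioo 0 t, s ∈ Ioc 0 T := fun s hs => ⟨hs.1, by linarith [hs.2, ht.2]⟩
  refine (hb.const_mul (C * D)).mono' (ContinuousOn.aestronglyMeasurable ?_ measurableSet_Ioo) ?_
  · exact (hc.comp (by fun_prop) m1).mul (hd.mono m2)
  · refine (ae_restrict_iff' measurableSet_Ioo).2 (Eventually.of_forall fun s hs => ?_)
    rw [norm_mul]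
    have h1 := hC _ (m1 s hs)
    have h2 := hD _ (m2 s hs)
    calc ‖f (t - s)‖ * ‖g s‖ ≤ (C * (t - s) ^ p) * (D * s ^ q) :=
          mul_le_mul h1 h2 (norm_nonneg _) ((abs_nonneg _).trans h1)
      _ = _ := by ring

namespace Sing

variable {T : ℝ} {f g h : ℝ → ℝ}

lemma causalConv (hf : Sing T f) (hg : Sing T g) : Sing T (causalConv f g) :=
  sing_iff.2 ((sing_iff.1 hf).causalConv (sing_iff.1 hg))

lemma intervalIntegrable {t : ℝ} (hf : Sing T f) (ht : t ∈ Icc 0 T) :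
    IntervalIntegrable f volume 0 t := by
  simpa [rlKernel_one] using
    causalConv_integrand_intervalIntegrable (sing_rlKernel T one_pos) hf ht

lemma causalConv_add (hf : Sing T f) (hg : Sing T g) (hh : Sing T h) {t : ℝ} (ht : t ∈ Icc 0 T) :
    Hilfer.causalConv f (fun s => g s + h s) t =
      Hilfer.causalConv f g t + Hilfer.causalConv f h t := by
  simp only [Hilfer.causalConv]
  rw [← intervalIntegral.integral_add (causalConv_integrand_intervalIntegrable hf hg ht)
    (causalConv_integrand_intervalIntegrable hf hh ht)]
  exact intervalIntegral.integral_congr fun s _ => by ring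

lemma add_causalConv (hf : Sing T f) (hg : Sing T g) (hh : Sing T h) {t : ℝ} (ht : t ∈ Icc 0 T) :
    Hilfer.causalConv (fun s => f s + g s) h t =
      Hilfer.causalConv f h t + Hilfer.causalConv g h t := by
  rw [causalConv_comm, causalConv_add hh hf hg ht, causalConv_comm h f, causalConv_comm h g]

lemma causalConv_sub (hf : Sing T f) (hg : Sing T g) (hh : Sing T h) {t : ℝ} (ht : t ∈ Icc 0 T) :
    Hilfer.causalConv f (fun s => g s - h s) t =
      Hilfer.causalConv f g t - Hilfer.causalConv f h t := by
  have := causalConv_add hf hg (hh.const_mul (-1)) ht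
  rw [causalConv_const_mul_right] at this
  rw [sub_eq_add_neg, ← neg_one_mul (Hilfer.causalConv f h t), ← this]
  congr 1
  ext s
  ring

end Sing

/-- If `|f| ≤ A t^p` and `|g| ≤ B t^q`, then `|f * g| ≤ A B B(q+1,p+1) t^{p+q+1}`. -/
lemma abs_causalConv_le {T p q A B : ℝ} {f g : ℝ → ℝ} (hp : -1 < p) (hq : -1 < q)
    (hf : ∀ t ∈ Ioc 0 T, |f t| ≤ A * t ^ p) (hg : ∀ t ∈ Ioc 0 T, |g t| ≤ B * t ^ q) {t : ℝ}
    (ht : t ∈ Ioc 0 T) :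
    |causalConv f g t| ≤
      A * B * ProbabilityTheory.beta (q + 1) (p + 1) * t ^ (p + q + 1) := by
  rw [mul_assoc, ← integral_rpow_mul_rpow hp hq ht.1, ← intervalIntegral.integral_const_mul]
  rw [causalConv, ← Real.norm_eq_abs, intervalIntegral.integral_of_le ht.1.le,
    intervalIntegral.integral_of_le ht.1.le, integral_Ioc_eq_integral_Ioo,
    integral_Ioc_eq_integral_Ioo]
  have hb := (intervalIntegrable_iff_integrableOn_Ioo_of_le ht.1.le).1
    (intervalIntegrable_rpow_mul_rpow hp hq ht.1.le)
  refine norm_integral_le_of_norm_le (hb.const_mul _)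
    ((ae_restrict_iff' measurableSet_Ioo).2 (Eventually.of_forall fun s hs => ?_))
  rw [norm_mul]
  have h1 := hf (t - s) ⟨by linarith [hs.2], by linarith [hs.1, ht.2]⟩
  have h2 := hg s ⟨hs.1, by linarith [hs.2, ht.2]⟩
  calc ‖f (t - s)‖ * ‖g s‖ ≤ (A * (t - s) ^ p) * (B * s ^ q) :=
        mul_le_mul h1 h2 (norm_nonneg _) ((abs_nonneg _).trans h1)
    _ = _ := by ring

lemma causalConv_mono {T : ℝ} {f f' g g' : ℝ → ℝ} (hf : Sing T f) (hf' : Sing T f')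
    (hg : Sing T g) (hg' : Sing T g')
    (h0 : ∀ t ∈ Ioo 0 T, 0 ≤ f t) (h0' : ∀ t ∈ Ioo 0 T, 0 ≤ g' t)
    (hff : ∀ t ∈ Ioo 0 T, f t ≤ f' t) (hgg : ∀ t ∈ Ioo 0 T, g t ≤ g' t)
    {t : ℝ} (ht : t ∈ Icc 0 T) : causalConv f g t ≤ causalConv f' g' t := by
  refine intervalIntegral.integral_mono_on_of_le_Ioo ht.1
    (causalConv_integrand_intervalIntegrable hf hg ht)
    (causalConv_integrand_intervalIntegrable hf' hg' ht) fun s hs => ?_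
  have m1 : t - s ∈ Ioo 0 T := ⟨by linarith [hs.2], by linarith [hs.1, ht.2]⟩
  have m2 : s ∈ Ioo 0 T := ⟨hs.1, by linarith [hs.2, ht.2]⟩
  exact mul_le_mul_of_nonneg (hff _ m1) (hgg _ m2) (h0 _ m1) (h0' _ m2)

lemma causalConv_nonneg {T : ℝ} {f g : ℝ → ℝ} (hf : ∀ t ∈ Ioo 0 T, 0 ≤ f t)
    (hg : ∀ t ∈ Ioo 0 T, 0 ≤ g t) {t : ℝ} (ht : t ∈ Icc 0 T) : 0 ≤ causalConv f g t := by
  rw [causalConv, intervalIntegral.integral_of_le ht.1, integral_Ioc_eq_integral_Ioo]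
  refine setIntegral_nonneg measurableSet_Ioo fun s hs => ?_
  exact mul_nonneg (hf _ ⟨by linarith [hs.2], by linarith [hs.1, ht.2]⟩)
    (hg _ ⟨hs.1, by linarith [hs.2, ht.2]⟩)

lemma abs_causalConv_le_causalConv {T : ℝ} {f g g' : ℝ → ℝ} (hf : Sing T f) (hg : Sing T g)
    (hg' : Sing T g')
    (h0 : ∀ t ∈ Ioo 0 T, 0 ≤ f t) (hgg : ∀ t ∈ Ioo 0 T, |g t| ≤ g' t)
    {t : ℝ} (ht : t ∈ Icc 0 T) : |causalConv f g t| ≤ causalConv f g' t := by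
  have hn : ∀ t ∈ Ioo 0 T, 0 ≤ g' t := fun t ht => (abs_nonneg _).trans (hgg t ht)
  rw [abs_le]
  constructor
  · rw [neg_le, ← neg_one_mul, ← causalConv_const_mul_right]
    refine causalConv_mono hf hf (hg.const_mul _) hg' h0 hn (fun _ _ => le_rfl) (fun s hs => ?_) ht
    linarith [neg_le_abs (g s), hgg s hs]
  · exact causalConv_mono hf hf hg hg' h0 hn (fun _ _ => le_rfl)
      (fun s hs => (le_abs_self _).trans (hgg s hs)) ht

/-! ### Associativity -/

/-- The causal convolution is the convolution on `ℝ` of the functions cut off outside `(0,T]`. -/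
lemma convolution_indicator_eq {T t : ℝ} (f g : ℝ → ℝ) (ht : t ∈ Icc 0 T) :
    convolution ((Ioc 0 T).indicator g) ((Ioc 0 T).indicator f) (ContinuousLinearMap.mul ℝ ℝ)
      volume t = causalConv f g t := by
  rw [convolution_def, causalConv, intervalIntegral.integral_of_le ht.1,
    integral_Ioc_eq_integral_Ioo, ← integral_indicator measurableSet_Ioo]
  refine integral_congr_ae ?_
  have h0 : ∀ᵐ s : ℝ, s ≠ t := by simp [ae_iff, measure_singleton]
  filter_upwards [h0] with s hs
  simp only [ContinuousLinearMap.mul_apply', indicator_apply]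
  by_cases h1 : s ∈ Ioo 0 t
  · have e1 : s ∈ Ioc 0 T := ⟨h1.1, by linarith [h1.2, ht.2]⟩
    have e2 : t - s ∈ Ioc 0 T := ⟨by linarith [h1.2], by linarith [h1.1, ht.2]⟩
    simp only [h1, e1, e2, if_true, mul_comm]
  · rw [if_neg h1]
    by_cases h2 : 0 < s
    · have h3 : t - s ∉ Ioc 0 T := by
        intro h
        exact h1 ⟨h2, by linarith [h.1]⟩
      simp [h3]
    · have h3 : s ∉ Ioc 0 T := fun h => h2 h.1
      simp [h3]

lemma convolution_indicator_of_nonpos {T t : ℝ} (f g : ℝ → ℝ) (ht : t ≤ 0) :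
    convolution ((Ioc 0 T).indicator g) ((Ioc 0 T).indicator f) (ContinuousLinearMap.mul ℝ ℝ)
      volume t = 0 := by
  rw [convolution_def]
  refine integral_eq_zero_of_ae (Eventually.of_forall fun s => ?_)
  by_cases h2 : 0 < s
  · have h3 : t - s ∉ Ioc 0 T := by
      intro h
      linarith [h.1]
    simp [h3]
  · have h3 : s ∉ Ioc 0 T := fun h => h2 h.1
    simp [h3]

/-- Associativity at the point `t` for integrable functions whose threefold convolution converges
absolutely at `t`. -/
lemma causalConv_assoc_of_integrable {t : ℝ} {f g h : ℝ → ℝ} (ht : 0 < t)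
    (hf : IntegrableOn f (Ioc 0 t)) (hg : IntegrableOn g (Ioc 0 t)) (hh : IntegrableOn h (Ioc 0 t))
    (hfgh : IntervalIntegrable
      (fun s => causalConv (fun r => |f r|) (fun r => |g r|) (t - s) * |h s|) volume 0 t) :
    causalConv f (causalConv g h) t = causalConv (causalConv f g) h t := by
  have hf' := hf.integrable_indicator measurableSet_Ioc
  have hg' := hg.integrable_indicator measurableSet_Ioc
  have hh' := hh.integrable_indicator measurableSet_Ioc
  have key : ∀ u v : ℝ → ℝ, causalConv u v t = ∫ s, (Ioc 0 t).indicator v s *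
      (Ioc 0 t).indicator u (t - s) := by
    intro u v
    rw [← convolution_indicator_eq u v ⟨ht.le, le_rfl⟩, convolution_def]
    rfl
  have norm_ind : ∀ u : ℝ → ℝ, (fun x => ‖(Ioc 0 t).indicator u x‖) =
      (Ioc 0 t).indicator (fun r => |u r|) := by
    intro u
    ext x
    simp only [indicator_apply]
    split_ifs <;> simp
  have hassoc := convolution_assoc (L := ContinuousLinearMap.mul ℝ ℝ)
    (L₂ := ContinuousLinearMap.mul ℝ ℝ) (L₃ := ContinuousLinearMap.mul ℝ ℝ)
    (L₄ := ContinuousLinearMap.mul ℝ ℝ) (μ := volume) (ν := volume) (x₀ := t)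
    (f := (Ioc 0 t).indicator h) (g := (Ioc 0 t).indicator g) (k := (Ioc 0 t).indicator f)
    (fun x y z => mul_assoc x y z) hh'.aestronglyMeasurable hg'.aestronglyMeasurable
    hf'.aestronglyMeasurable (hh'.ae_convolution_exists _ hg')
    (hg'.norm.ae_convolution_exists _ hf'.norm) ?_
  · rw [convolution_def, convolution_def] at hassoc
    rw [key, key]
    convert hassoc using 1
    · refine integral_congr_ae (Eventually.of_forall fun s => ?_)
      simp only [ContinuousLinearMap.mul_apply', indicator_apply]
      by_cases h1 : s ∈ Ioc 0 t
      · rw [if_pos h1, convolution_indicator_eq g h ⟨h1.1.le, h1.2⟩]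
      · rw [if_neg h1]
        by_cases h2 : 0 < s
        · have h3 : t - s ∉ Ioc 0 t := by
            intro h
            exact h1 ⟨h2, by linarith [h.1]⟩
          simp [h3]
        · rw [convolution_indicator_of_nonpos _ _ (not_lt.1 h2)]
    · refine integral_congr_ae (Eventually.of_forall fun s => ?_)
      simp only [ContinuousLinearMap.mul_apply', indicator_apply]
      by_cases h1 : s ∈ Ioc 0 t
      · rw [if_pos h1]
        congr 1
        by_cases h2 : t - s ∈ Ioc 0 t
        · rw [if_pos h2, convolution_indicator_eq f g ⟨h2.1.le, h2.2⟩]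
        · rw [if_neg h2, convolution_indicator_of_nonpos]
          by_contra h3
          exact h2 ⟨not_le.1 h3, by linarith [h1.1]⟩
      · simp [h1]
  · rw [norm_ind, norm_ind, norm_ind]
    rw [intervalIntegrable_iff_integrableOn_Ioo_of_le ht.le] at hfgh
    refine (hfgh.integrable_indicator measurableSet_Ioo).congr ?_
    have h0 : ∀ᵐ s : ℝ, s ≠ t := by simp [ae_iff, measure_singleton]
    filter_upwards [h0] with s hs
    simp only [ContinuousLinearMap.mul_apply', indicator_apply (Ioo 0 t)]
    by_cases h1 : s ∈ Ioo 0 t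
    · rw [if_pos h1, convolution_indicator_eq (T := t) _ _ (t := t - s)
          ⟨by linarith [h1.2], by linarith [h1.1]⟩,
        indicator_of_mem (show s ∈ Ioc 0 t from ⟨h1.1, h1.2.le⟩), mul_comm]
    · rw [if_neg h1, indicator_of_notMem, zero_mul]
      intro h2
      exact h1 ⟨h2.1, lt_of_le_of_ne h2.2 hs⟩

lemma Sing.integrableOn {T : ℝ} {f : ℝ → ℝ} (hf : Sing T f) {t : ℝ} (ht : t ∈ Icc 0 T) :
    IntegrableOn f (Ioc 0 t) :=
  (intervalIntegrable_iff_integrableOn_Ioc_of_le ht.1).1 (hf.intervalIntegrable ht)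

lemma Sing.causalConv_assoc {T : ℝ} {f g h : ℝ → ℝ} (hf : Sing T f) (hg : Sing T g)
    (hh : Sing T h) {t : ℝ} (ht : t ∈ Icc 0 T) :
    Hilfer.causalConv f (Hilfer.causalConv g h) t =
      Hilfer.causalConv (Hilfer.causalConv f g) h t := by
  rcases ht.1.eq_or_lt with h0 | h0
  · subst h0; simp [Hilfer.causalConv]
  exact causalConv_assoc_of_integrable h0 (hf.integrableOn ht) (hg.integrableOn ht)
    (hh.integrableOn ht) (causalConv_integrand_intervalIntegrable (hf.abs.causalConv hg.abs)
      hh.abs ht)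

lemma Sing.causalConv_left_comm {T : ℝ} {f g h : ℝ → ℝ} (hf : Sing T f) (hg : Sing T g)
    (hh : Sing T h) {t : ℝ} (ht : t ∈ Icc 0 T) :
    Hilfer.causalConv f (Hilfer.causalConv g h) t =
      Hilfer.causalConv g (Hilfer.causalConv f h) t := by
  rw [hf.causalConv_assoc hg hh ht, hg.causalConv_assoc hf hh ht]
  exact causalConv_congr ht (fun s _ => causalConv_comm f g s) fun _ _ => rfl

/-! ### Fractional integrals -/

lemma fracInt_zero (f : ℝ → ℝ) : fracInt 0 f = f := by
  ext t; simp [fracInt]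

lemma fracInt_eq_causalConv {a : ℝ} (ha : 0 < a) (f : ℝ → ℝ) :
    fracInt a f = causalConv (rlKernel a) f := by
  ext t
  rw [fracInt, if_neg ha.ne', causalConv, ← intervalIntegral.integral_const_mul]
  refine intervalIntegral.integral_congr fun s _ => ?_
  simp only [rlKernel]
  ring

lemma fracInt_one (f : ℝ → ℝ) (t : ℝ) : fracInt 1 f t = ∫ s in (0 : ℝ)..t, f s := by
  rw [fracInt_eq_causalConv one_pos, causalConv_one_left]

lemma fracInt_congr {a t : ℝ} {f g : ℝ → ℝ} (ha : 0 ≤ a) (ht : 0 < t)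
    (h : ∀ s ∈ Ioc 0 t, f s = g s) : fracInt a f t = fracInt a g t := by
  rcases ha.eq_or_lt with rfl | ha
  · simpa [fracInt_zero] using h t ⟨ht, le_rfl⟩
  · rw [fracInt_eq_causalConv ha, fracInt_eq_causalConv ha]
    exact causalConv_congr (T := t) ⟨ht.le, le_rfl⟩ (fun _ _ => rfl)
      fun s hs => h s ⟨hs.1, hs.2.le⟩

lemma fracInt_const_mul {a : ℝ} (ha : 0 ≤ a) (c : ℝ) (f : ℝ → ℝ) (t : ℝ) :
    fracInt a (fun s => c * f s) t = c * fracInt a f t := by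
  rcases ha.eq_or_lt with rfl | ha
  · simp [fracInt_zero]
  · rw [fracInt_eq_causalConv ha, fracInt_eq_causalConv ha, causalConv_const_mul_right]

lemma _root_.MemC.fracInt {T a : ℝ} (ha : 0 ≤ a) {f : ℝ → ℝ → ℝ} (hf : MemC T f) :
    MemC T (fun t x => fracInt a (fun s => f s x) t) := by
  rcases ha.eq_or_lt with rfl | ha
  · simpa [fracInt_zero] using hf
  · simp only [fracInt_eq_causalConv ha]
    exact (sing_iff.1 (sing_rlKernel T ha)).causalConv hf

namespace Sing

variable {T : ℝ} {f g : ℝ → ℝ}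

lemma fracInt {a : ℝ} (ha : 0 ≤ a) (hf : Sing T f) : Sing T (fracInt a f) :=
  sing_iff.2 ((sing_iff.1 hf).fracInt ha)

lemma fracInt_add {a : ℝ} (ha : 0 ≤ a) (hf : Sing T f) (hg : Sing T g) {t : ℝ}
    (ht : t ∈ Icc 0 T) :
    _root_.fracInt a (fun s => f s + g s) t = _root_.fracInt a f t + _root_.fracInt a g t := by
  rcases ha.eq_or_lt with rfl | ha
  · simp [fracInt_zero]
  · simp only [fracInt_eq_causalConv ha]
    exact (sing_rlKernel T ha).causalConv_add hf hg ht

lemma fracInt_sub {a : ℝ} (ha : 0 ≤ a) (hf : Sing T f) (hg : Sing T g) {t : ℝ}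
    (ht : t ∈ Icc 0 T) :
    _root_.fracInt a (fun s => f s - g s) t = _root_.fracInt a f t - _root_.fracInt a g t := by
  rcases ha.eq_or_lt with rfl | ha
  · simp [fracInt_zero]
  · simp only [fracInt_eq_causalConv ha]
    exact (sing_rlKernel T ha).causalConv_sub hf hg ht

lemma fracInt_causalConv {a : ℝ} (ha : 0 ≤ a) (hf : Sing T f) (hg : Sing T g) {t : ℝ}
    (ht : t ∈ Icc 0 T) :
    _root_.fracInt a (Hilfer.causalConv f g) t =
      Hilfer.causalConv (_root_.fracInt a f) g t := by
  rcases ha.eq_or_lt with rfl | ha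
  · simp [fracInt_zero]
  · simp only [fracInt_eq_causalConv ha]
    exact (sing_rlKernel T ha).causalConv_assoc hf hg ht

lemma fracInt_causalConv' {a : ℝ} (ha : 0 ≤ a) (hf : Sing T f) (hg : Sing T g) {t : ℝ}
    (ht : t ∈ Icc 0 T) :
    _root_.fracInt a (Hilfer.causalConv f g) t =
      Hilfer.causalConv f (_root_.fracInt a g) t := by
  rcases ha.eq_or_lt with rfl | ha
  · simp [fracInt_zero]
  · simp only [fracInt_eq_causalConv ha]
    exact (sing_rlKernel T ha).causalConv_left_comm hf hg ht

lemma fracInt_fracInt {a b : ℝ} (ha : 0 ≤ a) (hb : 0 ≤ b) (hf : Sing T f) {t : ℝ}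
    (ht : t ∈ Ioc 0 T) :
    _root_.fracInt a (_root_.fracInt b f) t = _root_.fracInt (a + b) f t := by
  rcases ha.eq_or_lt with rfl | ha
  · simp [fracInt_zero]
  rcases hb.eq_or_lt with rfl | hb
  · simp [fracInt_zero]
  · rw [fracInt_eq_causalConv ha, fracInt_eq_causalConv hb, fracInt_eq_causalConv (add_pos ha hb),
      (sing_rlKernel T ha).causalConv_assoc (sing_rlKernel T hb) hf (Ioc_subset_Icc_self ht)]
    exact causalConv_congr (Ioc_subset_Icc_self ht)
      (fun s hs => causalConv_rlKernel ha hb hs.1) fun _ _ => rfl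

lemma hasDerivAt_fracInt_one (hf : Sing T f) {t : ℝ} (ht : t ∈ Ioo 0 T) :
    HasDerivAt (_root_.fracInt 1 f) (f t) t := by
  have : _root_.fracInt 1 f = fun t => ∫ s in (0 : ℝ)..t, f s := funext (fracInt_one f)
  rw [this]
  have hn : Ioc 0 T ∈ 𝓝 t := Ioc_mem_nhds ht.1 ht.2
  refine intervalIntegral.integral_hasDerivAt_right
    (hf.intervalIntegrable ⟨ht.1.le, ht.2.le⟩) ?_ (hf.1.continuousAt hn)
  exact hf.1.stronglyMeasurableAtFilter_nhdsWithin measurableSet_Ioc t |>.filter_mono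
    (by rw [nhdsWithin_eq_nhds.2 hn])

lemma eqOn_Ioc (hf : Sing T f) (hg : Sing T g) (h : ∀ t ∈ Ioo 0 T, f t = g t) {t : ℝ}
    (ht : t ∈ Ioc 0 T) : f t = g t := by
  have hT : 0 < T := ht.1.trans_le ht.2
  have : EqOn f g (Ioc 0 T) := by
    refine EqOn.of_subset_closure (s := Ioo 0 T) h hf.1 hg.1 Ioo_subset_Ioc_self ?_
    rw [closure_Ioo hT.ne]
    exact Ioc_subset_Icc_self
  exact this ht

/-- A function of the class is determined by its antiderivative. -/
lemma eq_of_fracInt_one_eq (hf : Sing T f) (hg : Sing T g)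
    (h : ∀ t ∈ Ioo 0 T, _root_.fracInt 1 f t = _root_.fracInt 1 g t) {t : ℝ} (ht : t ∈ Ioc 0 T) :
    f t = g t := by
  refine hf.eqOn_Ioc hg (fun s hs => ?_) ht
  have h1 := (hf.hasDerivAt_fracInt_one hs).congr_of_eventuallyEq
    (f₁ := _root_.fracInt 1 g) (by
      filter_upwards [Ioo_mem_nhds hs.1 hs.2] with r hr using (h r hr).symm)
  exact h1.unique (hg.hasDerivAt_fracInt_one hs)

lemma tendsto_fracInt_one (hT : 0 < T) (hf : Sing T f) :
    Tendsto (_root_.fracInt 1 f) (𝓝[>] 0) (𝓝 0) := by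
  have h := intervalIntegral.continuousOn_primitive_interval'
    (hf.intervalIntegrable ⟨hT.le, le_rfl⟩) left_mem_uIcc
  have h0 := h 0 left_mem_uIcc
  rw [ContinuousWithinAt, intervalIntegral.integral_same, uIcc_of_le hT.le] at h0
  have h1 : Tendsto (fun t => ∫ s in (0 : ℝ)..t, f s) (𝓝[>] 0) (𝓝 0) := by
    refine h0.mono_left ?_
    rw [← nhdsWithin_Ioo_eq_nhdsGT hT]
    exact nhdsWithin_mono _ Ioo_subset_Icc_self
  exact h1.congr fun t => (fracInt_one f t).symm

end Sing

lemma eq_integral_of_hasDerivAt_of_tendsto {t : ℝ} {w w' : ℝ → ℝ} (ht : 0 < t)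
    (hd : ∀ s ∈ Ioc 0 t, HasDerivAt w (w' s) s) (hi : IntervalIntegrable w' volume 0 t)
    (h0 : Tendsto w (𝓝[>] 0) (𝓝 0)) : w t = ∫ s in (0 : ℝ)..t, w' s := by
  have h1 : Tendsto w (𝓝[<] t) (𝓝 (w t)) :=
    ((hd t ⟨ht, le_rfl⟩).continuousAt.tendsto).mono_left nhdsWithin_le_nhds
  rw [intervalIntegral.integral_eq_sub_of_hasDerivAt_of_tendsto ht
    (fun s hs => hd s ⟨hs.1, hs.2.le⟩) hi h0 h1, sub_zero]

/-! ### Series of singular functions -/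

section Series

variable {T p : ℝ} {f : ℕ → ℝ → ℝ} {c : ℕ → ℝ}

lemma summable_of_bound (hb : ∀ n, ∀ t ∈ Ioc 0 T, |f n t| ≤ c n * t ^ p) (hc : Summable c)
    {t : ℝ} (ht : t ∈ Ioc 0 T) : Summable fun n => f n t :=
  Summable.of_norm_bounded (hc.mul_right _) fun n => hb n t ht

lemma abs_tsum_le_of_bound (hb : ∀ n, ∀ t ∈ Ioc 0 T, |f n t| ≤ c n * t ^ p) (hc : Summable c)
    {t : ℝ} (ht : t ∈ Ioc 0 T) : |∑' n, f n t| ≤ (∑' n, c n) * t ^ p :=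
  tsum_of_norm_bounded (E := ℝ) (hc.hasSum.mul_right (t ^ p)) fun n => hb n t ht

/-- The Weierstrass test in `C_{-1}`: the weight `t^{-p}` makes the series uniformly convergent. -/
lemma memC_tsum (hp : -1 < p) (hf : ∀ n, Sing T (f n))
    (hb : ∀ n, ∀ t ∈ Ioc 0 T, |f n t| ≤ c n * t ^ p) (hc : Summable c)
    {e : ℕ → ℝ → ℝ} (he : ∀ n, Continuous (e n)) (he1 : ∀ n x, |e n x| ≤ 1) :
    MemC T (fun t x => ∑' n, e n x * f n t) := by
  have hb' : ∀ n, ∀ q ∈ Ioc 0 T ×ˢ Icc (0:ℝ) 1, |e n q.2 * f n q.1| ≤ c n * q.1 ^ p := by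
    intro n q hq
    rw [abs_mul]
    exact (mul_le_of_le_one_left (abs_nonneg _) (he1 n _)).trans (hb n _ hq.1)
  refine memC_iff.2 ⟨?_, p, hp, ∑' n, c n, fun t ht x hx => ?_⟩
  · have h1 : ContinuousOn (fun q : ℝ × ℝ => ∑' n, q.1 ^ (-p) * (e n q.2 * f n q.1))
        (Ioc 0 T ×ˢ Icc 0 1) := by
      refine continuousOn_tsum (u := c) (fun n => ?_) hc fun n q hq => ?_
      · refine ContinuousOn.mul ?_ (ContinuousOn.mul ((he n).comp continuous_snd).continuousOn ?_)
        · exact continuousOn_fst.rpow_const fun q hq => Or.inl hq.1.1.ne'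
        · exact (hf n).1.comp continuousOn_fst fun q hq => hq.1
      · have hq0 := Real.rpow_pos_of_pos hq.1.1 (-p)
        rw [norm_mul, Real.norm_of_nonneg hq0.le, Real.norm_eq_abs]
        calc q.1 ^ (-p) * |e n q.2 * f n q.1| ≤ q.1 ^ (-p) * (c n * q.1 ^ p) :=
              mul_le_mul_of_nonneg_left (hb' n q hq) hq0.le
          _ = c n * (q.1 ^ (-p) * q.1 ^ p) := by ring
          _ = c n := by rw [← Real.rpow_add hq.1.1]; simp
    have h2 : ContinuousOn (fun q : ℝ × ℝ => q.1 ^ p * ∑' n, q.1 ^ (-p) * (e n q.2 * f n q.1))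
        (Ioc 0 T ×ˢ Icc 0 1) :=
      ContinuousOn.mul (continuousOn_fst.rpow_const fun q hq => Or.inl hq.1.1.ne') h1
    refine h2.congr fun q hq => ?_
    simp only
    rw [tsum_mul_left, ← mul_assoc, ← Real.rpow_add hq.1.1]
    simp
  · exact tsum_of_norm_bounded (E := ℝ) (hc.hasSum.mul_right (t ^ p)) fun n => hb' n (t, x) ⟨ht, hx⟩

lemma sing_tsum (hp : -1 < p) (hf : ∀ n, Sing T (f n))
    (hb : ∀ n, ∀ t ∈ Ioc 0 T, |f n t| ≤ c n * t ^ p) (hc : Summable c) :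
    Sing T (fun t => ∑' n, f n t) := by
  have := memC_tsum hp hf hb hc (e := fun _ _ => 1) (fun _ => continuous_const) (by simp)
  simp only [one_mul] at this
  exact sing_iff.2 this

lemma hasSum_causalConv (hp : -1 < p) (hf : ∀ n, Sing T (f n))
    (hb : ∀ n, ∀ t ∈ Ioc 0 T, |f n t| ≤ c n * t ^ p) (hc : Summable c) {κ : ℝ → ℝ}
    (hκ : Sing T κ) {t : ℝ} (ht : t ∈ Icc 0 T) :
    HasSum (fun n => causalConv κ (f n) t) (causalConv κ (fun s => ∑' n, f n s) t) := by
  have hpow : Sing T (fun s => s ^ p) :=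
    ⟨continuousOn_id.rpow_const fun s hs => Or.inl hs.1.ne', p, hp, 1, fun s hs => by
      rw [abs_of_pos (Real.rpow_pos_of_pos hs.1 _), one_mul]⟩
  have hint := causalConv_integrand_intervalIntegrable hκ.abs hpow ht
  have hmem : ∀ s ∈ Ioo 0 t, s ∈ Ioc 0 T := fun s hs => ⟨hs.1, by linarith [hs.2, ht.2]⟩
  simp only [causalConv, intervalIntegral.integral_of_le ht.1, integral_Ioc_eq_integral_Ioo]
  rw [intervalIntegrable_iff_integrableOn_Ioo_of_le ht.1] at hint
  refine hasSum_integral_of_dominated_convergence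
    (fun n s => c n * (|κ (t - s)| * s ^ p)) (fun n => ?_) (fun n => ?_) ?_ ?_ ?_
  · exact ((intervalIntegrable_iff_integrableOn_Ioo_of_le ht.1).1
      (causalConv_integrand_intervalIntegrable hκ (hf n) ht)).aestronglyMeasurable
  · refine (ae_restrict_iff' measurableSet_Ioo).2 (Eventually.of_forall fun s hs => ?_)
    rw [norm_mul, Real.norm_eq_abs, Real.norm_eq_abs, mul_left_comm]
    exact mul_le_mul_of_nonneg_left (hb n s (hmem s hs)) (abs_nonneg _)
  · exact Eventually.of_forall fun s => hc.mul_right _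
  · simp only [tsum_mul_right]
    exact hint.const_mul _
  · refine (ae_restrict_iff' measurableSet_Ioo).2 (Eventually.of_forall fun s hs => ?_)
    exact (summable_of_bound hb hc (hmem s hs)).hasSum.mul_left _

lemma hasSum_fracInt (hp : -1 < p) (hf : ∀ n, Sing T (f n))
    (hb : ∀ n, ∀ t ∈ Ioc 0 T, |f n t| ≤ c n * t ^ p) (hc : Summable c) {a : ℝ} (ha : 0 ≤ a)
    {t : ℝ} (ht : t ∈ Ioc 0 T) :
    HasSum (fun n => fracInt a (f n) t) (fracInt a (fun s => ∑' n, f n s) t) := by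
  rcases ha.eq_or_lt with rfl | ha
  · simpa [fracInt_zero] using (summable_of_bound hb hc ht).hasSum
  · simp only [fracInt_eq_causalConv ha]
    exact hasSum_causalConv hp hf hb hc (sing_rlKernel T ha) (Ioc_subset_Icc_self ht)

end Series

/-! ### The Mittag-Leffler kernels -/

/-- The function `t^{b-1} E_{(a-c,a),b}(-μ t^{a-c}, -l t^a)`, which solves the Volterra equation
`y + μ I^{a-c} y + l I^a y = t^{b-1} / Γ(b)`. -/
noncomputable def mlKernel (a c μ l b t : ℝ) : ℝ :=
  t ^ (b - 1) * mittagLefflerTwo a c b (-μ * t ^ (a - c)) (-l * t ^ a)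

/-- The `n`-th term of the Neumann series of `y + μ I^d y + l I^a y = t^{b-1} / Γ(b)`. -/
noncomputable def neumannTerm (a d μ l b : ℝ) (n : ℕ) (t : ℝ) : ℝ :=
  ∑ ij ∈ Finset.HasAntidiagonal.antidiagonal n,
    (n.choose ij.1 : ℝ) * ((-μ) ^ ij.1 * (-l) ^ ij.2 * rlKernel (b + d * ij.1 + a * ij.2) t)

lemma mlKernel_eq_tsum (a c μ l b : ℝ) {t : ℝ} (ht : 0 < t) :
    mlKernel a c μ l b t = ∑' n, neumannTerm a (a - c) μ l b n t := by
  rw [mlKernel, mittagLefflerTwo, ← tsum_mul_left]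
  refine tsum_congr fun n => ?_
  rw [neumannTerm, Finset.Nat.sum_antidiagonal_eq_sum_range_succ (fun i j =>
    (n.choose i : ℝ) * ((-μ) ^ i * (-l) ^ j * rlKernel (b + (a - c) * i + a * j) t)),
    Finset.mul_sum]
  refine Finset.sum_congr rfl fun i hi => ?_
  have hin : i ≤ n := Nat.lt_succ_iff.1 (Finset.mem_range.1 hi)
  rw [rlKernel, mul_pow, mul_pow, ← Real.rpow_natCast (t ^ (a - c)), ← Real.rpow_mul ht.le,
    ← Real.rpow_natCast (t ^ a), ← Real.rpow_mul ht.le, Nat.cast_sub hin,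
    show b + (a - c) * (i : ℝ) + a * ((n : ℝ) - i) = b + a * n - c * i by ring,
    show b + a * (n : ℝ) - c * i - 1 = (b - 1) + (a - c) * i + a * ((n : ℝ) - i) by ring,
    Real.rpow_add ht, Real.rpow_add ht]
  ring

lemma Sing.finset_sum {ι : Type*} {T : ℝ} (s : Finset ι) {f : ι → ℝ → ℝ}
    (hf : ∀ i ∈ s, Sing T (f i)) : Sing T (fun t => ∑ i ∈ s, f i t) := by
  classical
  induction s using Finset.induction_on with
  | empty => simpa using (continuousOn_const (c := (0 : ℝ))).sing
  | insert i s hi ih =>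
    simp only [Finset.sum_insert hi]
    exact (hf i (Finset.mem_insert_self _ _)).add
      (ih fun j hj => hf j (Finset.mem_insert_of_mem hj))

lemma Sing.causalConv_finset_sum {ι : Type*} {T : ℝ} (s : Finset ι) {κ : ℝ → ℝ} {f : ι → ℝ → ℝ}
    (hκ : Sing T κ) (hf : ∀ i ∈ s, Sing T (f i)) {t : ℝ} (ht : t ∈ Icc 0 T) :
    Hilfer.causalConv κ (fun t => ∑ i ∈ s, f i t) t = ∑ i ∈ s, Hilfer.causalConv κ (f i) t := by
  simp only [Hilfer.causalConv, Finset.mul_sum]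
  exact intervalIntegral.integral_finsetSum fun i hi =>
    causalConv_integrand_intervalIntegrable hκ (hf i hi) ht

section

variable {a d μ l b : ℝ}

lemma sing_neumannTerm (T : ℝ) (ha : 0 < a) (hd : 0 < d) (hb : 0 < b) (n : ℕ) :
    Sing T (neumannTerm a d μ l b n) :=
  Sing.finset_sum _ fun ij _ => ((sing_rlKernel T (by positivity)).const_mul _).const_mul _

lemma neumannTerm_zero : neumannTerm a d μ l b 0 = rlKernel b := by
  ext t; simp [neumannTerm]

/-- Pascal's rule together with the semigroup law of the kernels. -/
lemma neumannTerm_succ (ha : 0 < a) (hd : 0 < d) (hb : 0 < b) (n : ℕ) {t : ℝ} (ht : 0 < t) :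
    neumannTerm a d μ l b (n + 1) t =
      -μ * causalConv (rlKernel d) (neumannTerm a d μ l b n) t -
        l * causalConv (rlKernel a) (neumannTerm a d μ l b n) t := by
  have hsing : ∀ ij ∈ Finset.HasAntidiagonal.antidiagonal n, Sing t (fun t => (n.choose ij.1 : ℝ) *
      ((-μ) ^ ij.1 * (-l) ^ ij.2 * rlKernel (b + d * ij.1 + a * ij.2) t)) :=
    fun ij _ => ((sing_rlKernel t (by positivity)).const_mul _).const_mul _
  have htt : t ∈ Icc 0 t := ⟨ht.le, le_rfl⟩
  have expand : ∀ e : ℝ, 0 < e → causalConv (rlKernel e) (neumannTerm a d μ l b n) t =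
      ∑ ij ∈ Finset.HasAntidiagonal.antidiagonal n, (n.choose ij.1 : ℝ) *
        ((-μ) ^ ij.1 * (-l) ^ ij.2 * rlKernel (e + (b + d * ij.1 + a * ij.2)) t) := by
    intro e he
    have := (sing_rlKernel t he).causalConv_finset_sum _ hsing htt
    refine this.trans (Finset.sum_congr rfl fun ij _ => ?_)
    rw [causalConv_const_mul_right, causalConv_const_mul_right,
      causalConv_rlKernel he (by positivity) ht]
  rw [neumannTerm, Finset.sum_antidiagonal_choose_succ_mul
    (fun i j => (-μ) ^ i * (-l) ^ j * rlKernel (b + d * i + a * j) t), expand a ha, expand d hd,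
    Finset.mul_sum, Finset.mul_sum, sub_eq_neg_add, ← Finset.sum_neg_distrib]
  congr 1
  · refine Finset.sum_congr rfl fun ij _ => ?_
    push_cast
    rw [show a + (b + d * ij.1 + a * ij.2) = b + d * ij.1 + a * (ij.2 + 1) by ring]
    ring
  · refine Finset.sum_congr rfl fun ij hij => ?_
    push_cast
    rw [show d + (b + d * ij.1 + a * ij.2) = b + d * (ij.1 + 1) + a * ij.2 by ring,
      ← Nat.choose_symm_of_eq_add (Finset.HasAntidiagonal.mem_antidiagonal.1 hij).symm]
    ring

/-- From `Γ(β+1) ≥ ∫_L^∞ x^β e^{-x} dx ≥ L^β e^{-L}`. -/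
lemma one_div_Gamma_le {β L : ℝ} (hβ : 0 < β) (hL : 0 < L) :
    1 / Real.Gamma β ≤ β * Real.exp L * L ^ (-β) := by
  have h1 : L ^ β * Real.exp (-L) ≤ Real.Gamma (β + 1) := by
    rw [Real.Gamma_eq_integral (by linarith), ← integral_exp_neg_Ioi, ← integral_const_mul]
    have hconv := Real.GammaIntegral_convergent (show 0 < β + 1 by linarith)
    refine (setIntegral_mono_on ((integrableOn_exp_neg_Ioi L).const_mul _)
      (hconv.mono_set (Ioi_subset_Ioi hL.le)) measurableSet_Ioi fun x hx => ?_).trans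
      (setIntegral_mono_set hconv ?_ (Ioi_subset_Ioi hL.le).eventuallyLE)
    · rw [mul_comm, add_sub_cancel_right]
      exact mul_le_mul_of_nonneg_left (Real.rpow_le_rpow hL.le (le_of_lt hx) hβ.le)
        (Real.exp_pos _).le
    · refine (ae_restrict_iff' measurableSet_Ioi).2 (Eventually.of_forall fun x hx => ?_)
      exact mul_nonneg (Real.exp_pos _).le (Real.rpow_nonneg (le_of_lt hx) _)
  have hG := Real.Gamma_pos_of_pos hβ
  rw [Real.Gamma_add_one hβ.ne', Real.exp_neg] at h1
  rw [Real.rpow_neg hL.le, div_le_iff₀ hG]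
  have hLb := Real.rpow_pos_of_pos hL β
  have he := Real.exp_pos L
  calc (1 : ℝ) = (L ^ β * (Real.exp L)⁻¹) * (Real.exp L * (L ^ β)⁻¹) := by field_simp
    _ ≤ (β * Real.Gamma β) * (Real.exp L * (L ^ β)⁻¹) :=
        mul_le_mul_of_nonneg_right h1 (by positivity)
    _ = _ := by ring

/-- The Neumann series converges like a geometric series, since `1 / Γ` decays faster than any
exponential. -/
lemma exists_neumannTerm_bound {T : ℝ} (hT : 0 < T) (hd : 0 < d) (had : d ≤ a)
    (hb : 0 < b) (μ l : ℝ) : ∃ c : ℕ → ℝ, Summable c ∧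
      ∀ n, ∀ t ∈ Ioc 0 T, |neumannTerm a d μ l b n t| ≤ c n * t ^ (b - 1) := by
  have ha : 0 < a := hd.trans_le had
  obtain ⟨Z, hZ⟩ : ∃ Z, Z = |μ| * T ^ d + |l| * T ^ a := ⟨_, rfl⟩
  have hZ0 : 0 ≤ Z := hZ ▸ by positivity
  -- `L` is chosen so that `L^d` dominates twice the ratio `Z` of the binomial sums
  obtain ⟨L, hLdef⟩ : ∃ L : ℝ, L = (1 + 2 * Z) ^ (1 / d) := ⟨_, rfl⟩
  have hL1 : 1 ≤ L := hLdef ▸ Real.one_le_rpow (by linarith) (by positivity)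
  have hL0 : 0 < L := by linarith
  have hLd : L ^ d = 1 + 2 * Z := by
    rw [hLdef, ← Real.rpow_mul (by linarith), one_div, inv_mul_cancel₀ hd.ne', Real.rpow_one]
  refine ⟨fun n => (b + a * n) * Real.exp L * L ^ (-b) * (1 / 2) ^ n, ?_, fun n t ht => ?_⟩
  · have h1 : Summable fun n : ℕ => (1 / 2 : ℝ) ^ n := summable_geometric_two
    have h2 : Summable fun n : ℕ => (n : ℝ) * (1 / 2 : ℝ) ^ n := by
      simpa using summable_pow_mul_geometric_of_norm_lt_one 1
        (show ‖(1 / 2 : ℝ)‖ < 1 by norm_num)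
    have h3 := ((h1.mul_left b).add (h2.mul_left a)).mul_left (Real.exp L * L ^ (-b))
    refine h3.congr fun n => ?_
    ring
  · have key : ∀ ij ∈ Finset.HasAntidiagonal.antidiagonal n,
        |(n.choose ij.1 : ℝ) * ((-μ) ^ ij.1 * (-l) ^ ij.2 * rlKernel (b + d * ij.1 + a * ij.2) t)|
        ≤ ((n.choose ij.1 : ℝ) * ((|μ| * T ^ d) ^ ij.1 * (|l| * T ^ a) ^ ij.2)) *
          ((b + a * n) * Real.exp L * (L ^ (-b) * ((1 + 2 * Z) ^ n)⁻¹) * t ^ (b - 1)) := by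
      intro ij hij
      have hn : (n : ℝ) = ij.1 + ij.2 := by
        rw [← Finset.HasAntidiagonal.mem_antidiagonal.1 hij]; push_cast; ring
      have hβ : 0 < b + d * ij.1 + a * ij.2 := by positivity
      have hG : 1 / Real.Gamma (b + d * ij.1 + a * ij.2) ≤
          (b + a * n) * Real.exp L * (L ^ (-b) * ((1 + 2 * Z) ^ n)⁻¹) := by
        refine (one_div_Gamma_le hβ hL0).trans ?_
        have e1 : L ^ (-(b + d * ij.1 + a * ij.2)) ≤ L ^ (-b + -(d * n)) := by
          refine Real.rpow_le_rpow_of_exponent_le hL1 ?_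
          have : d * (ij.2 : ℝ) ≤ a * ij.2 := mul_le_mul_of_nonneg_right had (by positivity)
          rw [hn]; linarith
        have e2 : L ^ (-b + -(d * (n : ℝ))) = L ^ (-b) * ((1 + 2 * Z) ^ n)⁻¹ := by
          rw [Real.rpow_add hL0, Real.rpow_neg hL0.le (d * n), Real.rpow_mul hL0.le, hLd,
            Real.rpow_natCast]
        have e3 : b + d * ij.1 + a * ij.2 ≤ b + a * n := by
          have : d * (ij.1 : ℝ) ≤ a * ij.1 := mul_le_mul_of_nonneg_right had (by positivity)
          rw [hn]; linarith
        rw [← e2]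
        gcongr
      have hpow : t ^ (b + d * ij.1 + a * ij.2 - 1) ≤
          (T ^ d) ^ ij.1 * (T ^ a) ^ ij.2 * t ^ (b - 1) := by
        rw [show b + d * ij.1 + a * ij.2 - 1 = d * ij.1 + a * ij.2 + (b - 1) by ring,
          Real.rpow_add ht.1, Real.rpow_add ht.1, Real.rpow_mul ht.1.le, Real.rpow_mul ht.1.le,
          Real.rpow_natCast, Real.rpow_natCast]
        have := Real.rpow_nonneg ht.1.le (b - 1)
        have hdT := Real.rpow_le_rpow ht.1.le ht.2 hd.le
        have haT := Real.rpow_le_rpow ht.1.le ht.2 ha.le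
        have := Real.rpow_nonneg ht.1.le d
        have := Real.rpow_nonneg ht.1.le a
        gcongr
      rw [abs_mul, abs_mul, abs_mul, abs_pow, abs_pow, abs_neg, abs_neg, Nat.abs_cast,
        abs_of_nonneg (rlKernel_nonneg hβ ht.1.le), rlKernel, div_eq_mul_one_div, mul_pow, mul_pow]
      have hG0 : 0 ≤ 1 / Real.Gamma (b + d * ij.1 + a * ij.2) := by
        have := Real.Gamma_pos_of_pos hβ
        positivity
      have ht0 := Real.rpow_nonneg ht.1.le (b - 1)
      calc _ ≤ (n.choose ij.1 : ℝ) * (|μ| ^ ij.1 * |l| ^ ij.2 *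
            (((T ^ d) ^ ij.1 * (T ^ a) ^ ij.2 * t ^ (b - 1)) *
              ((b + a * n) * Real.exp L * (L ^ (-b) * ((1 + 2 * Z) ^ n)⁻¹)))) := by
            gcongr
        _ = _ := by ring
    refine (Finset.abs_sum_le_sum_abs _ _).trans ((Finset.sum_le_sum key).trans ?_)
    rw [← Finset.sum_mul]
    have hbin : ∑ ij ∈ Finset.HasAntidiagonal.antidiagonal n,
        (n.choose ij.1 : ℝ) * ((|μ| * T ^ d) ^ ij.1 * (|l| * T ^ a) ^ ij.2) = Z ^ n := by
      rw [hZ, (Commute.all (|μ| * T ^ d) (|l| * T ^ a)).add_pow']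
      simp [nsmul_eq_mul]
    rw [hbin]
    have hq : Z ^ n * ((1 + 2 * Z) ^ n)⁻¹ ≤ (1 / 2) ^ n := by
      rw [← inv_pow, ← mul_pow]
      refine pow_le_pow_left₀ (by positivity) ?_ n
      rw [← div_eq_mul_inv, div_le_div_iff₀ (by linarith) two_pos]
      linarith
    have ht0 := Real.rpow_nonneg ht.1.le (b - 1)
    have hLb := Real.rpow_nonneg hL0.le (-b)
    calc _ = ((b + a * n) * Real.exp L * L ^ (-b)) * (Z ^ n * ((1 + 2 * Z) ^ n)⁻¹) * t ^ (b - 1) := by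
          ring
      _ ≤ ((b + a * n) * Real.exp L * L ^ (-b)) * (1 / 2) ^ n * t ^ (b - 1) := by gcongr

end

section

variable {a c b : ℝ}

lemma exists_mlKernel_bound {T : ℝ} (hT : 0 < T) (hc : 0 ≤ c) (hca : c < a) (hb : 0 < b)
    (μ l : ℝ) : ∃ C, ∀ t ∈ Ioc 0 T, |mlKernel a c μ l b t| ≤ C * t ^ (b - 1) := by
  obtain ⟨e, he, hbd⟩ := exists_neumannTerm_bound (a := a) hT (d := a - c) (by linarith)
    (by linarith) hb μ l
  refine ⟨∑' n, e n, fun t ht => ?_⟩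
  rw [mlKernel_eq_tsum _ _ _ _ _ ht.1]
  exact abs_tsum_le_of_bound hbd he ht

lemma sing_mlKernel {T : ℝ} (hT : 0 < T) (hc : 0 ≤ c) (hca : c < a) (hb : 0 < b) (μ l : ℝ) :
    Sing T (mlKernel a c μ l b) := by
  obtain ⟨e, he, hbd⟩ := exists_neumannTerm_bound (a := a) hT (d := a - c) (by linarith)
    (by linarith) hb μ l
  exact (sing_tsum (by linarith) (fun n => sing_neumannTerm T (by linarith) (by linarith) hb n)
    hbd he).congr fun t ht => mlKernel_eq_tsum _ _ _ _ _ ht.1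

/-- The Mittag-Leffler kernel solves its Volterra equation: each term of the Neumann series is
obtained from the preceding one by the operator `-μ I^{a-c} - l I^a`. -/
lemma mlKernel_volterra (hc : 0 ≤ c) (hca : c < a) (hb : 0 < b) (μ l : ℝ) {t : ℝ} (ht : 0 < t) :
    mlKernel a c μ l b t + μ * causalConv (rlKernel (a - c)) (mlKernel a c μ l b) t +
      l * causalConv (rlKernel a) (mlKernel a c μ l b) t = rlKernel b t := by
  obtain ⟨e, he, hbd⟩ := exists_neumannTerm_bound (a := a) ht (d := a - c) (by linarith)
    (by linarith) hb μ l
  have ha : 0 < a := by linarith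
  have hd : 0 < a - c := by linarith
  have hs := fun n => sing_neumannTerm (μ := μ) (l := l) t ha hd hb n
  have htt : t ∈ Icc 0 t := ⟨ht.le, le_rfl⟩
  have h0 : Summable fun n => neumannTerm a (a - c) μ l b n t :=
    summable_of_bound hbd he ⟨ht, le_rfl⟩
  have hconv : ∀ κ, Sing t κ → HasSum (fun n => causalConv κ (neumannTerm a (a - c) μ l b n) t)
      (causalConv κ (mlKernel a c μ l b) t) := by
    intro κ hκ
    rw [causalConv_congr (g := mlKernel a c μ l b) htt (fun _ _ => rfl)
      fun s hs => mlKernel_eq_tsum _ _ _ _ _ hs.1]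
    exact hasSum_causalConv (by linarith) hs hbd he hκ htt
  have h1 := ((hconv _ (sing_rlKernel t hd)).mul_left (-μ)).sub
    ((hconv _ (sing_rlKernel t ha)).mul_left l)
  have h2 := (tsum_congr fun n => neumannTerm_succ (μ := μ) (l := l) ha hd hb n ht).trans
    h1.tsum_eq
  rw [mlKernel_eq_tsum _ _ _ _ _ ht, h0.tsum_eq_zero_add, neumannTerm_zero, h2]
  ring

end

/-! ### The resolvent of the kernel `l t^{a-1} / Γ(a)` -/

section Resolvent

variable {a l : ℝ} {R : ℝ → ℝ}

lemma rlKernel_eq_mul {a t t' : ℝ} (ht : 0 < t) (ht' : 0 < t') :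
    rlKernel a t = (t / t') ^ (a - 1) * rlKernel a t' := by
  rw [rlKernel, rlKernel, Real.div_rpow ht.le ht'.le]
  have := (Real.rpow_pos_of_pos ht' (a - 1)).ne'
  field_simp

/-- Near `0` the right-hand side `t^{a-1} / Γ(a)` dominates the convolution, which is
`O(t^{2a-1})`. -/
lemma pos_near_zero (ha : 0 < a) (hl : 0 < l) {C : ℝ}
    (hC : ∀ t ∈ Ioc 0 1, |R t| ≤ C * t ^ (a - 1))
    (hV : ∀ t, 0 < t → R t + l * causalConv (rlKernel a) R t = rlKernel a t) :
    ∃ τ > 0, ∀ t ∈ Ioc 0 τ, 0 < R t := by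
  have hG := Real.Gamma_pos_of_pos ha
  obtain ⟨K, hK⟩ : ∃ K, K = l * (1 / Real.Gamma a * C * ProbabilityTheory.beta a a) := ⟨_, rfl⟩
  have hlim : Tendsto (fun t : ℝ => K * t ^ a) (𝓝[>] 0) (𝓝 0) := by
    have h : Continuous fun t : ℝ => K * t ^ a :=
      continuous_const.mul (continuous_id.rpow_const fun _ => Or.inr ha.le)
    have h2 := h.tendsto 0
    simp only [Real.zero_rpow ha.ne', mul_zero] at h2
    exact h2.mono_left nhdsWithin_le_nhds
  have hev : ∀ᶠ t in 𝓝[>] (0:ℝ), K * t ^ a < 1 / Real.Gamma a :=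
    hlim.eventually (gt_mem_nhds (by positivity))
  obtain ⟨u, hu, hsub⟩ := mem_nhdsGT_iff_exists_Ioo_subset.1 hev
  have hu : 0 < u := hu
  refine ⟨min 1 (u / 2), by positivity, fun t ht => ?_⟩
  have ht1 : t ∈ Ioc (0:ℝ) 1 := ⟨ht.1, ht.2.trans (min_le_left _ _)⟩
  have h1 : K * t ^ a < 1 / Real.Gamma a :=
    hsub ⟨ht.1, by linarith [ht.2.trans (min_le_right (1:ℝ) (u / 2))]⟩
  have h2 := abs_causalConv_le (T := 1) (p := a - 1) (q := a - 1) (A := 1 / Real.Gamma a) (B := C)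
    (f := rlKernel a) (g := R) (by linarith) (by linarith) (fun s hs => by
      rw [abs_of_nonneg (rlKernel_nonneg ha hs.1.le), rlKernel]
      exact le_of_eq (by ring)) hC ht1
  rw [sub_add_cancel, show a - 1 + (a - 1) + 1 = a - 1 + a by ring] at h2
  have h3 := hV t ht.1
  have h4 : l * causalConv (rlKernel a) R t ≤ K * t ^ a * t ^ (a - 1) := by
    calc l * causalConv (rlKernel a) R t ≤ l * |causalConv (rlKernel a) R t| :=
          mul_le_mul_of_nonneg_left (le_abs_self _) hl.le
      _ ≤ l * (1 / Real.Gamma a * C * ProbabilityTheory.beta a a * t ^ (a - 1 + a)) :=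
          mul_le_mul_of_nonneg_left h2 hl.le
      _ = _ := by rw [Real.rpow_add ht.1, hK]; ring
  have h5 : K * t ^ a * t ^ (a - 1) < 1 / Real.Gamma a * t ^ (a - 1) :=
    mul_lt_mul_of_pos_right h1 (Real.rpow_pos_of_pos ht.1 _)
  have h6 : rlKernel a t = 1 / Real.Gamma a * t ^ (a - 1) := by rw [rlKernel]; ring
  linarith

/-- Positivity of the resolvent. At a first zero `t₀` one compares the Volterra equation with the
one at a nearby earlier point `t₁` where `R` is maximal on `[t₁, t₀]`; the kernel satisfies
`k (t₀ - s) / k (t₁ - s) ≤ k t₀ / k t₁`, which forces `R t₀ > 0`. -/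
lemma resolvent_pos (ha : 0 < a) (ha1 : a < 1) (hl : 0 < l) {C : ℝ}
    (hC : ∀ t ∈ Ioc 0 1, |R t| ≤ C * t ^ (a - 1)) (hR : ∀ T, 0 < T → Sing T R)
    (hV : ∀ t, 0 < t → R t + l * causalConv (rlKernel a) R t = rlKernel a t) {t : ℝ}
    (ht : 0 < t) : 0 < R t := by
  obtain ⟨τ, hτ, hpos⟩ := pos_near_zero ha hl hC hV
  by_contra hneg
  push Not at hneg
  have hτt : τ < t := by
    by_contra h
    exact absurd (hpos t ⟨ht, not_lt.1 h⟩) (not_lt.2 hneg)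
  have hcont : ContinuousOn R (Icc τ t) :=
    (hR t ht).1.mono fun s hs => ⟨hτ.trans_le hs.1, hs.2⟩
  have hcpt : IsCompact (Icc τ t ∩ R ⁻¹' Iic 0) :=
    isCompact_Icc.of_isClosed_subset (hcont.preimage_isClosed_of_isClosed isClosed_Icc isClosed_Iic)
      inter_subset_left
  obtain ⟨t₀, ⟨ht₀, hRt₀⟩, hleast⟩ := hcpt.exists_isLeast ⟨t, ⟨hτt.le, le_rfl⟩, hneg⟩
  have hRt₀ : R t₀ ≤ 0 := hRt₀
  have hbefore : ∀ s, 0 < s → s < t₀ → 0 < R s := by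
    intro s hs hst
    by_contra h
    rcases le_or_gt s τ with h1 | h1
    · exact h (hpos s ⟨hs, h1⟩)
    · exact absurd (hleast ⟨⟨h1.le, hst.le.trans ht₀.2⟩, not_lt.1 h⟩) (not_le.2 hst)
  have ht₀pos : 0 < t₀ := hτ.trans_le ht₀.1
  have hG := Real.Gamma_pos_of_pos ha
  -- a point `t'` so close to `t₀` that `[t', t₀]` contributes little to the convolution
  obtain ⟨t', ht'1, ht'2, ht'3, ht'4⟩ : ∃ t', 0 < t' ∧ t' < t₀ ∧ t₀ / 2 ≤ t' ∧
      l * ((t₀ - t') ^ a / (a * Real.Gamma a)) < 1 / 2 := by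
    have hlim : Tendsto (fun s : ℝ => l * ((t₀ - s) ^ a / (a * Real.Gamma a))) (𝓝[<] t₀) (𝓝 0) := by
      have h : Continuous fun s : ℝ => l * ((t₀ - s) ^ a / (a * Real.Gamma a)) :=
        continuous_const.mul (((continuous_const.sub continuous_id).rpow_const
          fun _ => Or.inr ha.le).div_const _)
      have h2 := h.tendsto t₀
      simp only [sub_self, Real.zero_rpow ha.ne', zero_div, mul_zero] at h2
      exact h2.mono_left nhdsWithin_le_nhds
    have e1 := hlim.eventually (gt_mem_nhds (show (0:ℝ) < 1 / 2 by norm_num))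
    have e2 : ∀ᶠ s in 𝓝[<] t₀, s ∈ Ioo (t₀ / 2) t₀ := Ioo_mem_nhdsLT (by linarith)
    obtain ⟨s, h1, h2⟩ := (e1.and e2).exists
    exact ⟨s, by linarith [h2.1], h2.2, h2.1.le, h1⟩
  have hcont' : ContinuousOn R (Icc t' t₀) :=
    (hR t ht).1.mono fun s hs => ⟨ht'1.trans_le hs.1, hs.2.trans ht₀.2⟩
  obtain ⟨t₁, ht₁, hmax⟩ := isCompact_Icc.exists_isMaxOn ⟨t', left_mem_Icc.2 ht'2.le⟩ hcont'
  have hRt₁ : 0 < R t₁ :=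
    (hbefore t' ht'1 ht'2).trans_le (hmax (left_mem_Icc.2 ht'2.le))
  have ht₁lt : t₁ < t₀ := by
    refine lt_of_le_of_ne ht₁.2 fun h => ?_
    rw [h] at hRt₁
    linarith
  have ht₁pos : 0 < t₁ := ht'1.trans_le ht₁.1
  have hk := sing_rlKernel t₀ ha
  have hint := causalConv_integrand_intervalIntegrable hk (hR t₀ ht₀pos) ⟨ht₀pos.le, le_rfl⟩
  have hint1 : IntervalIntegrable (fun s => rlKernel a (t₀ - s) * R s) volume 0 t₁ :=
    hint.mono_set (by
      rw [uIcc_of_le ht₁pos.le, uIcc_of_le ht₀pos.le]; exact Icc_subset_Icc_right ht₁lt.le)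
  have hint2 : IntervalIntegrable (fun s => rlKernel a (t₀ - s) * R s) volume t₁ t₀ :=
    hint.mono_set (by
      rw [uIcc_of_le ht₁lt.le, uIcc_of_le ht₀pos.le]; exact Icc_subset_Icc_left ht₁pos.le)
  have hsplit : causalConv (rlKernel a) R t₀ = (∫ s in (0:ℝ)..t₁, rlKernel a (t₀ - s) * R s) +
      ∫ s in t₁..t₀, rlKernel a (t₀ - s) * R s :=
    (intervalIntegral.integral_add_adjacent_intervals hint1 hint2).symm
  obtain ⟨ρ, hρ⟩ : ∃ ρ, ρ = (t₀ / t₁) ^ (a - 1) := ⟨_, rfl⟩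
  have hfirst : (∫ s in (0:ℝ)..t₁, rlKernel a (t₀ - s) * R s) ≤
      ρ * causalConv (rlKernel a) R t₁ := by
    rw [causalConv, ← intervalIntegral.integral_const_mul]
    refine intervalIntegral.integral_mono_on_of_le_Ioo ht₁pos.le hint1
      ((causalConv_integrand_intervalIntegrable (sing_rlKernel t₁ ha) (hR t₁ ht₁pos)
        ⟨ht₁pos.le, le_rfl⟩).const_mul ρ) fun s hs => ?_
    have hs1 : 0 < t₁ - s := by linarith [hs.2]
    have hs0 : 0 < t₀ - s := by linarith
    rw [← mul_assoc]
    refine mul_le_mul_of_nonneg_right ?_ (hbefore s hs.1 (hs.2.trans ht₁lt)).le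
    rw [rlKernel_eq_mul hs0 hs1, hρ]
    refine mul_le_mul_of_nonneg_right ?_ (rlKernel_nonneg ha hs1.le)
    refine Real.rpow_le_rpow_of_nonpos (by positivity) ?_ (by linarith)
    rw [div_le_div_iff₀ ht₁pos hs1]
    nlinarith [hs.1]
  have hsecond : (∫ s in t₁..t₀, rlKernel a (t₀ - s) * R s) ≤
      R t₁ * ((t₀ - t₁) ^ a / (a * Real.Gamma a)) := by
    have hval : ∫ s in t₁..t₀, rlKernel a (t₀ - s) = (t₀ - t₁) ^ a / (a * Real.Gamma a) := by
      rw [intervalIntegral.integral_comp_sub_left (fun s => rlKernel a s) t₀]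
      simp only [rlKernel, sub_self]
      rw [intervalIntegral.integral_div, integral_rpow (Or.inl (by linarith)), sub_add_cancel,
        Real.zero_rpow ha.ne', sub_zero, div_div]
    rw [← hval, ← intervalIntegral.integral_const_mul]
    have hi : IntervalIntegrable (fun s => rlKernel a (t₀ - s)) volume t₁ t₀ := by
      have h := causalConv_integrand_intervalIntegrable hk
        (sing_rlKernel t₀ one_pos) ⟨ht₀pos.le, le_rfl⟩
      simp only [rlKernel_one, mul_one] at h
      exact h.mono_set (by
        rw [uIcc_of_le ht₁lt.le, uIcc_of_le ht₀pos.le]; exact Icc_subset_Icc_left ht₁pos.le)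
    refine intervalIntegral.integral_mono_on_of_le_Ioo ht₁lt.le hint2 (hi.const_mul _)
      fun s hs => ?_
    rw [mul_comm]
    exact mul_le_mul_of_nonneg_right (hmax ⟨ht₁.1.trans hs.1.le, hs.2.le⟩)
      (rlKernel_nonneg ha (by linarith [hs.2]))
  have hρhalf : 1 / 2 ≤ ρ := by
    have h1 : t₁ / t₀ ≤ ρ := by
      rw [hρ, ← inv_div t₁ t₀, Real.inv_rpow (by positivity), ← Real.rpow_neg (by positivity)]
      calc t₁ / t₀ = (t₁ / t₀) ^ (1:ℝ) := (Real.rpow_one _).symm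
        _ ≤ (t₁ / t₀) ^ (-(a - 1)) := Real.rpow_le_rpow_of_exponent_ge (by positivity)
            ((div_le_one ht₀pos).2 ht₁lt.le) (by linarith)
    refine le_trans ?_ h1
    rw [div_le_div_iff₀ two_pos ht₀pos]
    linarith [ht₁.1]
  have hJ : l * ((t₀ - t₁) ^ a / (a * Real.Gamma a)) < 1 / 2 := by
    refine lt_of_le_of_lt ?_ ht'4
    have : (t₀ - t₁) ^ a ≤ (t₀ - t') ^ a :=
      Real.rpow_le_rpow (by linarith) (by linarith [ht₁.1]) ha.le
    gcongr
  have e0 := hV t₀ ht₀pos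
  have e1 := hV t₁ ht₁pos
  rw [rlKernel_eq_mul ht₀pos ht₁pos, ← hρ, ← e1, hsplit] at e0
  have hlf := mul_le_mul_of_nonneg_left hfirst hl.le
  have hls := mul_le_mul_of_nonneg_left hsecond hl.le
  have : R t₁ * (ρ - l * ((t₀ - t₁) ^ a / (a * Real.Gamma a))) ≤ R t₀ := by nlinarith
  have : 0 < R t₁ * (ρ - l * ((t₀ - t₁) ^ a / (a * Real.Gamma a))) :=
    mul_pos hRt₁ (by linarith)
  linarith

/-- Inversion of `1 + l I^a` by its resolvent. -/
lemma eq_sub_resolvent {T : ℝ} (ha : 0 < a) (hR : Sing T R)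
    (hV : ∀ t, 0 < t → R t + l * causalConv (rlKernel a) R t = rlKernel a t) {y q : ℝ → ℝ}
    (hy : Sing T y) (hq : ∀ t ∈ Ioc 0 T, y t + l * causalConv (rlKernel a) y t = q t) {t : ℝ}
    (ht : t ∈ Ioc 0 T) : y t = q t - l * causalConv R q t := by
  have ht' := Ioc_subset_Icc_self ht
  have hk := sing_rlKernel T ha
  have h1 : causalConv R q t = causalConv (rlKernel a) y t := by
    rw [causalConv_congr (f' := R) (g' := fun s => y s + l * causalConv (rlKernel a) y s) ht'
      (fun _ _ => rfl) fun s hs => (hq s ⟨hs.1, hs.2.le⟩).symm,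
      hR.causalConv_add hy ((hk.causalConv hy).const_mul l) ht', causalConv_const_mul_right,
      hR.causalConv_assoc hk hy ht', ← causalConv_const_mul_left,
      ← hR.add_causalConv ((hR.causalConv hk).const_mul l) hy ht']
    refine causalConv_congr ht' (fun s hs => ?_) fun _ _ => rfl
    rw [causalConv_comm R, hV s hs.1]
  rw [h1, ← hq t ht]
  ring

variable (ha : 0 < a) (ha1 : a < 1) (hl : 0 < l) (hR : ∀ T, 0 < T → Sing T R)
  (hpos : ∀ t, 0 < t → 0 < R t)
  (hV : ∀ t, 0 < t → R t + l * causalConv (rlKernel a) R t = rlKernel a t)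

include ha hl hpos hV in
lemma resolvent_le {t : ℝ} (ht : 0 < t) : R t ≤ rlKernel a t := by
  have h : 0 ≤ causalConv (rlKernel a) R t := causalConv_nonneg (T := t)
    (fun s hs => rlKernel_nonneg ha hs.1.le) (fun s hs => (hpos s hs.1).le) ⟨ht.le, le_rfl⟩
  nlinarith [hV t ht]

include ha ha1 hR hpos hV in
/-- Apply `I^{1-a}` to `l I^a R ≤ k_a`. -/
lemma mul_integral_resolvent_le {t : ℝ} (ht : 0 < t) :
    l * causalConv (rlKernel 1) R t ≤ 1 := by
  have ht' : t ∈ Icc 0 t := ⟨ht.le, le_rfl⟩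
  have hk := sing_rlKernel t ha
  have h1a : 0 < 1 - a := by linarith
  have hk1 := sing_rlKernel t h1a
  have hRt := hR t ht
  have e1 : causalConv (rlKernel 1) R t =
      causalConv (rlKernel (1 - a)) (causalConv (rlKernel a) R) t := by
    rw [hk1.causalConv_assoc hk hRt ht']
    refine causalConv_congr ht' (fun s hs => ?_) fun _ _ => rfl
    rw [causalConv_rlKernel h1a ha hs.1, sub_add_cancel]
  have e2 : causalConv (rlKernel (1 - a)) (rlKernel a) t = 1 := by
    rw [causalConv_rlKernel h1a ha ht, sub_add_cancel, rlKernel_one]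
  refine le_of_le_of_eq ?_ e2
  rw [e1, ← causalConv_const_mul_right]
  refine causalConv_mono hk1 hk1 ((hk.causalConv hRt).const_mul l) hk
    (fun s hs => rlKernel_nonneg h1a hs.1.le) (fun s hs => rlKernel_nonneg ha hs.1.le)
    (fun _ _ => le_rfl) (fun s hs => ?_) ht'
  linarith [hV s hs.1, hpos s hs.1]

lemma mul_rlKernel {t : ℝ} (ha : 0 < a) (ht : 0 < t) : t * rlKernel a t = a * rlKernel (1 + a) t := by
  rw [rlKernel, rlKernel, add_comm 1 a, Real.Gamma_add_one ha.ne', add_sub_cancel_right]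
  have h : t ^ a = t ^ (a - 1) * t := by
    conv_lhs => rw [← sub_add_cancel a 1, Real.rpow_add ht, Real.rpow_one]
  have := (Real.Gamma_pos_of_pos ha).ne'
  rw [h]
  field_simp

lemma _root_.ContinuousOn.mul_sing {T : ℝ} {f g : ℝ → ℝ} (hf : ContinuousOn f (Icc 0 T))
    (hg : Sing T g) : Sing T (fun t => f t * g t) := by
  obtain ⟨K, hK⟩ := isCompact_Icc.exists_bound_of_continuousOn hf
  obtain ⟨hc, p, hp, C, hC⟩ := hg
  refine ⟨(hf.mono Ioc_subset_Icc_self).mul hc, p, hp, K * C, fun t ht => ?_⟩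
  rw [abs_mul, mul_assoc]
  have h1 := hK t (Ioc_subset_Icc_self ht)
  exact mul_le_mul h1 (hC t ht) (abs_nonneg _) ((norm_nonneg _).trans h1)

/-- The product rule for the multiplication by `t`. -/
lemma mul_causalConv {T : ℝ} {f g : ℝ → ℝ} (hf : Sing T f) (hg : Sing T g) {t : ℝ}
    (ht : t ∈ Icc 0 T) : t * causalConv f g t =
      causalConv (fun s => s * f s) g t + causalConv f (fun s => s * g s) t := by
  have h1 := causalConv_integrand_intervalIntegrable (continuousOn_id.mul_sing hf) hg ht
  have h2 := causalConv_integrand_intervalIntegrable hf (continuousOn_id.mul_sing hg) ht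
  simp only [id] at h1 h2
  simp only [causalConv]
  rw [← intervalIntegral.integral_const_mul, ← intervalIntegral.integral_add h1 h2]
  exact intervalIntegral.integral_congr fun s _ => by ring

include ha ha1 hl hR hpos hV in
/-- The function `t R` solves the same Volterra equation with the right-hand side `a ∫ R`, so that
it lies below `a ∫ R ≤ 1 / l`. -/
lemma resolvent_le_inv {t : ℝ} (ht : 0 < t) : l * (t * R t) ≤ 1 := by
  have htt : t ∈ Ioc 0 t := ⟨ht, le_rfl⟩
  have hk := sing_rlKernel t ha
  have hk1 := sing_rlKernel t one_pos
  have hRt := hR t ht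
  have hS : Sing t (fun s => s * R s) := continuousOn_id.mul_sing hRt
  have hq : ∀ s ∈ Ioc 0 t, s * R s + l * causalConv (rlKernel a) (fun s => s * R s) s =
      a * causalConv (rlKernel 1) R s := by
    intro s hs
    have hs' := Ioc_subset_Icc_self hs
    have e1 := mul_causalConv hk hRt hs'
    have e2 : causalConv (fun s => s * rlKernel a s) R s =
        a * causalConv (rlKernel (1 + a)) R s := by
      rw [← causalConv_const_mul_left]
      exact causalConv_congr hs' (fun r hr => mul_rlKernel ha hr.1) fun _ _ => rfl
    have e3 : causalConv (rlKernel 1) R s =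
        rlKernel (1 + a) s - l * causalConv (rlKernel (1 + a)) R s := by
      have e4 : causalConv (rlKernel 1) R s = causalConv (rlKernel 1)
          (fun r => rlKernel a r - l * causalConv (rlKernel a) R r) s :=
        causalConv_congr hs' (fun _ _ => rfl) fun r hr => by linarith [hV r hr.1]
      rw [e4, hk1.causalConv_sub hk ((hk.causalConv hRt).const_mul l) hs',
        causalConv_const_mul_right, causalConv_rlKernel one_pos ha hs.1,
        hk1.causalConv_assoc hk hRt hs']
      congr 2
      exact causalConv_congr hs' (fun r hr => causalConv_rlKernel one_pos ha hr.1) fun _ _ => rfl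
    have e5 := hV s hs.1
    have e6 := mul_rlKernel ha hs.1
    have e7 : s * R s + l * (s * causalConv (rlKernel a) R s) = s * rlKernel a s := by
      rw [← e5]; ring
    rw [e3]
    rw [e1, e2, e6] at e7
    linarith
  have h := eq_sub_resolvent ha hRt hV hS hq htt
  have hn : 0 ≤ causalConv R (fun s => a * causalConv (rlKernel 1) R s) t := by
    refine causalConv_nonneg (T := t) (fun s hs => (hpos s hs.1).le) (fun s hs => ?_) ⟨ht.le, le_rfl⟩
    refine mul_nonneg ha.le (causalConv_nonneg (T := s)
      (fun r hr => rlKernel_nonneg one_pos hr.1.le) (fun r hr => (hpos r hr.1).le)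
      ⟨hs.1.le, le_rfl⟩)
  have h2 : t * R t ≤ a * causalConv (rlKernel 1) R t := by
    have := mul_nonneg hl.le hn
    linarith
  have h3 := mul_integral_resolvent_le ha ha1 hR hpos hV ht
  have h4 : l * (t * R t) ≤ a * (l * causalConv (rlKernel 1) R t) := by
    have := mul_le_mul_of_nonneg_left h2 hl.le
    linarith
  nlinarith

include ha ha1 hl hR hpos hV in
/-- Interpolation between `R ≤ k_a` and `R ≤ 1 / (l t)`. -/
lemma resolvent_decay {t : ℝ} (ht : 0 < t) :
    R t ≤ (1 / Real.Gamma a) ^ (1 / 4 : ℝ) * l ^ (-(3 / 4) : ℝ) * t ^ (a / 4 - 1) := by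
  have h1 := resolvent_le ha hl hpos hV ht
  have h2 := resolvent_le_inv ha ha1 hl hR hpos hV ht
  have h0 := hpos t ht
  have hG := Real.Gamma_pos_of_pos ha
  have h3 : R t ≤ (l * t)⁻¹ := by
    rw [← one_div, le_div_iff₀ (by positivity)]
    linarith
  calc R t = R t ^ (1 / 4 : ℝ) * R t ^ (3 / 4 : ℝ) := by
        rw [← Real.rpow_add h0]; norm_num
    _ ≤ (rlKernel a t) ^ (1 / 4 : ℝ) * ((l * t)⁻¹) ^ (3 / 4 : ℝ) := by
        have := rlKernel_nonneg ha ht.le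
        gcongr
    _ = _ := by
        have e1 : rlKernel a t = (1 / Real.Gamma a) * t ^ (a - 1) := by rw [rlKernel]; ring
        rw [e1, Real.mul_rpow (by positivity) (by positivity), ← Real.rpow_mul ht.le,
          Real.inv_rpow (by positivity), ← Real.rpow_neg (by positivity),
          Real.mul_rpow hl.le ht.le]
        rw [show a / 4 - 1 = (a - 1) * (1 / 4) + -(3 / 4) by ring, Real.rpow_add ht]
        ring

lemma sing_rpow (T : ℝ) {p : ℝ} (hp : -1 < p) : Sing T (fun s => s ^ p) :=
  ⟨continuousOn_id.rpow_const fun s hs => Or.inl hs.1.ne', p, hp, 1, fun s hs => by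
      rw [abs_of_pos (Real.rpow_pos_of_pos hs.1 _), one_mul]⟩

include ha ha1 hl hR hpos hV in
/-- Convolution with `l R` is bounded on the weight `t^{ε-1}`, uniformly in `l`. In
`t (R * s^{ε-1}) = (s R) * s^{ε-1} + R * s^ε` the first term is controlled by `l s R ≤ 1` and the
second by `l ∫ R ≤ 1`. -/
lemma mul_causalConv_resolvent_rpow_le {ε t : ℝ} (hε : 0 < ε) (ht : 0 < t) :
    l * causalConv R (fun s => s ^ (ε - 1)) t ≤ (1 / ε + 1) * t ^ (ε - 1) := by
  have htt : t ∈ Icc 0 t := ⟨ht.le, le_rfl⟩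
  have hRt := hR t ht
  have hp := sing_rpow t (show -1 < ε - 1 by linarith)
  have hp2 := sing_rpow t (show -1 < ε by linarith)
  have hk1 := sing_rlKernel t one_pos
  have e1 := mul_causalConv hRt hp htt
  have e2 : l * causalConv (fun s => s * R s) (fun s => s ^ (ε - 1)) t ≤ t ^ ε / ε := by
    have h1 : causalConv (rlKernel 1) (fun s => s ^ (ε - 1)) t = t ^ ε / ε := by
      rw [causalConv_one_left, integral_rpow (Or.inl (by linarith)), sub_add_cancel,
        Real.zero_rpow hε.ne', sub_zero]
    rw [← h1, ← causalConv_const_mul_left]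
    refine causalConv_mono ((continuousOn_id.mul_sing hRt).const_mul l) hk1 hp hp
      (fun s hs => ?_) (fun s hs => Real.rpow_nonneg hs.1.le _) (fun s hs => ?_)
      (fun _ _ => le_rfl) htt
    · have := hpos s hs.1
      have := hs.1
      simp only [id]
      positivity
    · rw [rlKernel_one]
      exact resolvent_le_inv ha ha1 hl hR hpos hV hs.1
  have e3 : l * causalConv R (fun s => s * s ^ (ε - 1)) t ≤ t ^ ε := by
    have h1 : causalConv R (fun s => s * s ^ (ε - 1)) t ≤
        causalConv R (fun s => t ^ ε * rlKernel 1 s) t := by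
      refine causalConv_mono hRt hRt (continuousOn_id.mul_sing hp) (hk1.const_mul _)
        (fun s hs => (hpos s hs.1).le) (fun s hs => ?_) (fun _ _ => le_rfl) (fun s hs => ?_) htt
      · rw [rlKernel_one]; positivity
      · rw [rlKernel_one, mul_one, id]
        calc s * s ^ (ε - 1) = s ^ ε := by
              rw [mul_comm, ← Real.rpow_add_one hs.1.ne', sub_add_cancel]
          _ ≤ t ^ ε := Real.rpow_le_rpow hs.1.le hs.2.le hε.le
    rw [causalConv_const_mul_right, causalConv_comm R (rlKernel 1)] at h1
    have h2 := mul_integral_resolvent_le ha ha1 hR hpos hV ht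
    have h3 := Real.rpow_nonneg ht.le ε
    have h4 := mul_le_mul_of_nonneg_left h1 hl.le
    nlinarith
  have e4 : t ^ ε = t ^ (ε - 1) * t := by
    rw [← Real.rpow_add_one ht.ne', sub_add_cancel]
  have e5 : t * (l * causalConv R (fun s => s ^ (ε - 1)) t) ≤ t * ((1 / ε + 1) * t ^ (ε - 1)) := by
    calc t * (l * causalConv R (fun s => s ^ (ε - 1)) t) = l * (t * causalConv R (fun s => s ^ (ε - 1)) t) := by ring
      _ ≤ t ^ ε / ε + t ^ ε := by rw [e1]; linarith
      _ = _ := by rw [e4]; ring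
  exact le_of_mul_le_mul_left e5 ht

end Resolvent

/-! ### Decay of the Mittag-Leffler kernel, uniformly in the eigenvalue -/

lemma exp_neg_le_rpow_neg {y r : ℝ} (hy : 0 < y) (hr : 0 ≤ r) (hr1 : r ≤ 1) :
    Real.exp (-y) ≤ y ^ (-r) := by
  rw [Real.rpow_def_of_pos hy, Real.exp_le_exp]
  have h := Real.log_le_sub_one_of_pos hy
  nlinarith [mul_le_mul_of_nonneg_left h hr]

/-- Against the weight `e^{σt} t^{ε-1}`, convolution with `t^{d-1}` is small for large `σ`. -/
lemma exists_weight {T d ε η : ℝ} (hT : 0 < T) (hd : 0 < d) (hd1 : d < 1) (hε : 0 < ε)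
    (hη : 0 < η) : ∃ σ : ℝ, 0 < σ ∧ ∀ t ∈ Ioc 0 T,
      causalConv (rlKernel d) (fun s => Real.exp (σ * s) * s ^ (ε - 1)) t ≤
        η * (Real.exp (σ * t) * t ^ (ε - 1)) := by
  have hG := Real.Gamma_pos_of_pos hd
  obtain ⟨K, hK⟩ : ∃ K, K = 1 / Real.Gamma d * ProbabilityTheory.beta ε (d / 2) * T ^ (d / 2) :=
    ⟨_, rfl⟩
  have hK0 : 0 < K := by
    have := ProbabilityTheory.beta_pos hε (half_pos hd)
    rw [hK]; positivity
  refine ⟨(K / η) ^ (2 / d), by positivity, fun t ht => ?_⟩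
  obtain ⟨σ, hσ⟩ : ∃ σ, σ = (K / η) ^ (2 / d) := ⟨_, rfl⟩
  have hσ0 : 0 < σ := hσ ▸ by positivity
  have hσd : σ ^ (-(d / 2)) = η / K := by
    rw [hσ, ← Real.rpow_mul (by positivity), show 2 / d * -(d / 2) = -1 by field_simp,
      Real.rpow_neg_one, inv_div]
  rw [← hσ]
  have e1 : causalConv (rlKernel d) (fun s => Real.exp (σ * s) * s ^ (ε - 1)) t =
      Real.exp (σ * t) *
        causalConv (fun r => Real.exp (-(σ * r)) * rlKernel d r) (fun s => s ^ (ε - 1)) t := by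
    simp only [causalConv]
    rw [← intervalIntegral.integral_const_mul]
    refine intervalIntegral.integral_congr fun s _ => ?_
    have : Real.exp (σ * s) = Real.exp (σ * t) * Real.exp (-(σ * (t - s))) := by
      rw [← Real.exp_add]; ring_nf
    simp only [this]
    ring
  have e2 := abs_causalConv_le (T := T) (p := d / 2 - 1) (q := ε - 1)
    (A := σ ^ (-(d / 2)) * (1 / Real.Gamma d)) (B := 1)
    (f := fun r => Real.exp (-(σ * r)) * rlKernel d r) (g := fun s => s ^ (ε - 1))
    (by linarith) (by linarith) (fun r hr => ?_) (fun s hs => ?_) ht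
  · rw [e1, mul_left_comm]
    refine mul_le_mul_of_nonneg_left ((le_abs_self _).trans (e2.trans ?_)) (Real.exp_pos _).le
    have h1 : t ^ (d / 2) ≤ T ^ (d / 2) := Real.rpow_le_rpow ht.1.le ht.2 (by linarith)
    have h2 := ProbabilityTheory.beta_pos hε (half_pos hd)
    have h3 := Real.rpow_nonneg ht.1.le (ε - 1)
    rw [hσd, sub_add_cancel, sub_add_cancel, show d / 2 - 1 + (ε - 1) + 1 = d / 2 + (ε - 1) by ring,
      Real.rpow_add ht.1]
    calc _ = η / K * (1 / Real.Gamma d * ProbabilityTheory.beta ε (d / 2) * t ^ (d / 2)) *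
          t ^ (ε - 1) := by ring
      _ ≤ η / K * (1 / Real.Gamma d * ProbabilityTheory.beta ε (d / 2) * T ^ (d / 2)) *
          t ^ (ε - 1) := by gcongr
      _ = η * t ^ (ε - 1) := by rw [← hK]; field_simp
  · rw [abs_mul, abs_of_pos (Real.exp_pos _), abs_of_nonneg (rlKernel_nonneg hd hr.1.le)]
    have h1 := exp_neg_le_rpow_neg (y := σ * r) (r := d / 2) (mul_pos hσ0 hr.1) (by linarith)
      (by linarith)
    rw [Real.mul_rpow hσ0.le hr.1.le] at h1
    calc _ ≤ (σ ^ (-(d / 2)) * r ^ (-(d / 2))) * rlKernel d r :=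
          mul_le_mul_of_nonneg_right h1 (rlKernel_nonneg hd hr.1.le)
      _ = _ := by
          rw [rlKernel, show d / 2 - 1 = -(d / 2) + (d - 1) by ring, Real.rpow_add hr.1]
          ring
  · rw [abs_of_nonneg (Real.rpow_nonneg hs.1.le _), one_mul]

/-- If any admissible constant `N` may be replaced by `A + N / 2`, then the constant `2 A` will do,
whatever the size of the initial constant. -/
lemma le_two_mul_of_halving {A M : ℝ} {P : ℝ → Prop} (hM : P M) (h : ∀ N, P N → P (A + N / 2))
    {y w : ℝ} (hP : ∀ N, P N → y ≤ N * w) : y ≤ 2 * A * w := by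
  have h1 : ∀ n : ℕ, P (2 * A + (M - 2 * A) * (1 / 2) ^ n) := by
    intro n
    induction n with
    | zero => simpa using hM
    | succ n ih =>
      have := h _ ih
      rw [pow_succ]
      convert this using 1
      ring
  have h2 : Tendsto (fun n : ℕ => (2 * A + (M - 2 * A) * (1 / 2 : ℝ) ^ n) * w) atTop
      (𝓝 ((2 * A + (M - 2 * A) * 0) * w)) :=
    (((tendsto_pow_atTop_nhds_zero_of_lt_one (by norm_num) (by norm_num)).const_mul _).const_add
      _).mul_const _
  rw [mul_zero, add_zero] at h2
  exact ge_of_tendsto' h2 fun n => hP _ (h1 n)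

/-- The kernel for general `μ` is the resolvent `R` (the case `μ = 0`) perturbed by
`G = R - μ (k_d * G - l R * (k_d * G))`; in an exponentially weighted norm the perturbation is
a contraction, with a weight that does not depend on `l`. -/
lemma exists_mlKernel_decay {a c T : ℝ} (μ : ℝ) (hT : 0 < T) (hc : 0 < c) (hca : c < a)
    (ha1 : a < 1) : ∃ C, 0 ≤ C ∧ ∀ l, 0 < l → ∀ t ∈ Ioc 0 T,
      |mlKernel a c μ l a t| ≤ C * l ^ (-(3 / 4) : ℝ) * t ^ (a / 4 - 1) := by
  have ha : 0 < a := hc.trans hca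
  have hd : 0 < a - c := by linarith
  obtain ⟨ε, hε⟩ : ∃ ε, ε = a / 4 := ⟨_, rfl⟩
  have hε0 : 0 < ε := by linarith
  rw [← hε]
  obtain ⟨B, hB⟩ : ∃ B, B = 2 + 1 / ε := ⟨_, rfl⟩
  have hB0 : 0 < B := by rw [hB]; positivity
  obtain ⟨σ, hσ0, hσ⟩ := exists_weight (η := 1 / (2 * (|μ| + 1) * B)) hT hd (by linarith) hε0
    (by positivity)
  obtain ⟨C₀, hC₀⟩ : ∃ C₀, C₀ = (1 / Real.Gamma a) ^ (1 / 4 : ℝ) := ⟨_, rfl⟩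
  have hG := Real.Gamma_pos_of_pos ha
  have hC₀0 : 0 ≤ C₀ := hC₀ ▸ by positivity
  refine ⟨2 * C₀ * Real.exp (σ * T), by positivity, fun l hl t ht => ?_⟩
  obtain ⟨G, hGdef⟩ : ∃ G, G = mlKernel a c μ l a := ⟨_, rfl⟩
  obtain ⟨R, hRdef⟩ : ∃ R, R = mlKernel a 0 0 l a := ⟨_, rfl⟩
  have hGV : ∀ t, 0 < t → G t + μ * causalConv (rlKernel (a - c)) G t +
      l * causalConv (rlKernel a) G t = rlKernel a t := fun t ht => by
    rw [hGdef]; exact mlKernel_volterra hc.le hca ha μ l ht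
  have hRV : ∀ t, 0 < t → R t + l * causalConv (rlKernel a) R t = rlKernel a t := fun t ht => by
    have := mlKernel_volterra le_rfl ha ha 0 l ht
    rwa [zero_mul, add_zero, ← hRdef] at this
  have hRS : ∀ T, 0 < T → Sing T R := fun T hT => hRdef ▸ sing_mlKernel hT le_rfl ha ha 0 l
  have hGS : Sing T G := hGdef ▸ sing_mlKernel hT hc.le hca ha μ l
  obtain ⟨CR, hCR⟩ := exists_mlKernel_bound (T := 1) one_pos le_rfl ha ha 0 l
  rw [← hRdef] at hCR
  have hRpos : ∀ t, 0 < t → 0 < R t := fun t ht => resolvent_pos ha ha1 hl hCR hRS hRV ht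
  have hk := sing_rlKernel T hd
  have hka := sing_rlKernel T ha
  have hRT := hRS T hT
  have hPS := hk.causalConv hGS
  obtain ⟨w, hw⟩ : ∃ w : ℝ → ℝ, w = fun s => Real.exp (σ * s) * s ^ (ε - 1) := ⟨_, rfl⟩
  have hwS : Sing T w := by
    rw [hw]
    exact ContinuousOn.mul_sing (by fun_prop) (sing_rpow T (by linarith))
  have hw0 : ∀ s, 0 < s → 0 ≤ w s := fun s hs => by
    rw [hw]; exact mul_nonneg (Real.exp_pos _).le (Real.rpow_nonneg hs.le _)
  have hGR : ∀ t ∈ Ioc 0 T, G t = R t - μ * (causalConv (rlKernel (a - c)) G t -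
      l * causalConv R (causalConv (rlKernel (a - c)) G) t) := by
    intro t ht
    have ht' := Ioc_subset_Icc_self ht
    have h1 := eq_sub_resolvent (y := G)
      (q := fun t => rlKernel a t - μ * causalConv (rlKernel (a - c)) G t) ha hRT hRV hGS
      (fun s hs => by linarith [hGV s hs.1]) ht
    rw [hRT.causalConv_sub hka (hPS.const_mul μ) ht', causalConv_const_mul_right,
      causalConv_comm R (rlKernel a)] at h1
    have h2 := hRV t ht.1
    linear_combination h1 - h2
  obtain ⟨η, hη⟩ : ∃ η, η = 1 / (2 * (|μ| + 1) * B) := ⟨_, rfl⟩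
  have hη0 : 0 < η := hη ▸ by positivity
  have hημ : |μ| * η * B ≤ 1 / 2 := by
    have : |μ| * η * B = |μ| / (2 * (|μ| + 1)) := by rw [hη]; field_simp
    rw [this, div_le_div_iff₀ (by positivity) two_pos]
    linarith
  -- one step of the bootstrap: a bound with constant `M` improves to `C₀ l^{-3/4} + M / 2`
  have step : ∀ M : ℝ, (0 ≤ M ∧ ∀ t ∈ Ioc 0 T, |G t| ≤ M * w t) →
      (0 ≤ C₀ * l ^ (-(3 / 4) : ℝ) + M / 2 ∧
        ∀ t ∈ Ioc 0 T, |G t| ≤ (C₀ * l ^ (-(3 / 4) : ℝ) + M / 2) * w t) := by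
    rintro M ⟨hM0, hM⟩
    refine ⟨by positivity, fun t ht => ?_⟩
    have hP : ∀ t ∈ Ioc 0 T, |causalConv (rlKernel (a - c)) G t| ≤ M * η * w t := by
      intro t ht
      have h1 := abs_causalConv_le_causalConv hk hGS (hwS.const_mul M)
        (fun s hs => rlKernel_nonneg hd hs.1.le) (fun s hs => hM s ⟨hs.1, hs.2.le⟩)
        (Ioc_subset_Icc_self ht)
      rw [causalConv_const_mul_right] at h1
      have h2 := hσ t ht
      rw [← hη] at h2
      rw [hw] at h1 ⊢
      calc _ ≤ _ := h1
        _ ≤ M * (η * (Real.exp (σ * t) * t ^ (ε - 1))) := mul_le_mul_of_nonneg_left h2 hM0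
        _ = _ := by ring
    have hRw : l * causalConv R w t ≤ (1 / ε + 1) * w t := by
      have h1 : causalConv R w t ≤ causalConv R (fun s => Real.exp (σ * t) * s ^ (ε - 1)) t := by
        refine causalConv_mono (T := t) (hRS t ht.1) (hRS t ht.1) (hwS.mono ht.2)
          ((sing_rpow t (by linarith)).const_mul _) (fun s hs => (hRpos s hs.1).le)
          (fun s hs => mul_nonneg (Real.exp_pos _).le (Real.rpow_nonneg hs.1.le _))
          (fun _ _ => le_rfl) (fun s hs => ?_) ⟨ht.1.le, le_rfl⟩
        rw [hw]
        have := Real.rpow_nonneg hs.1.le (ε - 1)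
        have := hs.2.le
        simp only
        gcongr
      rw [causalConv_const_mul_right] at h1
      have h2 := mul_causalConv_resolvent_rpow_le ha ha1 hl hRS hRpos hRV hε0 ht.1
      have h3 := mul_le_mul_of_nonneg_left h1 hl.le
      have h4 := mul_le_mul_of_nonneg_left h2 (Real.exp_pos (σ * t)).le
      have h5 : w t = Real.exp (σ * t) * t ^ (ε - 1) := by rw [hw]
      rw [h5]
      linarith
    have hRP : l * |causalConv R (causalConv (rlKernel (a - c)) G) t| ≤
        M * η * ((1 / ε + 1) * w t) := by
      have h1 := abs_causalConv_le_causalConv hRT hPS (hwS.const_mul (M * η))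
        (fun s hs => (hRpos s hs.1).le) (fun s hs => hP s ⟨hs.1, hs.2.le⟩)
        (Ioc_subset_Icc_self ht)
      rw [causalConv_const_mul_right] at h1
      have h2 := mul_le_mul_of_nonneg_left h1 hl.le
      have h3 := mul_le_mul_of_nonneg_left hRw (by positivity : 0 ≤ M * η)
      linarith
    have hRbd : R t ≤ C₀ * l ^ (-(3 / 4) : ℝ) * w t := by
      have h1 := resolvent_decay ha ha1 hl hRS hRpos hRV ht.1
      rw [← hC₀, ← hε] at h1
      refine h1.trans ?_
      rw [hw]
      refine mul_le_mul_of_nonneg_left ?_ (by positivity)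
      exact le_mul_of_one_le_left (Real.rpow_nonneg ht.1.le _)
        (Real.one_le_exp (mul_nonneg hσ0.le ht.1.le))
    have hPt := hP t ht
    rw [hGR t ht]
    have hμ0 := abs_nonneg μ
    have hwt := hw0 t ht.1
    calc _ ≤ |R t| + |μ * (causalConv (rlKernel (a - c)) G t -
          l * causalConv R (causalConv (rlKernel (a - c)) G) t)| := abs_sub _ _
      _ ≤ R t + |μ| * (|causalConv (rlKernel (a - c)) G t| +
          l * |causalConv R (causalConv (rlKernel (a - c)) G) t|) := by
          rw [abs_of_pos (hRpos t ht.1), abs_mul]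
          gcongr
          refine (abs_sub _ _).trans ?_
          rw [abs_mul, abs_of_pos hl]
      _ ≤ C₀ * l ^ (-(3 / 4) : ℝ) * w t + |μ| * (M * η * w t + M * η * ((1 / ε + 1) * w t)) := by
          gcongr
      _ = C₀ * l ^ (-(3 / 4) : ℝ) * w t + (|μ| * η * B) * (M * w t) := by rw [hB]; ring
      _ ≤ C₀ * l ^ (-(3 / 4) : ℝ) * w t + (1 / 2) * (M * w t) := by gcongr
      _ = _ := by ring
  obtain ⟨CG, hCG⟩ := exists_mlKernel_bound hT hc.le hca ha μ l
  rw [← hGdef] at hCG ⊢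
  have start : 0 ≤ |CG| * T ^ (a - 1 - (ε - 1)) ∧
      ∀ t ∈ Ioc 0 T, |G t| ≤ |CG| * T ^ (a - 1 - (ε - 1)) * w t := by
    refine ⟨by positivity, fun t ht => ?_⟩
    have h1 : t ^ (a - 1) ≤ T ^ (a - 1 - (ε - 1)) * t ^ (ε - 1) :=
      rpow_le_mul_rpow (by linarith) ht
    have h2 : t ^ (ε - 1) ≤ w t := by
      rw [hw]
      exact le_mul_of_one_le_left (Real.rpow_nonneg ht.1.le _)
        (Real.one_le_exp (mul_nonneg hσ0.le ht.1.le))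
    have h3 := Real.rpow_nonneg ht.1.le (a - 1)
    calc |G t| ≤ CG * t ^ (a - 1) := hCG t ht
      _ ≤ |CG| * t ^ (a - 1) := mul_le_mul_of_nonneg_right (le_abs_self _) h3
      _ ≤ |CG| * (T ^ (a - 1 - (ε - 1)) * w t) := by
          gcongr
          exact h1.trans (by gcongr)
      _ = _ := by ring
  have fin := le_two_mul_of_halving (P := fun M => 0 ≤ M ∧ ∀ t ∈ Ioc 0 T, |G t| ≤ M * w t)
    start step (y := |G t|) (w := w t) fun N hN => hN.2 t ht
  have h4 : w t ≤ Real.exp (σ * T) * t ^ (ε - 1) := by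
    rw [hw]
    have := Real.rpow_nonneg ht.1.le (ε - 1)
    have := ht.2
    simp only
    gcongr
  calc |G t| ≤ 2 * (C₀ * l ^ (-(3 / 4) : ℝ)) * w t := fin
    _ ≤ 2 * (C₀ * l ^ (-(3 / 4) : ℝ)) * (Real.exp (σ * T) * t ^ (ε - 1)) := by gcongr
    _ = _ := by ring

/-! ### Sine series -/

/-- The `k`-th sine coefficient of a function on `(0,1)`. -/
noncomputable def sineCoeffFun (f : ℝ → ℝ) (k : ℕ) : ℝ :=
  2 * ∫ x in (0 : ℝ)..1, f x * Real.sin (k * Real.pi * x)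

lemma continuousOn_union_Icc {E : Type*} [TopologicalSpace E] {F : ℝ → E}
    (h1 : ContinuousOn F (Icc (-1) 0)) (h2 : ContinuousOn F (Icc 0 1)) :
    ContinuousOn F (Icc (-1) 1) := by
  rw [← Icc_union_Icc_eq_Icc (b := (0:ℝ)) (by norm_num) (by norm_num)]
  exact h1.union_of_isClosed h2 isClosed_Icc isClosed_Icc

/-- A continuous function on `[0,1]` vanishing at the endpoints is the sum of its sine series if
the coefficients are summable: this is the Fourier series on `ℝ / 2ℤ` of the odd extension. -/
lemma hasSum_sine_series {f : ℝ → ℝ} (hf : ContinuousOn f (Icc 0 1)) (h0 : f 0 = 0) (h1 : f 1 = 0)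
    (hs : Summable fun k : ℕ => sineCoeffFun f (k + 1)) {x : ℝ} (hx : x ∈ Icc (0:ℝ) 1) :
    HasSum (fun k : ℕ => Real.sin (((k + 1 : ℕ) : ℝ) * Real.pi * x) * sineCoeffFun f (k + 1))
      (f x) := by
  have : Fact (0 < (2 : ℝ)) := ⟨two_pos⟩
  obtain ⟨F, hF⟩ : ∃ F : ℝ → ℂ, F = fun x => if 0 ≤ x then (f x : ℂ) else -(f (-x) : ℂ) :=
    ⟨_, rfl⟩
  have hFpos : ∀ x, 0 ≤ x → F x = f x := fun x hx => by simp [hF, hx]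
  have hFneg : ∀ x, x ≤ 0 → F x = -(f (-x) : ℂ) := fun x hx => by
    rcases hx.eq_or_lt with rfl | hx
    · simp [hF, h0]
    · simp [hF, hx.not_ge]
  have hc1 : ContinuousOn F (Icc (-1) 0) := by
    have : ContinuousOn (fun x : ℝ => -(f (-x) : ℂ)) (Icc (-1) 0) :=
      (Complex.continuous_ofReal.comp_continuousOn (hf.comp (by fun_prop)
        fun x hx => ⟨by linarith [hx.2], by linarith [hx.1]⟩)).neg
    exact this.congr fun x hx => hFneg x hx.2
  have hc2 : ContinuousOn F (Icc 0 1) :=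
    (Complex.continuous_ofReal.comp_continuousOn hf).congr fun x hx => hFpos x hx.1
  have hc := continuousOn_union_Icc hc1 hc2
  have hper : F (-1) = F (-1 + 2) := by
    rw [hFneg (-1) (by norm_num), hFpos (-1 + 2) (by norm_num)]
    norm_num [h1]
  obtain ⟨g, hg⟩ : ∃ g : C(AddCircle (2:ℝ), ℂ), (g : AddCircle (2:ℝ) → ℂ) =
      AddCircle.liftIco 2 (-1) F :=
    ⟨⟨AddCircle.liftIco 2 (-1) F, AddCircle.liftIco_continuous hper (by norm_num; exact hc)⟩, rfl⟩
  have hgx : ∀ y ∈ Icc (-1:ℝ) 1, g (y : AddCircle (2:ℝ)) = F y := by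
    intro y hy
    rw [hg]
    rcases hy.2.eq_or_lt with rfl | hy1
    · have : ((1 : ℝ) : AddCircle (2:ℝ)) = ((-1 : ℝ) : AddCircle (2:ℝ)) := by
        rw [← AddCircle.coe_add_period (2:ℝ) (-1)]
        norm_num
      rw [this, AddCircle.liftIco_coe_apply (by norm_num), hper]
      norm_num
    · exact AddCircle.liftIco_coe_apply ⟨hy.1, by linarith⟩
  have hcoef : ∀ n : ℤ, fourierCoeff g n =
      -Complex.I * ((∫ y in (0:ℝ)..1, f y * Real.sin (n * Real.pi * y) : ℝ) : ℂ) := by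
    intro n
    rw [fourierCoeff_eq_intervalIntegral g n (-1)]
    have e0 : ∀ y : ℝ, (fourier (-n) (y : AddCircle (2:ℝ)) : ℂ) =
        Complex.exp (-(Complex.I * (n * Real.pi * y : ℝ))) := by
      intro y
      rw [fourier_coe_apply]
      congr 1
      push_cast
      ring
    have ecc : ∀ s : ℝ, Continuous fun y : ℝ =>
        Complex.exp (-(Complex.I * (n * Real.pi * (s * y) : ℝ))) := fun s => by fun_prop
    have e1 : ∫ y in (-1:ℝ)..(-1 + 2), (fourier (-n) (y : AddCircle (2:ℝ)) : ℂ) • g y =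
        ∫ y in (-1:ℝ)..1, Complex.exp (-(Complex.I * (n * Real.pi * y : ℝ))) * F y := by
      rw [show (-1:ℝ) + 2 = 1 by norm_num]
      refine intervalIntegral.integral_congr fun y hy => ?_
      rw [uIcc_of_le (by norm_num)] at hy
      simp only [smul_eq_mul]
      rw [e0, hgx y hy]
    have i1 : IntervalIntegrable (fun y : ℝ => Complex.exp (-(Complex.I * (n * Real.pi * y : ℝ))) * F y)
        volume (-1) 0 := by
      refine ContinuousOn.intervalIntegrable ?_
      rw [uIcc_of_le (by norm_num)]
      exact (Continuous.continuousOn (by simpa using ecc 1)).mul hc1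
    have i2 : IntervalIntegrable (fun y : ℝ => Complex.exp (-(Complex.I * (n * Real.pi * y : ℝ))) * F y)
        volume 0 1 := by
      refine ContinuousOn.intervalIntegrable ?_
      rw [uIcc_of_le (by norm_num)]
      exact (Continuous.continuousOn (by simpa using ecc 1)).mul hc2
    have i3 : IntervalIntegrable (fun y : ℝ => Complex.exp (-(Complex.I * (n * Real.pi * (-y) : ℝ))) *
        F (-y)) volume 0 1 := by
      refine ContinuousOn.intervalIntegrable ?_
      rw [uIcc_of_le (by norm_num)]
      refine (Continuous.continuousOn (by simpa using ecc (-1))).mul (hc1.comp (by fun_prop) ?_)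
      exact fun x hx => ⟨by linarith [hx.2], by linarith [hx.1]⟩
    have e2 : ∫ y in (-1:ℝ)..0, Complex.exp (-(Complex.I * (n * Real.pi * y : ℝ))) * F y =
        ∫ y in (0:ℝ)..1, Complex.exp (-(Complex.I * (n * Real.pi * (-y) : ℝ))) * F (-y) := by
      have := intervalIntegral.integral_comp_neg (a := 0) (b := 1)
        (fun y : ℝ => Complex.exp (-(Complex.I * (n * Real.pi * y : ℝ))) * F y)
      rw [neg_zero] at this
      exact this.symm
    rw [e1, ← intervalIntegral.integral_add_adjacent_intervals i1 i2, e2,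
      ← intervalIntegral.integral_add i3 i2, ← intervalIntegral.integral_ofReal,
      ← intervalIntegral.integral_const_mul, ← intervalIntegral.integral_smul]
    refine intervalIntegral.integral_congr fun y hy => ?_
    rw [uIcc_of_le zero_le_one] at hy
    have m1 : F (-y) = -(f y : ℂ) := by rw [hFneg _ (by linarith [hy.1]), neg_neg]
    rw [m1, hFpos y hy.1]
    have s1 : Complex.exp (-(Complex.I * ((n * Real.pi * y : ℝ) : ℂ))) =
        Real.cos (n * Real.pi * y) - Real.sin (n * Real.pi * y) * Complex.I := by
      rw [show -(Complex.I * ((n * Real.pi * y : ℝ) : ℂ)) = ((-(n * Real.pi * y) : ℝ) : ℂ) * Complex.I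
        by push_cast; ring, Complex.exp_mul_I, ← Complex.ofReal_cos, ← Complex.ofReal_sin,
        Real.cos_neg, Real.sin_neg]
      push_cast; ring
    have s2 : Complex.exp (-(Complex.I * ((n * Real.pi * (-y) : ℝ) : ℂ))) =
        Real.cos (n * Real.pi * y) + Real.sin (n * Real.pi * y) * Complex.I := by
      rw [show -(Complex.I * ((n * Real.pi * (-y) : ℝ) : ℂ)) = ((n * Real.pi * y : ℝ) : ℂ) * Complex.I
        by push_cast; ring, Complex.exp_mul_I, ← Complex.ofReal_cos, ← Complex.ofReal_sin]
    rw [s1, s2, Complex.real_smul]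
    push_cast
    ring
  have hodd : ∀ n : ℕ, ∫ y in (0:ℝ)..1, f y * Real.sin (((-(n:ℤ) : ℤ) : ℝ) * Real.pi * y) =
      -∫ y in (0:ℝ)..1, f y * Real.sin (n * Real.pi * y) := by
    intro n
    rw [← intervalIntegral.integral_neg]
    refine intervalIntegral.integral_congr fun y _ => ?_
    rw [show ((-(n:ℤ) : ℤ) : ℝ) * Real.pi * y = -(n * Real.pi * y) by push_cast; ring,
      Real.sin_neg]
    ring
  -- the coefficients at `± n` combine to a sine
  have hterm : ∀ n : ℕ, fourierCoeff g n • (fourier (n:ℤ) (x : AddCircle (2:ℝ)) : ℂ) +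
      fourierCoeff g (-n) • (fourier (-(n:ℤ)) (x : AddCircle (2:ℝ)) : ℂ) =
      ((Real.sin (n * Real.pi * x) * sineCoeffFun f n : ℝ) : ℂ) := by
    intro n
    have q1 : fourierCoeff g n = -Complex.I * ((sineCoeffFun f n / 2 : ℝ) : ℂ) := by
      rw [hcoef, sineCoeffFun]; push_cast; ring
    have q2 : fourierCoeff g (-n) = Complex.I * ((sineCoeffFun f n / 2 : ℝ) : ℂ) := by
      rw [hcoef, sineCoeffFun, hodd]; push_cast; ring
    have r : ∀ m : ℤ, (fourier m (x : AddCircle (2:ℝ)) : ℂ) =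
        Real.cos (m * Real.pi * x) + Real.sin (m * Real.pi * x) * Complex.I := by
      intro m
      rw [fourier_coe_apply, Complex.ofReal_cos, Complex.ofReal_sin, ← Complex.exp_mul_I]
      congr 1
      push_cast
      ring
    rw [q1, q2, r, r, show (((-(n:ℤ) : ℤ)) : ℝ) * Real.pi * x = -(n * Real.pi * x) by push_cast; ring,
      Real.sin_neg, Real.cos_neg]
    simp only [smul_eq_mul, Int.cast_natCast]
    push_cast
    have := Complex.I_mul_I
    linear_combination (-(sineCoeffFun f n : ℂ) * Complex.sin (n * Real.pi * x)) * this
  have hsum1 : Summable fun n : ℕ => sineCoeffFun f n :=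
    (summable_nat_add_iff 1).1 hs
  have hsumm : Summable (fourierCoeff g) := by
    refine Summable.of_nat_of_neg ?_ ?_
    · refine (((Complex.summable_ofReal.2 hsum1).mul_left (-Complex.I / 2))).congr fun n => ?_
      rw [hcoef, sineCoeffFun]; push_cast; ring
    · refine (((Complex.summable_ofReal.2 hsum1).mul_left (Complex.I / 2))).congr fun n => ?_
      rw [hcoef, sineCoeffFun, hodd]; push_cast; ring
  have hpt := has_pointwise_sum_fourier_series_of_summable hsumm (x : AddCircle (2:ℝ))
  rw [hgx x ⟨by linarith [hx.1], hx.2⟩, hFpos x hx.1] at hpt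
  have h3 := hpt.nat_add_neg
  simp only [hterm] at h3
  have hz : fourierCoeff g 0 = 0 := by
    rw [hcoef]
    simp
  rw [hz, zero_smul, add_zero, Complex.hasSum_ofReal] at h3
  have h4 := (hasSum_nat_add_iff' 1).2 h3
  simpa using h4

lemma sineCoeffFun_congr {f g : ℝ → ℝ} (h : ∀ x ∈ Ioo (0:ℝ) 1, f x = g x) (k : ℕ) :
    sineCoeffFun f k = sineCoeffFun g k := by
  rw [sineCoeffFun, sineCoeffFun]
  congr 1
  refine intervalIntegral.integral_congr_Ioo_of_le zero_le_one fun x hx => ?_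
  rw [h x hx]

lemma intervalIntegrable_mul_sin {f : ℝ → ℝ} (hf : ContinuousOn f (Icc 0 1)) (k : ℕ) :
    IntervalIntegrable (fun x => f x * Real.sin (k * Real.pi * x)) volume 0 1 := by
  refine ContinuousOn.intervalIntegrable ?_
  rw [uIcc_of_le zero_le_one]
  exact hf.mul (Continuous.continuousOn (by fun_prop))

lemma sineCoeffFun_add {f g : ℝ → ℝ} (hf : ContinuousOn f (Icc 0 1)) (hg : ContinuousOn g (Icc 0 1))
    (k : ℕ) : sineCoeffFun (fun x => f x + g x) k = sineCoeffFun f k + sineCoeffFun g k := by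
  simp only [sineCoeffFun, add_mul]
  rw [intervalIntegral.integral_add (intervalIntegrable_mul_sin hf k)
    (intervalIntegrable_mul_sin hg k)]
  ring

lemma sineCoeffFun_const_mul (c : ℝ) (f : ℝ → ℝ) (k : ℕ) :
    sineCoeffFun (fun x => c * f x) k = c * sineCoeffFun f k := by
  simp only [sineCoeffFun, mul_assoc]
  rw [intervalIntegral.integral_const_mul]
  ring

lemma abs_sineCoeffFun_le {f : ℝ → ℝ} {C : ℝ} (hC : ∀ x ∈ Icc (0:ℝ) 1, |f x| ≤ C) (k : ℕ) :
    |sineCoeffFun f k| ≤ 2 * C := by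
  rw [sineCoeffFun, abs_mul, abs_two]
  refine mul_le_mul_of_nonneg_left ?_ two_pos.le
  have h := intervalIntegral.norm_integral_le_of_norm_le_const (a := 0) (b := 1) (C := C)
    (f := fun x => f x * Real.sin (k * Real.pi * x)) fun x hx => ?_
  · simpa using h
  · rw [uIoc_of_le zero_le_one] at hx
    rw [norm_mul]
    exact (mul_le_of_le_one_right (norm_nonneg _) (Real.abs_sin_le_one _)).trans
      (hC x ⟨hx.1.le, hx.2⟩)

/-- Two integrations by parts. The second derivative is only assumed to extend continuously from
the open interval; then so does the first. -/
lemma sineCoeffFun_of_iteratedDeriv {f H : ℝ → ℝ} (hf : ContinuousOn f (Icc 0 1)) (h0 : f 0 = 0)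
    (h1 : f 1 = 0) (hd : ContDiffOn ℝ 2 f (Ioo 0 1)) (hH : ContinuousOn H (Icc 0 1))
    (hfH : ∀ x ∈ Ioo (0:ℝ) 1, iteratedDeriv 2 f x = H x) (k : ℕ) :
    (k * Real.pi) ^ 2 * sineCoeffFun f k = -sineCoeffFun H k := by
  obtain ⟨ω, hω⟩ : ∃ ω, ω = k * Real.pi := ⟨_, rfl⟩
  have hHi : IntervalIntegrable H volume 0 1 :=
    ContinuousOn.intervalIntegrable (by rwa [uIcc_of_le zero_le_one])
  obtain ⟨P, hP⟩ : ∃ P : ℝ → ℝ, P = fun x => deriv f (1 / 2) + ∫ y in (1 / 2 : ℝ)..x, H y :=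
    ⟨_, rfl⟩
  have hPd : ∀ x ∈ Ioo (0:ℝ) 1, HasDerivAt P (H x) x := by
    intro x hx
    rw [hP]
    refine HasDerivAt.const_add _ ?_
    refine intervalIntegral.integral_hasDerivAt_right (hHi.mono_set ?_) ?_
      (hH.continuousAt (Icc_mem_nhds hx.1 hx.2))
    · rw [uIcc_of_le zero_le_one]
      exact uIcc_subset_Icc ⟨by norm_num, by norm_num⟩ (Ioo_subset_Icc_self hx)
    · exact (hH.mono Ioo_subset_Icc_self).stronglyMeasurableAtFilter isOpen_Ioo x hx
  have hPc : ContinuousOn P (Icc 0 1) := by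
    rw [hP]
    refine continuousOn_const.add ?_
    have := intervalIntegral.continuousOn_primitive_interval' (a := 1 / 2) hHi
      (by rw [uIcc_of_le zero_le_one]; constructor <;> norm_num)
    rwa [uIcc_of_le zero_le_one] at this
  have hd2 : ContDiffOn ℝ (1 + 1) f (Ioo 0 1) := by simpa [one_add_one_eq_two] using hd
  obtain ⟨hfd, -, hfd1⟩ := (contDiffOn_succ_iff_deriv_of_isOpen isOpen_Ioo).1 hd2
  have hdd : DifferentiableOn ℝ (deriv f) (Ioo 0 1) := hfd1.differentiableOn (by norm_num)
  have hfP : EqOn (deriv f) P (Ioo 0 1) := by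
    refine isOpen_Ioo.eqOn_of_deriv_eq isPreconnected_Ioo hdd
      (fun x hx => (hPd x hx).differentiableAt.differentiableWithinAt) (fun x hx => ?_)
      (show (1 / 2 : ℝ) ∈ Ioo (0:ℝ) 1 by constructor <;> norm_num) (by simp [hP])
    rw [(hPd x hx).deriv, ← hfH x hx, iteratedDeriv_succ, iteratedDeriv_one]
  have hfd' : ∀ x ∈ Ioo (0:ℝ) 1, HasDerivAt f (P x) x := fun x hx => by
    rw [← hfP hx]
    exact (hfd.differentiableAt (Ioo_mem_nhds hx.1 hx.2)).hasDerivAt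
  have hPi : IntervalIntegrable P volume 0 1 :=
    ContinuousOn.intervalIntegrable (by rwa [uIcc_of_le zero_le_one])
  have hcos : ∀ x, HasDerivAt (fun x => -Real.cos (ω * x)) (ω * Real.sin (ω * x)) x := fun x => by
    have := (((hasDerivAt_id x).const_mul ω).cos).neg
    simp only [id, mul_one, neg_mul, neg_neg] at this
    rw [mul_comm]
    exact this
  have hsin : ∀ x, HasDerivAt (fun x => Real.sin (ω * x)) (ω * Real.cos (ω * x)) x := fun x => by
    have := ((hasDerivAt_id x).const_mul ω).sin
    simp only [id, mul_one] at this
    rw [mul_comm]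
    exact this
  have p1 := intervalIntegral.integral_mul_deriv_eq_deriv_mul_of_hasDerivAt (a := 0) (b := 1)
    (u := f) (u' := P) (v := fun x => -Real.cos (ω * x)) (v' := fun x => ω * Real.sin (ω * x))
    (by rwa [uIcc_of_le zero_le_one]) (Continuous.continuousOn (by fun_prop))
    (by simpa using hfd') (fun x _ => hcos x) hPi (Continuous.intervalIntegrable (by fun_prop) _ _)
  have p2 := intervalIntegral.integral_mul_deriv_eq_deriv_mul_of_hasDerivAt (a := 0) (b := 1)
    (u := P) (u' := H) (v := fun x => Real.sin (ω * x)) (v' := fun x => ω * Real.cos (ω * x))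
    (by rwa [uIcc_of_le zero_le_one]) (Continuous.continuousOn (by fun_prop))
    (by simpa using hPd) (fun x _ => hsin x) hHi (Continuous.intervalIntegrable (by fun_prop) _ _)
  have hsπ : Real.sin ω = 0 := by rw [hω]; exact Real.sin_nat_mul_pi k
  simp only [h0, h1, zero_mul, mul_zero, mul_one, Real.sin_zero, hsπ, sub_zero, zero_sub] at p1 p2
  have q1 : ∫ x in (0:ℝ)..1, f x * (ω * Real.sin (ω * x)) =
      ω * ∫ x in (0:ℝ)..1, f x * Real.sin (ω * x) := by
    rw [← intervalIntegral.integral_const_mul]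
    exact intervalIntegral.integral_congr fun x _ => by ring
  have q2 : ∫ x in (0:ℝ)..1, P x * (ω * Real.cos (ω * x)) =
      -(ω * ∫ x in (0:ℝ)..1, P x * -Real.cos (ω * x)) := by
    rw [← intervalIntegral.integral_const_mul, ← intervalIntegral.integral_neg]
    exact intervalIntegral.integral_congr fun x _ => by ring
  rw [q1] at p1
  rw [q2] at p2
  rw [sineCoeffFun, sineCoeffFun, ← hω]
  linear_combination (2 * ω) * p1 + 2 * p2

/-! ### Sine coefficients of functions of two variables -/

lemma continuousOn_sineCoeffFun {T : ℝ} {F : ℝ → ℝ → ℝ}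
    (hF : ContinuousOn (fun q : ℝ × ℝ => F q.1 q.2) (Icc 0 T ×ˢ Icc 0 1)) (k : ℕ) :
    ContinuousOn (fun t => sineCoeffFun (F t) k) (Icc 0 T) := by
  obtain ⟨C, hC⟩ := (isCompact_Icc.prod isCompact_Icc).exists_bound_of_continuousOn hF
  refine continuousOn_const.mul ?_
  simp only [intervalIntegral.integral_of_le zero_le_one]
  refine continuousOn_of_dominated (bound := fun _ => C) (fun t ht => ?_) (fun t ht => ?_)
    (integrable_const _) ?_
  · refine ContinuousOn.aestronglyMeasurable ?_ measurableSet_Ioc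
    exact (hF.comp (f := fun x => (t, x)) (by fun_prop)
      fun x hx => ⟨ht, Ioc_subset_Icc_self hx⟩).mul (Continuous.continuousOn (by fun_prop))
  · refine (ae_restrict_iff' measurableSet_Ioc).2 (Eventually.of_forall fun x hx => ?_)
    rw [norm_mul]
    exact (mul_le_of_le_one_right (norm_nonneg _) (Real.abs_sin_le_one _)).trans
      (hC (t, x) ⟨ht, Ioc_subset_Icc_self hx⟩)
  · refine (ae_restrict_iff' measurableSet_Ioc).2 (Eventually.of_forall fun x hx => ?_)
    exact (hF.comp (f := fun t => (t, x)) (by fun_prop)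
      fun t ht => ⟨ht, Ioc_subset_Icc_self hx⟩).mul continuousOn_const

lemma _root_.MemC.continuousOn_slice {T t : ℝ} {h : ℝ → ℝ → ℝ} (hh : MemC T h) (ht : t ∈ Ioc 0 T) :
    ContinuousOn (h t) (Icc 0 1) :=
  (memC_iff.1 hh).1.comp (f := fun x => (t, x)) (by fun_prop) fun _ hx => ⟨ht, hx⟩

lemma _root_.MemC.sineCoeffFun {T : ℝ} {h : ℝ → ℝ → ℝ} (hh : MemC T h) (k : ℕ) :
    Sing T (fun t => sineCoeffFun (h t) k) := by
  obtain ⟨p, hp, F, hF, hhF⟩ := hh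
  refine sing_iff.2 ⟨p, hp, fun t _ => Hilfer.sineCoeffFun (F t) k, ?_, fun t ht x _ => ?_⟩
  · exact (continuousOn_sineCoeffFun hF k).comp continuousOn_fst fun q hq => hq.1
  · rw [← sineCoeffFun_const_mul]
    exact sineCoeffFun_congr (fun x hx => hhF t ht x (Ioo_subset_Icc_self hx)) k

/-- Taking sine coefficients commutes with convolution in `t`, by Fubini's theorem. -/
lemma causalConv_sineCoeffFun {T t : ℝ} {κ : ℝ → ℝ} {h : ℝ → ℝ → ℝ} (hκ : Sing T κ)
    (hh : MemC T h) (ht : t ∈ Icc 0 T) (k : ℕ) :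
    causalConv κ (fun s => sineCoeffFun (h s) k) t =
      sineCoeffFun (fun x => causalConv κ (fun s => h s x) t) k := by
  obtain ⟨p, hp, F, hF, hhF⟩ := hh
  obtain ⟨C, hC⟩ := (isCompact_Icc.prod isCompact_Icc).exists_bound_of_continuousOn hF
  have hw := (intervalIntegrable_iff_integrableOn_Ioo_of_le ht.1).1
    (causalConv_integrand_intervalIntegrable hκ (sing_rpow T hp) ht)
  have hsub : ∀ s ∈ Ioo 0 t, s ∈ Ioc 0 T := fun s hs => ⟨hs.1, by linarith [hs.2, ht.2]⟩
  have hint : IntegrableOn (Function.uncurry fun s x => κ (t - s) * (h s x * Real.sin (k * Real.pi * x)))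
      (uIoc 0 t ×ˢ uIoc 0 1) := by
    rw [uIoc_of_le ht.1, uIoc_of_le zero_le_one, IntegrableOn, Measure.volume_eq_prod,
      ← Measure.prod_restrict, ← restrict_Ioo_eq_restrict_Ioc]
    have hdom : Integrable (fun z : ℝ × ℝ => (κ (t - z.1) * z.1 ^ p) * C)
        ((volume.restrict (Ioo 0 t)).prod (volume.restrict (Ioc (0:ℝ) 1))) :=
      Integrable.mul_prod hw (integrable_const C)
    have hmeas : AEStronglyMeasurable (fun z : ℝ × ℝ => (κ (t - z.1) * z.1 ^ p) *
        (F z.1 z.2 * Real.sin (k * Real.pi * z.2)))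
        ((volume.restrict (Ioo 0 t)).prod (volume.restrict (Ioc (0:ℝ) 1))) := by
      refine hw.aestronglyMeasurable.comp_fst.mul ?_
      rw [Measure.prod_restrict]
      refine ContinuousOn.aestronglyMeasurable (ContinuousOn.mul ?_ ?_)
        (measurableSet_Ioo.prod measurableSet_Ioc)
      · exact hF.mono (prod_mono (fun s hs => Ioc_subset_Icc_self (hsub s hs)) Ioc_subset_Icc_self)
      · exact Continuous.continuousOn (by fun_prop)
    have hmem : ∀ᵐ z : ℝ × ℝ ∂((volume.restrict (Ioo 0 t)).prod (volume.restrict (Ioc (0:ℝ) 1))),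
        z ∈ Ioo 0 t ×ˢ Ioc (0:ℝ) 1 := by
      rw [Measure.prod_restrict]
      exact ae_restrict_mem (measurableSet_Ioo.prod measurableSet_Ioc)
    have hkey : Integrable (fun z : ℝ × ℝ => (κ (t - z.1) * z.1 ^ p) *
        (F z.1 z.2 * Real.sin (k * Real.pi * z.2)))
        ((volume.restrict (Ioo 0 t)).prod (volume.restrict (Ioc (0:ℝ) 1))) := by
      refine hdom.norm.mono' hmeas ?_
      filter_upwards [hmem] with z hz
      have hb := hC z ⟨Ioc_subset_Icc_self (hsub _ hz.1), Ioc_subset_Icc_self hz.2⟩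
      rw [norm_mul, norm_mul (κ _ * _) C, norm_mul (F _ _)]
      refine mul_le_mul_of_nonneg_left ?_ (norm_nonneg _)
      exact ((mul_le_of_le_one_right (norm_nonneg _) (Real.abs_sin_le_one _)).trans hb).trans
        (Real.le_norm_self C)
    refine hkey.congr ?_
    filter_upwards [hmem] with z hz
    simp only [Function.uncurry]
    rw [hhF _ (hsub _ hz.1) _ (Ioc_subset_Icc_self hz.2)]
    ring
  have hswap := intervalIntegral_intervalIntegral_swap hint
  have e1 : causalConv κ (fun s => sineCoeffFun (h s) k) t = 2 * ∫ s in (0:ℝ)..t,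
      ∫ x in (0:ℝ)..1, κ (t - s) * (h s x * Real.sin (k * Real.pi * x)) := by
    rw [causalConv, ← intervalIntegral.integral_const_mul]
    refine intervalIntegral.integral_congr fun s _ => ?_
    rw [intervalIntegral.integral_const_mul, sineCoeffFun]
    ring
  rw [e1, hswap, sineCoeffFun]
  congr 1
  refine intervalIntegral.integral_congr fun x _ => ?_
  rw [causalConv, ← intervalIntegral.integral_mul_const]
  exact intervalIntegral.integral_congr fun s _ => by ring

lemma fracInt_sineCoeffFun {T t a : ℝ} {h : ℝ → ℝ → ℝ} (ha : 0 ≤ a)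
    (hh : MemC T h) (ht : t ∈ Icc 0 T) (k : ℕ) :
    fracInt a (fun s => sineCoeffFun (h s) k) t =
      sineCoeffFun (fun x => fracInt a (fun s => h s x) t) k := by
  rcases ha.eq_or_lt with rfl | ha
  · simp [fracInt_zero]
  · simp only [fracInt_eq_causalConv ha]
    exact causalConv_sineCoeffFun (sing_rlKernel T ha) hh ht k

/-! ### Fractional integrals of integrable functions -/

/-- The semigroup law for merely integrable functions. The condition `1 ≤ p + q` makes the kernel
`k_{p+q}` bounded, so that the law holds at every point instead of almost everywhere. -/
lemma causalConv_rlKernel_of_integrable {p q t : ℝ} {χ : ℝ → ℝ} (hp : 0 < p) (hq : 0 < q)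
    (hpq : 1 ≤ p + q) (ht : 0 < t) (hχ : IntervalIntegrable χ volume 0 t) :
    causalConv (rlKernel p) (causalConv (rlKernel q) χ) t = causalConv (rlKernel (p + q)) χ t := by
  have hp' := sing_rlKernel t hp
  have hq' := sing_rlKernel t hq
  have htt : t ∈ Icc 0 t := ⟨ht.le, le_rfl⟩
  have hχ' := (intervalIntegrable_iff_integrableOn_Ioc_of_le ht.le).1 hχ
  rw [causalConv_assoc_of_integrable ht (hp'.integrableOn htt) (hq'.integrableOn htt) hχ']
  · exact causalConv_congr htt (fun s hs => causalConv_rlKernel hp hq hs.1) fun _ _ => rfl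
  · have hcont : ContinuousOn (fun s => rlKernel (p + q) (t - s)) (uIcc 0 t) := by
      refine Continuous.continuousOn ?_
      exact ((continuous_const.sub continuous_id).rpow_const fun _ =>
        Or.inr (by linarith)).div_const _
    have h := hχ.abs.continuousOn_mul hcont
    rw [intervalIntegrable_iff_integrableOn_Ioo_of_le ht.le] at h ⊢
    refine h.congr_fun (fun s hs => ?_) measurableSet_Ioo
    have hts : 0 < t - s := by linarith [hs.2]
    beta_reduce
    rw [← causalConv_rlKernel hp hq hts]
    congr 1
    refine causalConv_congr (T := t - s) ⟨hts.le, le_rfl⟩ (fun r hr => ?_) fun r hr => ?_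
    · exact (abs_of_nonneg (rlKernel_nonneg hp hr.1.le)).symm
    · exact (abs_of_nonneg (rlKernel_nonneg hq hr.1.le)).symm

lemma intervalIntegrable_causalConv {t : ℝ} {κ χ : ℝ → ℝ} (ht : 0 < t)
    (hκ : IntervalIntegrable κ volume 0 t) (hχ : IntervalIntegrable χ volume 0 t) :
    IntervalIntegrable (causalConv κ χ) volume 0 t := by
  rw [intervalIntegrable_iff_integrableOn_Ioc_of_le ht.le] at hκ hχ ⊢
  have h := (hχ.integrable_indicator measurableSet_Ioc).integrable_convolution
    (ContinuousLinearMap.mul ℝ ℝ) (hκ.integrable_indicator measurableSet_Ioc)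
  exact h.integrableOn.congr_fun
    (fun s hs => convolution_indicator_eq κ χ ⟨hs.1.le, hs.2⟩) measurableSet_Ioc

/-- For `u = I^a φ` the Hilfer derivative of order `c < a` is `I^{a-c} φ` almost everywhere,
whatever its type. The inner derivative is merely integrable, so only the antiderivatives of both
sides can be compared. -/
lemma ae_hilferDeriv_eq {T a b c : ℝ} {u φ : ℝ → ℝ} (hb : b ∈ Icc (0:ℝ) 1) (hc : 0 < c)
    (hca : c < a) (ha1 : a < 1) (hu : Sing T u) (hφ : Sing T φ)
    (huφ : ∀ t ∈ Ioc 0 T, u t = fracInt a φ t) (hd : HilferDifferentiable T c b u)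
    (h0 : Tendsto (fracInt ((1 - b) * (1 - c)) u) (𝓝[>] 0) (𝓝 0)) :
    ∀ᵐ t : ℝ, t ∈ Ioo 0 T → hilferDeriv c b u t = fracInt (a - c) φ t := by
  obtain ⟨γ, hγ⟩ : ∃ γ, γ = (1 - b) * (1 - c) := ⟨_, rfl⟩
  obtain ⟨δ, hδ⟩ : ∃ δ, δ = b * (1 - c) := ⟨_, rfl⟩
  have hγ0 : 0 ≤ γ := hγ ▸ mul_nonneg (by linarith [hb.2]) (by linarith)
  have hδ0 : 0 ≤ δ := hδ ▸ mul_nonneg hb.1 (by linarith)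
  have hγδ : δ + γ = 1 - c := by rw [hγ, hδ]; ring
  rw [← hγ] at h0
  have hη : Sing T (fracInt (a - c) φ) := hφ.fracInt (by linarith)
  have hV : ∀ t ∈ Ioo 0 T, DifferentiableAt ℝ (fracInt γ u) t ∧
      IntervalIntegrable (deriv (fracInt γ u)) volume 0 t := by
    rw [hγ]; exact hd
  have key : ∀ t ∈ Ioo 0 T, fracInt δ (fracInt γ u) t = fracInt 1 (fracInt (a - c) φ) t := by
    intro t ht
    have ht' : t ∈ Ioc 0 T := ⟨ht.1, ht.2.le⟩
    rw [hu.fracInt_fracInt hδ0 hγ0 ht', hφ.fracInt_fracInt zero_le_one (by linarith) ht', hγδ,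
      fracInt_congr (by linarith) ht.1 fun s hs => huφ s ⟨hs.1, hs.2.trans ht'.2⟩,
      hφ.fracInt_fracInt (by linarith) (by linarith) ht']
    congr 1
    ring
  have hform : ∀ t, hilferDeriv c b u t = fracInt δ (deriv (fracInt γ u)) t := fun t => by
    rw [hilferDeriv, ← hγ, ← hδ]
  rcases hδ0.eq_or_lt with hδ1 | hδ1
  · refine Eventually.of_forall fun t ht => ?_
    rw [← hδ1, fracInt_zero] at key
    rw [hform, ← hδ1, fracInt_zero]
    refine ((hη.hasDerivAt_fracInt_one ht).congr_of_eventuallyEq ?_).deriv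
    filter_upwards [Ioo_mem_nhds ht.1 ht.2] with s hs using key s hs
  · have hprim : ∀ t ∈ Ioo 0 T, ∫ s in (0:ℝ)..t, hilferDeriv c b u s =
        fracInt 1 (fracInt (a - c) φ) t := by
      intro t ht
      have h1 : ∀ s ∈ Ioo 0 T, fracInt γ u s = causalConv (rlKernel 1) (deriv (fracInt γ u)) s := by
        intro s hs
        rw [causalConv_one_left]
        exact eq_integral_of_hasDerivAt_of_tendsto hs.1
          (fun r hr => (hV r ⟨hr.1, hr.2.trans_lt hs.2⟩).1.hasDerivAt) (hV s hs).2 h0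
      rw [← key t ht, ← causalConv_one_left, funext hform, fracInt_eq_causalConv hδ1,
        fracInt_eq_causalConv hδ1, causalConv_rlKernel_of_integrable one_pos hδ1 (by linarith) ht.1
          (hV t ht).2, add_comm, ← causalConv_rlKernel_of_integrable hδ1 one_pos (by linarith) ht.1
          (hV t ht).2]
      exact causalConv_congr (T := t) ⟨ht.1.le, le_rfl⟩ (fun _ _ => rfl)
        fun s hs => (h1 s ⟨hs.1, hs.2.trans ht.2⟩).symm
    have hint : ∀ t ∈ Ioo 0 T, IntervalIntegrable (hilferDeriv c b u) volume 0 t := by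
      intro t ht
      rw [funext hform, fracInt_eq_causalConv hδ1]
      exact intervalIntegrable_causalConv ht.1
        ((sing_rlKernel t hδ1).intervalIntegrable ⟨ht.1.le, le_rfl⟩) (hV t ht).2
    have hall : ∀ᵐ t : ℝ, ∀ q : ℚ, (q : ℝ) ∈ Ioo 0 T → t ∈ Ioo 0 (q : ℝ) →
        hilferDeriv c b u t = fracInt (a - c) φ t := by
      rw [ae_all_iff]
      intro q
      by_cases hq : (q : ℝ) ∈ Ioo 0 T
      · filter_upwards [(hint q hq).ae_hasDerivAt_integral] with t ht _ htq
        have h1 := ht (by rw [uIcc_of_le hq.1.le]; exact Ioo_subset_Icc_self htq) 0 left_mem_uIcc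
        have h2 := hη.hasDerivAt_fracInt_one (t := t) ⟨htq.1, htq.2.trans hq.2⟩
        refine h1.unique (h2.congr_of_eventuallyEq ?_)
        filter_upwards [Ioo_mem_nhds htq.1 (htq.2.trans hq.2)] with s hs using hprim s hs
      · exact Eventually.of_forall fun t h => absurd h hq
    filter_upwards [hall] with t ht htT
    obtain ⟨q, hq1, hq2⟩ := exists_rat_btwn htT.2
    exact ht q ⟨htT.1.trans hq1, hq2⟩ ⟨htT.1, hq1⟩

/-! ### Every solution is given by the series -/

/-- If `φ + μ I^{a-c} φ + l I^a φ = q`, then convolution of `q` with the Mittag-Leffler kernel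
gives `I^a φ`. -/
lemma causalConv_mlKernel_eq {T a c l μ : ℝ} {φ q : ℝ → ℝ} (hT : 0 < T) (hc : 0 < c) (hca : c < a)
    (hφ : Sing T φ) (hq : ∀ t ∈ Ioc 0 T,
      φ t + μ * fracInt (a - c) φ t + l * fracInt a φ t = q t) {t : ℝ} (ht : t ∈ Ioc 0 T) :
    causalConv (mlKernel a c μ l a) q t = fracInt a φ t := by
  have ha : 0 < a := hc.trans hca
  have hd : 0 < a - c := by linarith
  have ht' := Ioc_subset_Icc_self ht
  have hG := sing_mlKernel hT hc.le hca ha μ l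
  have hka := sing_rlKernel T ha
  have hkd := sing_rlKernel T hd
  rw [fracInt_eq_causalConv hd, fracInt_eq_causalConv ha] at hq
  rw [fracInt_eq_causalConv ha,
    causalConv_congr (f' := mlKernel a c μ l a) (g' := fun t => (φ t +
      μ * causalConv (rlKernel (a - c)) φ t) + l * causalConv (rlKernel a) φ t) ht'
      (fun _ _ => rfl) (fun s hs => (hq s ⟨hs.1, hs.2.le⟩).symm),
    hG.causalConv_add (hφ.add ((hkd.causalConv hφ).const_mul μ)) ((hka.causalConv hφ).const_mul l)
      ht', hG.causalConv_add hφ ((hkd.causalConv hφ).const_mul μ) ht', causalConv_const_mul_right,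
    causalConv_const_mul_right, hG.causalConv_assoc hkd hφ ht', hG.causalConv_assoc hka hφ ht',
    ← causalConv_const_mul_left, ← causalConv_const_mul_left,
    ← hG.add_causalConv ((hG.causalConv hkd).const_mul μ) hφ ht',
    ← (hG.add ((hG.causalConv hkd).const_mul μ)).add_causalConv ((hG.causalConv hka).const_mul l)
      hφ ht']
  refine causalConv_congr ht' (fun s hs => ?_) fun _ _ => rfl
  rw [causalConv_comm _ (rlKernel (a - c)), causalConv_comm _ (rlKernel a)]
  exact mlKernel_volterra hc.le hca ha μ l hs.1

/-- The eigenvalues `((k+1)π)²` of the Dirichlet problem. -/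
noncomputable def eigenval (k : ℕ) : ℝ := (((k + 1 : ℕ) : ℝ) * Real.pi) ^ 2

lemma eigenval_pos (k : ℕ) : 0 < eigenval k := by
  have := Real.pi_pos
  unfold eigenval
  positivity

lemma one_le_eigenval (k : ℕ) : 1 ≤ eigenval k := by
  have h3 := Real.pi_gt_three
  have h1 : (1:ℝ) ≤ ((k + 1 : ℕ) : ℝ) := by exact_mod_cast Nat.le_add_left 1 k
  exact one_le_pow₀ (by nlinarith)

lemma summable_eigenval_rpow : Summable fun k => eigenval k ^ (-(3 / 4) : ℝ) := by
  have h : Summable fun k : ℕ => ((k + 1 : ℕ) : ℝ) ^ (-(3 / 2) : ℝ) :=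
    (summable_nat_add_iff 1).2 (Real.summable_nat_rpow.2 (by norm_num))
  refine (h.mul_right (Real.pi ^ (-(3 / 2) : ℝ))).congr fun k => ?_
  have := Real.pi_pos
  rw [eigenval, ← Real.mul_rpow (by positivity) (by positivity), ← Real.rpow_natCast,
    ← Real.rpow_mul (by positivity)]
  norm_num

/-- The coefficient of `sin((k+1)πx)` in the solution. -/
noncomputable def modalSolution (a c μ : ℝ) (g : ℝ → ℝ → ℝ) (k : ℕ) : ℝ → ℝ :=
  causalConv (mlKernel a c μ (eigenval k) a) (sineCoeff g (k + 1))

lemma directIntegrand_eq (a c μ : ℝ) (g : ℝ → ℝ → ℝ) (k : ℕ) (t z : ℝ) :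
    directIntegrand a c μ g (k + 1) t z =
      sineCoeff g (k + 1) (t - z) * mlKernel a c μ (eigenval k) a z := by
  rw [directIntegrand, mlKernel, eigenval, mul_comm]

lemma integral_directIntegrand (a c μ : ℝ) (g : ℝ → ℝ → ℝ) (k : ℕ) (t : ℝ) :
    ∫ z in (0:ℝ)..t, directIntegrand a c μ g (k + 1) t z = modalSolution a c μ g k t := by
  simp only [directIntegrand_eq]
  rw [modalSolution, causalConv_comm]
  rfl

lemma sineCoeff_eq (g : ℝ → ℝ → ℝ) (k : ℕ) : sineCoeff g k = fun t => sineCoeffFun (g t) k := rfl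

section Source

variable {T : ℝ} {g : ℝ → ℝ → ℝ}

lemma _root_.SourceCondition.memC (hg : SourceCondition T g) : MemC T g :=
  memC_of_continuousOn hg.cont

lemma _root_.SourceCondition.continuousOn_sineCoeff (hg : SourceCondition T g) (k : ℕ) :
    ContinuousOn (sineCoeff g k) (Icc 0 T) :=
  continuousOn_sineCoeffFun hg.cont k

/-- The sine coefficients of the source decay like `1 / ((k+1)π)²`, uniformly in time. -/
lemma _root_.SourceCondition.exists_bound (hg : SourceCondition T g) :
    ∃ B, 0 ≤ B ∧ ∀ k, ∀ t ∈ Icc 0 T, |sineCoeff g (k + 1) t| ≤ B * (eigenval k)⁻¹ := by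
  obtain ⟨C, hC⟩ := (isCompact_Icc.prod isCompact_Icc).exists_bound_of_continuousOn hg.cont_xx
  refine ⟨2 * |C|, by positivity, fun k t ht => ?_⟩
  have hslice : ContinuousOn (g t) (Icc 0 1) := (hg.contDiff t ht).continuousOn
  have h := sineCoeffFun_of_iteratedDeriv (H := iteratedDerivWithin 2 (g t) (Icc 0 1)) hslice
    (hg.bdry t ht).1 (hg.bdry t ht).2 ((hg.contDiff t ht).mono Ioo_subset_Icc_self)
    (hg.cont_xx.comp (f := fun x => (t, x)) (by fun_prop) fun x hx => ⟨ht, hx⟩)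
    (fun x hx => (iteratedDerivWithin_eq_iteratedDeriv (uniqueDiffOn_Icc zero_lt_one)
      (((hg.contDiff t ht).contDiffAt (Icc_mem_nhds hx.1 hx.2)).of_le le_rfl)
      (Ioo_subset_Icc_self hx)).symm) (k + 1)
  have h2 := abs_sineCoeffFun_le (f := iteratedDerivWithin 2 (g t) (Icc 0 1)) (C := |C|)
    (fun x hx => (hC (t, x) ⟨ht, hx⟩).trans (le_abs_self C)) (k + 1)
  have hl := eigenval_pos k
  rw [sineCoeff_eq]
  rw [← div_eq_mul_inv, le_div_iff₀ hl]
  have h3 : |(eigenval k) * sineCoeffFun (g t) (k + 1)| ≤ 2 * |C| := by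
    rw [eigenval, h, abs_neg]
    exact h2
  rw [abs_mul, abs_of_pos hl] at h3
  linarith

end Source

section Modal

variable {T a c μ : ℝ} {g : ℝ → ℝ → ℝ}

/-- The modal solutions decay like `λ^{-7/4}`: a factor `λ^{-3/4}` comes from the kernel and a factor
`λ^{-1}` from the source. -/
lemma exists_modalSolution_bound (hT : 0 < T) (hc : 0 < c) (hca : c < a)
    (ha1 : a < 1) (hg : SourceCondition T g) (μ : ℝ) : ∃ B, 0 ≤ B ∧ ∀ k, ∀ t ∈ Ioc 0 T,
      |modalSolution a c μ g k t| ≤ B * eigenval k ^ (-(3 / 4) : ℝ) * (eigenval k)⁻¹ := by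
  have ha : 0 < a := hc.trans hca
  obtain ⟨C, hC0, hC⟩ := exists_mlKernel_decay μ hT hc hca ha1
  obtain ⟨B, hB0, hB⟩ := hg.exists_bound
  have hβ := ProbabilityTheory.beta_pos (one_pos) (show 0 < a / 4 by linarith)
  refine ⟨C * B * ProbabilityTheory.beta 1 (a / 4) * T ^ (a / 4), by positivity, fun k t ht => ?_⟩
  have hl := eigenval_pos k
  have h := abs_causalConv_le (T := T) (p := a / 4 - 1) (q := 0)
    (A := C * eigenval k ^ (-(3 / 4) : ℝ)) (B := B * (eigenval k)⁻¹) (by linarith) (by norm_num)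
    (fun s hs => hC _ hl s hs) (fun s hs => by
      simpa using hB k s (Ioc_subset_Icc_self hs)) ht
  rw [zero_add, sub_add_cancel, add_zero, sub_add_cancel] at h
  have h2 : t ^ (a / 4) ≤ T ^ (a / 4) := Real.rpow_le_rpow ht.1.le ht.2 (by linarith)
  have := Real.rpow_nonneg hl.le (-(3 / 4))
  calc _ ≤ _ := h
    _ ≤ C * eigenval k ^ (-(3 / 4) : ℝ) * (B * (eigenval k)⁻¹) * ProbabilityTheory.beta 1 (a / 4) *
        T ^ (a / 4) := by gcongr
    _ = _ := by ring

lemma summable_modalSolution (hc : 0 < c) (hca : c < a)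
    (ha1 : a < 1) (hg : SourceCondition T g) {t : ℝ} (ht : t ∈ Ioc 0 T) :
    Summable fun k => modalSolution a c μ g k t := by
  obtain ⟨B, hB0, hB⟩ := exists_modalSolution_bound (ht.1.trans_le ht.2) hc hca ha1 hg μ
  refine Summable.of_norm_bounded ((summable_eigenval_rpow.mul_left B)) fun k => ?_
  refine (hB k t ht).trans ?_
  have hl := eigenval_pos k
  exact mul_le_of_le_one_right (by positivity) (inv_le_one_of_one_le₀ (one_le_eigenval k))

/-- The sine coefficients of a solution are the modal solutions. At each fixed
`x` the Hilfer derivative of order `c` is identified only for almost every `t`; a countable dense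
set of `x` and the continuity in `x` give an equation on all of `(0,1)` for almost every `t`, and
the continuity in `t` of the sine coefficients gives the modal equations for every `t`. -/
lemma sineCoeff_of_isDirectSolution {b₁ b₂ : ℝ} {u : ℝ → ℝ → ℝ} (hT : 0 < T) (hc : 0 < c)
    (hca : c < a) (ha1 : a < 1) (hb₁ : b₁ ∈ Icc (0:ℝ) 1) (hb₂ : b₂ ∈ Icc (0:ℝ) 1)
    (hg : SourceCondition T g) (hu : IsDirectSolution a c b₁ b₂ μ T g u) (k : ℕ) {t : ℝ}
    (ht : t ∈ Ioc 0 T) : sineCoeffFun (u t) (k + 1) = modalSolution a c μ g k t := by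
  have ha : 0 < a := hc.trans hca
  have hd : 0 < a - c := by linarith
  obtain ⟨γ, hγ⟩ : ∃ γ, γ = (1 - b₁) * (1 - a) := ⟨_, rfl⟩
  obtain ⟨δ, hδ⟩ : ∃ δ, δ = b₁ * (1 - a) := ⟨_, rfl⟩
  have hγ0 : 0 ≤ γ := hγ ▸ mul_nonneg (by linarith [hb₁.2]) (by linarith)
  have hδ0 : 0 ≤ δ := hδ ▸ mul_nonneg hb₁.1 (by linarith)
  have hγδ : a + δ = 1 - γ := by rw [hγ, hδ]; ring
  obtain ⟨p, hp, F, hF, hder⟩ := hu.memCOne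
  rw [← hγ] at hder
  obtain ⟨ψ, hψdef⟩ : ∃ ψ : ℝ → ℝ → ℝ, ψ = fun t x => t ^ p * F t x := ⟨_, rfl⟩
  have hψ : MemC T ψ := ⟨p, hp, F, hF, fun t _ x _ => by rw [hψdef]⟩
  have hder : ∀ t ∈ Ioo 0 T, ∀ x ∈ Icc (0:ℝ) 1,
      HasDerivAt (fracInt γ fun s => u s x) (ψ t x) t := by
    rw [hψdef]; exact hder
  have hini := hu.initial₁
  rw [← hγ] at hini
  have hV : ∀ x ∈ Icc (0:ℝ) 1, ∀ t ∈ Ioc 0 T, fracInt γ (fun s => u s x) t =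
      fracInt 1 (fun s => ψ s x) t := by
    intro x hx t ht
    refine ((hu.memC.slice hx).fracInt hγ0).eqOn_Ioc ((hψ.slice hx).fracInt zero_le_one)
      (fun s hs => ?_) ht
    rw [fracInt_one]
    exact eq_integral_of_hasDerivAt_of_tendsto hs.1
      (fun r hr => hder r ⟨hr.1, hr.2.trans_lt hs.2⟩ x hx)
      ((hψ.slice hx).intervalIntegrable ⟨hs.1.le, hs.2.le⟩) (hini x hx)
  obtain ⟨φ, hφdef⟩ : ∃ φ : ℝ → ℝ → ℝ, φ = fun t x => fracInt δ (fun s => ψ s x) t := ⟨_, rfl⟩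
  have hφ : MemC T φ := hφdef ▸ hψ.fracInt hδ0
  have hφx : ∀ x, (fun s => φ s x) = fracInt δ fun s => ψ s x := fun x => by rw [hφdef]
  have huφ : ∀ x ∈ Icc (0:ℝ) 1, ∀ t ∈ Ioc 0 T, u t x = fracInt a (fun s => φ s x) t := by
    intro x hx t ht
    rw [hφx, (hψ.slice hx).fracInt_fracInt ha.le hδ0 ht, hγδ]
    refine (hu.memC.slice hx).eq_of_fracInt_one_eq ((hψ.slice hx).fracInt (by linarith))
      (fun s hs => ?_) ht
    have hs' : s ∈ Ioc 0 T := ⟨hs.1, hs.2.le⟩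
    have e1 := (hu.memC.slice hx).fracInt_fracInt (a := 1 - γ) (b := γ) (by linarith) hγ0 hs'
    rw [sub_add_cancel] at e1
    rw [← e1, fracInt_congr (by linarith) hs.1
      fun r hr => hV x hx r ⟨hr.1, hr.2.trans hs'.2⟩,
      (hψ.slice hx).fracInt_fracInt (by linarith) zero_le_one hs',
      (hψ.slice hx).fracInt_fracInt zero_le_one (by linarith) hs', add_comm]
  have hD1 : ∀ x ∈ Icc (0:ℝ) 1, ∀ t ∈ Ioo 0 T, hilferDeriv a b₁ (fun s => u s x) t = φ t x := by
    intro x hx t ht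
    rw [hilferDeriv, ← hγ, ← hδ, hφdef]
    exact fracInt_congr hδ0 ht.1 fun s hs => (hder s ⟨hs.1, hs.2.trans_lt ht.2⟩ x hx).deriv
  obtain ⟨η, hηdef⟩ : ∃ η : ℝ → ℝ → ℝ, η = fun t x => fracInt (a - c) (fun s => φ s x) t :=
    ⟨_, rfl⟩
  have hη : MemC T η := hηdef ▸ hφ.fracInt hd.le
  have hH : ∀ t ∈ Ioc 0 T, ContinuousOn (fun x => φ t x + μ * η t x + -1 * g t x) (Icc 0 1) :=
    fun t ht => ((hφ.continuousOn_slice ht).add (continuousOn_const.mul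
      (hη.continuousOn_slice ht))).add (continuousOn_const.mul (hg.memC.continuousOn_slice ht))
  have hae : ∀ᵐ t : ℝ, ∀ q : ℚ, (q : ℝ) ∈ Ioo (0:ℝ) 1 → t ∈ Ioo 0 T →
      iteratedDeriv 2 (u t) q = φ t q + μ * η t q + -1 * g t q := by
    rw [ae_all_iff]
    intro q
    by_cases hq : (q : ℝ) ∈ Ioo (0:ℝ) 1
    · have hq' := Ioo_subset_Icc_self hq
      filter_upwards [ae_hilferDeriv_eq hb₂ hc hca ha1 (hu.memC.slice hq') (hφ.slice hq')
        (huφ q hq') (hu.hilfer q hq) (hu.initial₂ q hq')] with t h1 _ ht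
      have h2 := hu.equation t ht q hq
      rw [h1 ht, hD1 q hq' t ht] at h2
      rw [hηdef]
      linarith
    · exact Eventually.of_forall fun t h => absurd h hq
  have hmode : ∀ᵐ t : ℝ, t ∈ Ioo 0 T → eigenval k * sineCoeffFun (u t) (k + 1) =
      -(sineCoeffFun (φ t) (k + 1) + μ * sineCoeffFun (η t) (k + 1) +
        -1 * sineCoeffFun (g t) (k + 1)) := by
    filter_upwards [hae] with t h1 ht
    have ht' : t ∈ Ioc 0 T := ⟨ht.1, ht.2.le⟩
    have hcd := hu.contDiff t ht'
    have hcont2 : ContinuousOn (iteratedDeriv 2 (u t)) (Ioo 0 1) :=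
      (hcd.continuousOn_iteratedDerivWithin le_rfl isOpen_Ioo.uniqueDiffOn).congr
        fun x hx => (iteratedDerivWithin_of_isOpen isOpen_Ioo hx).symm
    have heq : EqOn (iteratedDeriv 2 (u t)) (fun x => φ t x + μ * η t x + -1 * g t x)
        (Ioo 0 1) := by
      refine EqOn.of_subset_closure (s := Ioo (0:ℝ) 1 ∩ range ((↑) : ℚ → ℝ)) ?_ hcont2
        ((hH t ht').mono Ioo_subset_Icc_self) inter_subset_left
        (Rat.denseRange_cast.open_subset_closure_inter isOpen_Ioo)
      rintro x ⟨hx, q, rfl⟩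
      exact h1 q hx ht
    have h2 := sineCoeffFun_of_iteratedDeriv (hu.memC.continuousOn_slice ht')
      (hu.bdry t ⟨ht.1.le, ht.2.le⟩).1 (hu.bdry t ⟨ht.1.le, ht.2.le⟩).2 hcd (hH t ht') heq (k + 1)
    have hφc := hφ.continuousOn_slice ht'
    have hηc : ContinuousOn (fun x => μ * η t x) (Icc 0 1) :=
      continuousOn_const.mul (hη.continuousOn_slice ht')
    have hgc : ContinuousOn (fun x => -1 * g t x) (Icc 0 1) :=
      continuousOn_const.mul (hg.memC.continuousOn_slice ht')
    rw [eigenval, h2, sineCoeffFun_add (f := fun x => φ t x + μ * η t x)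
      (g := fun x => -1 * g t x) (hφc.add hηc) hgc, sineCoeffFun_add (f := φ t)
      (g := fun x => μ * η t x) hφc hηc, sineCoeffFun_const_mul, sineCoeffFun_const_mul]
  -- both sides are continuous in `t`, so that the modal equation holds for every `t`
  have hφk := hφ.sineCoeffFun (k + 1)
  have hηk := hη.sineCoeffFun (k + 1)
  have huk := hu.memC.sineCoeffFun (k + 1)
  have hgk := hg.memC.sineCoeffFun (k + 1)
  have hL := huk.const_mul (eigenval k)
  have hRR := ((hφk.add (hηk.const_mul μ)).add (hgk.const_mul (-1))).const_mul (-1)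
  have hmode' : ∀ t ∈ Ioc 0 T, eigenval k * sineCoeffFun (u t) (k + 1) =
      -1 * (sineCoeffFun (φ t) (k + 1) + μ * sineCoeffFun (η t) (k + 1) +
        -1 * sineCoeffFun (g t) (k + 1)) := by
    intro t ht
    refine hL.eqOn_Ioc hRR ?_ ht
    refine MeasureTheory.Measure.eqOn_open_of_ae_eq (μ := volume) ?_ isOpen_Ioo
      (hL.1.mono Ioo_subset_Ioc_self) (hRR.1.mono Ioo_subset_Ioc_self)
    rw [EventuallyEq, ae_restrict_iff' measurableSet_Ioo]
    filter_upwards [hmode] with s hs hs'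
    rw [hs hs']
    ring
  have huk' : ∀ t ∈ Ioc 0 T, sineCoeffFun (u t) (k + 1) =
      fracInt a (fun s => sineCoeffFun (φ s) (k + 1)) t := by
    intro t ht
    rw [fracInt_sineCoeffFun ha.le hφ (Ioc_subset_Icc_self ht)]
    exact sineCoeffFun_congr (fun x hx => huφ x (Ioo_subset_Icc_self hx) t ht) _
  rw [huk' t ht, modalSolution]
  refine (causalConv_mlKernel_eq hT hc hca hφk (fun s hs => ?_) ht).symm
  have h1 := hmode' s hs
  have h2 : sineCoeffFun (η s) (k + 1) =
      fracInt (a - c) (fun s => sineCoeffFun (φ s) (k + 1)) s := by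
    rw [fracInt_sineCoeffFun hd.le hφ (Ioc_subset_Icc_self hs), hηdef]
  rw [huk' s hs, h2] at h1
  rw [sineCoeff_eq]
  linarith

/-- Every solution is the sum of the series of modal solutions. -/
lemma hasSum_of_isDirectSolution {b₁ b₂ : ℝ} {u : ℝ → ℝ → ℝ} (hT : 0 < T) (hc : 0 < c)
    (hca : c < a) (ha1 : a < 1) (hb₁ : b₁ ∈ Icc (0:ℝ) 1) (hb₂ : b₂ ∈ Icc (0:ℝ) 1)
    (hg : SourceCondition T g) (hu : IsDirectSolution a c b₁ b₂ μ T g u) {t x : ℝ}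
    (ht : t ∈ Ioc 0 T) (hx : x ∈ Icc (0:ℝ) 1) :
    HasSum (fun k : ℕ => Real.sin (((k + 1 : ℕ) : ℝ) * Real.pi * x) * modalSolution a c μ g k t)
      (u t x) := by
  have hk := fun k => sineCoeff_of_isDirectSolution hT hc hca ha1 hb₁ hb₂ hg hu k ht
  have hb := hu.bdry t (Ioc_subset_Icc_self ht)
  have h := hasSum_sine_series (hu.memC.continuousOn_slice ht) hb.1 hb.2
    (by simpa only [hk] using summable_modalSolution hc hca ha1 hg ht) hx
  simpa only [hk] using h

end Modal

/-! ### Termwise differentiation of sine series -/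

/-- The eigenfunctions `sin((k+1)πx)` of the Dirichlet problem. -/
noncomputable def sineMode (k : ℕ) (x : ℝ) : ℝ := Real.sin (((k + 1 : ℕ) : ℝ) * Real.pi * x)

lemma continuous_sineMode (k : ℕ) : Continuous (sineMode k) := by
  unfold sineMode
  fun_prop

lemma abs_sineMode_le (k : ℕ) (x : ℝ) : |sineMode k x| ≤ 1 := Real.abs_sin_le_one _

lemma sineMode_zero (k : ℕ) : sineMode k 0 = 0 := by simp [sineMode]

lemma sineMode_one (k : ℕ) : sineMode k 1 = 0 := by
  rw [sineMode, mul_one]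
  exact Real.sin_nat_mul_pi _

lemma abs_sineMode_mul_le (k : ℕ) (x y : ℝ) : |sineMode k x * y| ≤ |y| := by
  rw [abs_mul]
  exact mul_le_of_le_one_left (abs_nonneg y) (abs_sineMode_le k x)

/-- A sine series whose coefficients are summable against the eigenvalues is twice differentiable
term by term. -/
lemma contDiff_sine_series {A : ℕ → ℝ} (hA : Summable fun k => eigenval k * A k) :
    ContDiff ℝ 2 (fun x => ∑' k, sineMode k x * A k) ∧
      ∀ x, iteratedDeriv 2 (fun x => ∑' k, sineMode k x * A k) x =
        -∑' k, sineMode k x * (eigenval k * A k) := by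
  obtain ⟨w, hw⟩ : ∃ w : ℕ → ℝ, w = fun k => ((k + 1 : ℕ) : ℝ) * Real.pi := ⟨_, rfl⟩
  have hwl : ∀ k, w k ^ 2 = eigenval k := fun k => by rw [hw, eigenval]
  have hw0 : ∀ k, 0 ≤ w k := fun k => by have := Real.pi_pos; rw [hw]; positivity
  have hw1 : ∀ k, 1 ≤ w k := fun k => by
    have h := one_le_eigenval k
    rw [← hwl] at h
    exact (one_le_sq_iff₀ (hw0 k)).1 h
  have hmode : ∀ k x, sineMode k x = Real.sin (w k * x) := fun k x => by rw [sineMode, hw]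
  have hs2 : Summable fun k => |eigenval k * A k| := hA.abs
  have hle2 : ∀ k, |w k * A k| ≤ |eigenval k * A k| := fun k => by
    rw [abs_mul, abs_mul, ← hwl, abs_of_nonneg (hw0 k), abs_of_nonneg (sq_nonneg (w k))]
    exact mul_le_mul_of_nonneg_right (by nlinarith [hw1 k]) (abs_nonneg _)
  have hle1 : ∀ k, |A k| ≤ |w k * A k| := fun k => by
    rw [abs_mul, abs_of_nonneg (hw0 k)]
    exact le_mul_of_one_le_left (abs_nonneg _) (hw1 k)
  have hs1 : Summable fun k => |w k * A k| :=
    Summable.of_nonneg_of_le (fun _ => abs_nonneg _) hle2 hs2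
  have hs0 : Summable fun k => |A k| := Summable.of_nonneg_of_le (fun _ => abs_nonneg _) hle1 hs1
  have hlin : ∀ k x, HasDerivAt (fun x => w k * x) (w k) x := fun k x => by
    simpa using (hasDerivAt_id x).const_mul (w k)
  have hd1 : ∀ x, HasDerivAt (fun x => ∑' k, sineMode k x * A k)
      (∑' k, Real.cos (w k * x) * (w k * A k)) x := by
    intro x
    refine hasDerivAt_tsum (g := fun k x => sineMode k x * A k)
      (g' := fun k x => Real.cos (w k * x) * (w k * A k)) hs1 (fun k y => ?_) (fun k y => ?_)
      (y₀ := 0) ?_ x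
    · have h := ((hlin k y).sin.mul_const (A k))
      simp only [hmode]
      exact h.congr_deriv (by ring)
    · rw [Real.norm_eq_abs, abs_mul]
      exact mul_le_of_le_one_left (abs_nonneg _) (Real.abs_cos_le_one _)
    · simpa only [sineMode_zero, zero_mul] using summable_zero
  have hd2 : ∀ x, HasDerivAt (fun x => ∑' k, Real.cos (w k * x) * (w k * A k))
      (∑' k, -(sineMode k x * (eigenval k * A k))) x := by
    intro x
    refine hasDerivAt_tsum (g := fun k x => Real.cos (w k * x) * (w k * A k))
      (g' := fun k x => -(sineMode k x * (eigenval k * A k))) hs2 (fun k y => ?_) (fun k y => ?_)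
      (y₀ := 0) ?_ x
    · have h := ((hlin k y).cos.mul_const (w k * A k))
      rw [hmode, ← hwl]
      exact h.congr_deriv (by ring)
    · rw [Real.norm_eq_abs, abs_neg]
      exact abs_sineMode_mul_le k y _
    · simpa using hs1.of_abs
  have hD1 : deriv (fun x => ∑' k, sineMode k x * A k) =
      fun x => ∑' k, Real.cos (w k * x) * (w k * A k) := funext fun x => (hd1 x).deriv
  have hD2 : deriv (fun x => ∑' k, Real.cos (w k * x) * (w k * A k)) =
      fun x => -∑' k, sineMode k x * (eigenval k * A k) :=
    funext fun x => by rw [(hd2 x).deriv, tsum_neg]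
  have hcont : Continuous fun x => -∑' k, sineMode k x * (eigenval k * A k) :=
    (continuous_tsum (fun k => (continuous_sineMode k).mul continuous_const) hs2
      fun k x => abs_sineMode_mul_le k x _).neg
  refine ⟨?_, fun x => ?_⟩
  · rw [show (2 : WithTop ℕ∞) = 1 + 1 from one_add_one_eq_two.symm, contDiff_succ_iff_deriv]
    refine ⟨fun x => (hd1 x).differentiableAt, by simp, ?_⟩
    rw [hD1, contDiff_one_iff_deriv, hD2]
    exact ⟨fun x => (hd2 x).differentiableAt, hcont⟩
  · rw [iteratedDeriv_succ, iteratedDeriv_one, hD1, hD2]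

/-! ### Hilfer derivatives of fractional integrals -/

lemma exists_fracInt_bound {γ p : ℝ} (hγ : 0 ≤ γ) (hp : -1 < p) : ∃ M, 0 ≤ M ∧
    ∀ T A : ℝ, ∀ f : ℝ → ℝ, (∀ t ∈ Ioc 0 T, |f t| ≤ A * t ^ p) →
      ∀ t ∈ Ioc 0 T, |fracInt γ f t| ≤ M * A * t ^ (p + γ) := by
  rcases hγ.eq_or_lt with rfl | hγ
  · refine ⟨1, zero_le_one, fun T A f hf t ht => ?_⟩
    rw [fracInt_zero, one_mul, add_zero]
    exact hf t ht
  · refine ⟨1 / Real.Gamma γ * ProbabilityTheory.beta (p + 1) γ, ?_, fun T A f hf t ht => ?_⟩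
    · have := Real.Gamma_pos_of_pos hγ
      have := ProbabilityTheory.beta_pos (α := p + 1) (β := γ) (by linarith) hγ
      positivity
    · rw [fracInt_eq_causalConv hγ]
      have h := abs_causalConv_le (T := T) (p := γ - 1) (q := p) (A := 1 / Real.Gamma γ) (B := A)
        (f := rlKernel γ) (by linarith) hp (fun s hs => ?_) hf ht
      · rw [sub_add_cancel, show γ - 1 + p + 1 = p + γ by ring] at h
        refine h.trans (le_of_eq ?_)
        ring
      · rw [abs_of_nonneg (rlKernel_nonneg hγ hs.1.le), rlKernel]
        exact le_of_eq (by ring)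

section HilferOfFracInt

variable {T a α b : ℝ} {f h ψ : ℝ → ℝ}

lemma hasDerivAt_of_eq_fracInt_one {V : ℝ → ℝ} (hψ : Sing T ψ)
    (hV : ∀ t ∈ Ioc 0 T, V t = fracInt 1 ψ t) {t : ℝ} (ht : t ∈ Ioo 0 T) :
    HasDerivAt V (ψ t) t :=
  (hψ.hasDerivAt_fracInt_one ht).congr_of_eventuallyEq <| by
    filter_upwards [isOpen_Ioo.mem_nhds ht] with s hs using hV s ⟨hs.1, hs.2.le⟩

lemma hilferDifferentiable_of_eq (hψ : Sing T ψ)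
    (hV : ∀ t ∈ Ioc 0 T, fracInt ((1 - b) * (1 - α)) f t = fracInt 1 ψ t) :
    HilferDifferentiable T α b f := by
  refine fun t ht => ⟨(hasDerivAt_of_eq_fracInt_one hψ hV ht).differentiableAt, ?_⟩
  refine (hψ.intervalIntegrable ⟨ht.1.le, ht.2.le⟩).congr fun s hs => ?_
  rw [uIoc_of_le ht.1.le] at hs
  exact (hasDerivAt_of_eq_fracInt_one hψ hV ⟨hs.1, hs.2.trans_lt ht.2⟩).deriv.symm

lemma tendsto_of_eq_fracInt_one {V : ℝ → ℝ} (hT : 0 < T) (hψ : Sing T ψ)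
    (hV : ∀ t ∈ Ioc 0 T, V t = fracInt 1 ψ t) : Tendsto V (𝓝[>] 0) (𝓝 0) :=
  (hψ.tendsto_fracInt_one hT).congr' <| by
    filter_upwards [Ioc_mem_nhdsGT hT] with s hs using (hV s hs).symm

/-- On the range of `I^a`, every Hilfer derivative of order `α ≤ a` is `I^{a-α}` of the preimage. -/
lemma hilferDeriv_fracInt (ha1 : α ≤ a) (hα : 0 < α) (hα1 : α < 1) (hb : b ∈ Icc (0:ℝ) 1)
    (hh : Sing T h) (hf : ∀ t ∈ Ioc 0 T, f t = fracInt a h t) (hψ : Sing T ψ)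
    (hV : ∀ t ∈ Ioc 0 T, fracInt ((1 - b) * (1 - α)) f t = fracInt 1 ψ t) {t : ℝ}
    (ht : t ∈ Ioo 0 T) : hilferDeriv α b f t = fracInt (a - α) h t := by
  have hδ : 0 ≤ b * (1 - α) := mul_nonneg hb.1 (by linarith)
  have hγ : 0 ≤ (1 - b) * (1 - α) := mul_nonneg (by linarith [hb.2]) (by linarith)
  have hfS : Sing T f := (hh.fracInt (hα.le.trans ha1)).congr hf
  have e1 : hilferDeriv α b f t = fracInt (b * (1 - α)) ψ t :=
    fracInt_congr hδ ht.1 fun s hs =>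
      (hasDerivAt_of_eq_fracInt_one hψ hV ⟨hs.1, hs.2.trans_lt ht.2⟩).deriv
  rw [e1]
  refine (hψ.fracInt hδ).eq_of_fracInt_one_eq (hh.fracInt (by linarith)) (fun s hs => ?_)
    ⟨ht.1, ht.2.le⟩
  have hs' : s ∈ Ioc 0 T := ⟨hs.1, hs.2.le⟩
  rw [hψ.fracInt_fracInt zero_le_one hδ hs', add_comm 1, ← hψ.fracInt_fracInt hδ zero_le_one hs',
    fracInt_congr hδ hs.1 fun r hr => (hV r ⟨hr.1, hr.2.trans hs'.2⟩).symm,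
    hfS.fracInt_fracInt hδ hγ hs', show b * (1 - α) + (1 - b) * (1 - α) = 1 - α by ring,
    fracInt_congr (by linarith) hs.1 fun r hr => hf r ⟨hr.1, hr.2.trans hs'.2⟩,
    hh.fracInt_fracInt (by linarith) (by linarith) hs',
    hh.fracInt_fracInt zero_le_one (by linarith) hs']
  congr 1
  ring

end HilferOfFracInt

/-! ### Existence -/

section Existence

variable {T a c μ : ℝ} {g : ℝ → ℝ → ℝ}

/-- The sum of the sine series with the modal solutions as coefficients. -/
noncomputable def seriesSolution (a c μ : ℝ) (g : ℝ → ℝ → ℝ) (t x : ℝ) : ℝ :=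
  ∑' k, sineMode k x * modalSolution a c μ g k t

lemma sing_modalSolution (hT : 0 < T) (hc : 0 < c) (hca : c < a) (hg : SourceCondition T g)
    (μ : ℝ) (k : ℕ) : Sing T (modalSolution a c μ g k) :=
  (sing_mlKernel hT hc.le hca (hc.trans hca) μ _).causalConv (hg.continuousOn_sineCoeff _).sing

/-- The modal equation after one application of `I^a`. -/
lemma modalSolution_volterra (hT : 0 < T) (hc : 0 < c) (hca : c < a) (hg : SourceCondition T g)
    (μ : ℝ) (k : ℕ) {t : ℝ} (ht : t ∈ Ioc 0 T) :
    modalSolution a c μ g k t + μ * fracInt (a - c) (modalSolution a c μ g k) t =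
      fracInt a (fun s => sineCoeff g (k + 1) s - eigenval k * modalSolution a c μ g k s) t := by
  have ha : 0 < a := hc.trans hca
  have hd : 0 < a - c := by linarith
  have ht' := Ioc_subset_Icc_self ht
  have hY := sing_mlKernel hT hc.le hca ha μ (eigenval k)
  have hgk := (hg.continuousOn_sineCoeff (k + 1)).sing
  have hka := sing_rlKernel T ha
  have hkd := sing_rlKernel T hd
  have hu := sing_modalSolution hT hc hca hg μ k
  rw [hgk.fracInt_sub ha.le (hu.const_mul _) ht', fracInt_const_mul ha.le, eq_sub_iff_add_eq,
    modalSolution, hY.fracInt_causalConv hd.le hgk ht', hY.fracInt_causalConv ha.le hgk ht',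
    fracInt_eq_causalConv hd, fracInt_eq_causalConv ha, fracInt_eq_causalConv ha,
    ← causalConv_const_mul_left, ← causalConv_const_mul_left, ← hY.add_causalConv ((hkd.causalConv hY).const_mul μ) hgk ht',
    ← (hY.add ((hkd.causalConv hY).const_mul μ)).add_causalConv ((hka.causalConv hY).const_mul _)
      hgk ht']
  exact causalConv_congr ht' (fun s hs => mlKernel_volterra hc.le hca ha μ (eigenval k) hs.1)
    fun _ _ => rfl

lemma exists_eigenval_mul_modalSolution_bound (hT : 0 < T) (hc : 0 < c) (hca : c < a)
    (ha1 : a < 1) (hg : SourceCondition T g) (μ : ℝ) : ∃ B, 0 ≤ B ∧ ∀ k, ∀ t ∈ Ioc 0 T,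
      |modalSolution a c μ g k t| ≤ B * eigenval k ^ (-(3 / 4) : ℝ) ∧
      |eigenval k * modalSolution a c μ g k t| ≤ B * eigenval k ^ (-(3 / 4) : ℝ) := by
  obtain ⟨B, hB0, hB⟩ := exists_modalSolution_bound hT hc hca ha1 hg μ
  refine ⟨B, hB0, fun k t ht => ?_⟩
  have hl := eigenval_pos k
  have h2 : |eigenval k * modalSolution a c μ g k t| ≤ B * eigenval k ^ (-(3 / 4) : ℝ) := by
    rw [abs_mul, abs_of_pos hl]
    calc _ ≤ eigenval k * (B * eigenval k ^ (-(3 / 4) : ℝ) * (eigenval k)⁻¹) :=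
          mul_le_mul_of_nonneg_left (hB k t ht) hl.le
      _ = _ := by field_simp
  refine ⟨le_trans ?_ h2, h2⟩
  rw [abs_mul, abs_of_pos hl]
  exact le_mul_of_one_le_left (abs_nonneg _) (one_le_eigenval k)

lemma exists_sineCoeff_bound (hg : SourceCondition T g) : ∃ B, 0 ≤ B ∧ ∀ k, ∀ t ∈ Icc 0 T,
    |sineCoeff g (k + 1) t| ≤ B * eigenval k ^ (-(3 / 4) : ℝ) := by
  obtain ⟨B, hB0, hB⟩ := hg.exists_bound
  refine ⟨B, hB0, fun k t ht => (hB k t ht).trans (mul_le_mul_of_nonneg_left ?_ hB0)⟩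
  rw [← Real.rpow_neg_one]
  exact Real.rpow_le_rpow_of_exponent_le (one_le_eigenval k) (by norm_num)

lemma hasSum_sineCoeff (hg : SourceCondition T g) {t x : ℝ} (ht : t ∈ Icc 0 T)
    (hx : x ∈ Icc (0:ℝ) 1) :
    HasSum (fun k => sineMode k x * sineCoeff g (k + 1) t) (g t x) := by
  obtain ⟨B, -, hB⟩ := exists_sineCoeff_bound hg
  exact hasSum_sine_series (hg.contDiff t ht).continuousOn (hg.bdry t ht).1 (hg.bdry t ht).2
    (Summable.of_norm_bounded (summable_eigenval_rpow.mul_left B) fun k => hB k t ht) hx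

/-- The sum of the series solves the equation in integrated form: `u = I^a h` with
`h + μ I^{a-c} h = g + u_xx`. The function `h` is obtained from `g + u_xx` by means of the
resolvent of the kernel of `μ I^{a-c}`. -/
lemma exists_eq_fracInt_seriesSolution (hT : 0 < T) (hc : 0 < c) (hca : c < a) (ha1 : a < 1)
    (hg : SourceCondition T g) (μ : ℝ) : ∃ h : ℝ → ℝ → ℝ, MemC T h ∧
      ∀ t ∈ Ioc 0 T, ∀ x ∈ Icc (0:ℝ) 1,
        seriesSolution a c μ g t x = fracInt a (fun s => h s x) t ∧
        h t x + μ * fracInt (a - c) (fun s => h s x) t =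
          g t x + iteratedDeriv 2 (seriesSolution a c μ g t) x := by
  have ha : 0 < a := hc.trans hca
  have hd : 0 < a - c := by linarith
  obtain ⟨B, hB0, hB⟩ := exists_eigenval_mul_modalSolution_bound hT hc hca ha1 hg μ
  obtain ⟨B', hB'0, hB'⟩ := exists_sineCoeff_bound hg
  obtain ⟨U, hU⟩ : ∃ U, U = modalSolution a c μ g := ⟨_, rfl⟩
  have hUs : ∀ k, Sing T (U k) := fun k => hU ▸ sing_modalSolution hT hc hca hg μ k
  rw [← hU] at hB
  have hQs : ∀ k, Sing T fun t => sineCoeff g (k + 1) t - eigenval k * U k t := fun k =>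
    (hg.continuousOn_sineCoeff (k + 1)).sing.sub ((hUs k).const_mul _)
  have hsB := summable_eigenval_rpow.mul_left B
  have hsB' := summable_eigenval_rpow.mul_left (B' + B)
  have hUb : ∀ k, ∀ t ∈ Ioc 0 T, |U k t| ≤ B * eigenval k ^ (-(3 / 4) : ℝ) * t ^ (0:ℝ) := by
    intro k t ht
    simpa using (hB k t ht).1
  have hQb : ∀ k, ∀ t ∈ Ioc 0 T, |sineCoeff g (k + 1) t - eigenval k * U k t| ≤
      (B' + B) * eigenval k ^ (-(3 / 4) : ℝ) * t ^ (0:ℝ) := by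
    intro k t ht
    rw [Real.rpow_zero, mul_one, add_mul]
    exact (abs_sub _ _).trans
      (add_le_add (hB' k t (Ioc_subset_Icc_self ht)) (hB k t ht).2)
  -- `q` is `g + u_xx` written as a sine series
  obtain ⟨q, hq⟩ : ∃ q : ℝ → ℝ → ℝ, q = fun t x => ∑' k, sineMode k x *
      (sineCoeff g (k + 1) t - eigenval k * U k t) := ⟨_, rfl⟩
  have hqC : MemC T q := hq ▸ memC_tsum (by norm_num) hQs hQb hsB' continuous_sineMode
    abs_sineMode_le
  have huC : MemC T (seriesSolution a c μ g) := by
    unfold seriesSolution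
    rw [← hU]
    exact memC_tsum (by norm_num) hUs hUb hsB continuous_sineMode abs_sineMode_le
  have hvol : ∀ x, ∀ t ∈ Ioc 0 T, seriesSolution a c μ g t x +
      μ * fracInt (a - c) (fun s => seriesSolution a c μ g s x) t =
        fracInt a (fun s => q s x) t := by
    intro x t ht
    have hbound : ∀ {D : ℝ} {F : ℕ → ℝ → ℝ}, (∀ k, ∀ t ∈ Ioc 0 T,
        |F k t| ≤ D * eigenval k ^ (-(3 / 4) : ℝ) * t ^ (0:ℝ)) → ∀ k, ∀ t ∈ Ioc 0 T,
        |sineMode k x * F k t| ≤ D * eigenval k ^ (-(3 / 4) : ℝ) * t ^ (0:ℝ) :=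
      fun h k t ht => (abs_sineMode_mul_le k x _).trans (h k t ht)
    have h1 := hasSum_fracInt (by norm_num) (fun k => (hUs k).const_mul (sineMode k x))
      (hbound hUb) hsB hd.le ht
    have h2 := hasSum_fracInt (by norm_num) (fun k => (hQs k).const_mul (sineMode k x))
      (hbound hQb) hsB' ha.le ht
    have h3 := (summable_of_bound (hbound hUb) hsB ht).hasSum
    have h4 := h3.add (h1.mul_left μ)
    have h5 : seriesSolution a c μ g = fun t x => ∑' k, sineMode k x * U k t := by
      rw [hU]
      rfl
    rw [h5, hq]
    refine h4.unique (h2.congr_fun fun k => ?_)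
    rw [fracInt_const_mul hd.le, fracInt_const_mul ha.le, hU,
      ← modalSolution_volterra hT hc hca hg μ k ht]
    ring
  -- the kernel with `l = 0` is the resolvent of `μ k_{a-c}`
  have hR := sing_mlKernel (T := T) hT hc.le hca hd μ 0
  have hRV : ∀ t, 0 < t → mlKernel a c μ 0 (a - c) t +
      μ * causalConv (rlKernel (a - c)) (mlKernel a c μ 0 (a - c)) t = rlKernel (a - c) t :=
    fun t ht => by simpa using mlKernel_volterra hc.le hca hd μ 0 ht
  obtain ⟨R, hRdef⟩ : ∃ R, R = mlKernel a c μ 0 (a - c) := ⟨_, rfl⟩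
  rw [← hRdef] at hR hRV
  have hkd := sing_rlKernel T hd
  have hRC : MemC T fun t _ => R t := sing_iff.1 hR
  obtain ⟨h, hh⟩ : ∃ h : ℝ → ℝ → ℝ, h = fun t x => q t x - μ * causalConv R (fun s => q s x) t :=
    ⟨_, rfl⟩
  refine ⟨h, hh ▸ hqC.sub ((hRC.causalConv hqC).const_mul μ), fun t ht x hx => ?_⟩
  have ht' := Ioc_subset_Icc_self ht
  have hqx := hqC.slice hx
  have hhx : (fun s => h s x) = fun s => q s x - μ * causalConv R (fun s => q s x) s := by rw [hh]
  constructor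
  · rw [eq_sub_resolvent (q := fracInt a fun s => q s x) hd hR hRV (huC.slice hx) (fun s hs => by
      rw [← hvol x s hs, fracInt_eq_causalConv hd]) ht, hhx,
      hqx.fracInt_sub ha.le ((hR.causalConv hqx).const_mul μ) ht', fracInt_const_mul ha.le,
      hR.fracInt_causalConv' ha.le hqx ht']
  · have e1 : q t x = g t x + iteratedDeriv 2 (seriesSolution a c μ g t) x := by
      have hsl : Summable fun k => eigenval k * U k t :=
        Summable.of_norm_bounded hsB fun k => (hB k t ht).2
      have h1 := (contDiff_sine_series hsl).2 x
      have h2 := hasSum_sineCoeff hg ht' hx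
      have h3 : HasSum (fun k => sineMode k x * (eigenval k * U k t))
          (∑' k, sineMode k x * (eigenval k * U k t)) :=
        (Summable.of_norm_bounded hsl.abs fun k => abs_sineMode_mul_le k x _).hasSum
      have h4 : seriesSolution a c μ g t = fun x => ∑' k, sineMode k x * U k t := by
        rw [hU]
        rfl
      rw [h4, h1, ← sub_eq_add_neg, ← (h2.sub h3).tsum_eq, hq]
      exact tsum_congr fun k => by ring
    have e2 : causalConv (rlKernel (a - c)) (fun s => q s x) t =
        causalConv R (fun s => q s x) t +
          μ * causalConv (causalConv (rlKernel (a - c)) R) (fun s => q s x) t := by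
      rw [← causalConv_const_mul_left,
        ← hR.add_causalConv ((hkd.causalConv hR).const_mul μ) hqx ht']
      exact causalConv_congr ht' (fun s hs => (hRV s hs.1).symm) fun _ _ => rfl
    rw [← e1, hhx, fracInt_eq_causalConv hd, hkd.causalConv_sub hqx
      ((hR.causalConv hqx).const_mul μ) ht', causalConv_const_mul_right,
      hkd.causalConv_assoc hR hqx ht', e2, hh]
    ring

/-- If `γ + a ≥ 1`, then `I^γ I^a h` is an integral `I^1 ψ`, by the semigroup law. -/
lemma exists_fracInt_eq_of_one_le_add {γ : ℝ} {u h : ℝ → ℝ → ℝ} (ha : 0 ≤ a) (hγ : 0 ≤ γ)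
    (hγa : 1 ≤ γ + a) (hh : MemC T h)
    (hu : ∀ t ∈ Ioc 0 T, ∀ x ∈ Icc (0:ℝ) 1, u t x = fracInt a (fun s => h s x) t) :
    ∃ ψ : ℝ → ℝ → ℝ, MemC T ψ ∧ ∀ x ∈ Icc (0:ℝ) 1, ∀ t ∈ Ioc 0 T,
      fracInt γ (fun s => u s x) t = fracInt 1 (fun s => ψ s x) t := by
  refine ⟨fun t x => fracInt (γ + a - 1) (fun s => h s x) t, hh.fracInt (by linarith),
    fun x hx t ht => ?_⟩
  rw [fracInt_congr hγ ht.1 fun s hs => hu s ⟨hs.1, hs.2.trans ht.2⟩ x hx,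
    (hh.slice hx).fracInt_fracInt hγ ha ht,
    (hh.slice hx).fracInt_fracInt zero_le_one (by linarith) ht, add_sub_cancel]

/-- If the source has a time derivative, its sine coefficients are integrals of functions with a
common singularity at `0`. -/
lemma exists_sineCoeff_eq (hT : 0 < T) (hg : SourceCondition T g) (hgt : MemCOne T g) :
    ∃ d : ℕ → ℝ → ℝ, ∃ p : ℝ, -1 < p ∧ ∃ D, 0 ≤ D ∧ ∀ k, Sing T (d k) ∧
      (∀ t ∈ Ioc 0 T, |d k t| ≤ D * t ^ p) ∧
      ∀ t ∈ Ioc 0 T, sineCoeff g (k + 1) t = sineCoeff g (k + 1) 0 + fracInt 1 (d k) t := by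
  obtain ⟨p, hp, F, hF, hder⟩ := hgt
  obtain ⟨ψ, hψdef⟩ : ∃ ψ : ℝ → ℝ → ℝ, ψ = fun t x => t ^ p * F t x := ⟨_, rfl⟩
  have hψ : MemC T ψ := ⟨p, hp, F, hF, fun t _ x _ => by rw [hψdef]⟩
  obtain ⟨-, r, hr, C, hC⟩ := memC_iff.1 hψ
  have hder : ∀ t ∈ Ioo 0 T, ∀ x ∈ Icc (0:ℝ) 1, HasDerivAt (fun s => g s x) (ψ t x) t := by
    rw [hψdef]; exact hder
  have hC0 : 0 ≤ C := by
    have h := (abs_nonneg _).trans (hC T ⟨hT, le_rfl⟩ 0 ⟨le_rfl, zero_le_one⟩)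
    exact nonneg_of_mul_nonneg_left h (Real.rpow_pos_of_pos hT r)
  refine ⟨fun k t => sineCoeffFun (ψ t) (k + 1), r, hr, 2 * C, by linarith, fun k =>
    ⟨hψ.sineCoeffFun _, fun t ht => ?_, fun t ht => ?_⟩⟩
  · rw [mul_assoc]
    exact abs_sineCoeffFun_le (hC t ht) _
  · have h0 : (0:ℝ) ∈ Icc 0 T := ⟨le_rfl, hT.le⟩
    have hslice : ∀ x ∈ Icc (0:ℝ) 1, ContinuousOn (fun s => g s x) (Icc 0 T) := fun x hx =>
      hg.cont.comp (f := fun s => (s, x)) (by fun_prop) fun s hs => ⟨hs, hx⟩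
    have hint : ∀ x ∈ Icc (0:ℝ) 1, g t x = g 0 x + fracInt 1 (fun s => ψ s x) t := by
      intro x hx
      have e : ∀ s ∈ Ioc 0 T, g s x - g 0 x = fracInt 1 (fun s => ψ s x) s := by
        intro s hs
        refine ((hslice x hx).sub continuousOn_const).sing.eqOn_Ioc
          ((hψ.slice hx).fracInt zero_le_one) (fun y hy => ?_) hs
        rw [fracInt_one]
        refine eq_integral_of_hasDerivAt_of_tendsto (w := fun s => g s x - g 0 x) hy.1
          (fun z hz => (hder z ⟨hz.1, hz.2.trans_lt hy.2⟩ x hx).sub_const _)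
          ((hψ.slice hx).intervalIntegrable ⟨hy.1.le, hy.2.le⟩) ?_
        have h1 := ((hslice x hx) 0 h0).mono_left (nhdsWithin_le_iff.2 (Icc_mem_nhdsGT hT))
        simpa using h1.sub_const (g 0 x)
      rw [← e t ht]
      ring
    have ht' := Ioc_subset_Icc_self ht
    rw [fracInt_sineCoeffFun zero_le_one hψ ht', sineCoeff_eq]
    refine (sineCoeffFun_congr (fun x hx => hint x (Ioo_subset_Icc_self hx)) _).trans
      (sineCoeffFun_add (hg.contDiff 0 h0).continuousOn
        ((hψ.fracInt zero_le_one).continuousOn_slice ht) _)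

/-- If the source has a time derivative, `I^γ u` is an integral `I^1 ψ` for every `γ`: the
derivative falls on the source, and the decay of the kernels in the eigenvalue sums the series. -/
lemma exists_fracInt_seriesSolution_eq_of_memCOne {γ : ℝ} (hT : 0 < T) (hc : 0 < c) (hca : c < a)
    (ha1 : a < 1) (hγ : 0 ≤ γ) (hg : SourceCondition T g) (hgt : MemCOne T g) (μ : ℝ) :
    ∃ ψ : ℝ → ℝ → ℝ, MemC T ψ ∧ ∀ x ∈ Icc (0:ℝ) 1, ∀ t ∈ Ioc 0 T,
      fracInt γ (fun s => seriesSolution a c μ g s x) t = fracInt 1 (fun s => ψ s x) t := by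
  have ha : 0 < a := hc.trans hca
  obtain ⟨d, p, hp, D, hD0, hd⟩ := exists_sineCoeff_eq hT hg hgt
  obtain ⟨C, hC0, hC⟩ := exists_mlKernel_decay μ hT hc hca ha1
  obtain ⟨M, hM0, hM⟩ := exists_fracInt_bound (p := a / 4 - 1) hγ (by linarith)
  obtain ⟨B, hB0, hB⟩ := hg.exists_bound
  obtain ⟨B₁, -, hB₁⟩ := exists_eigenval_mul_modalSolution_bound hT hc hca ha1 hg μ
  have hk1 := sing_rlKernel T one_pos
  -- the exponent of the singularity of `I^γ G`; convolution with `d k` only raises it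
  obtain ⟨r, hr⟩ : ∃ r, r = a / 4 - 1 + γ := ⟨_, rfl⟩
  have hr1 : -1 < r := by linarith
  obtain ⟨K, hK⟩ : ∃ K : ℕ → ℝ → ℝ, K = fun k => fracInt γ (mlKernel a c μ (eigenval k) a) :=
    ⟨_, rfl⟩
  have hY : ∀ k, Sing T (mlKernel a c μ (eigenval k) a) := fun k => sing_mlKernel hT hc.le hca ha μ _
  have hKs : ∀ k, Sing T (K k) := fun k => hK ▸ (hY k).fracInt hγ
  have hKb : ∀ k, ∀ t ∈ Ioc 0 T, |K k t| ≤ M * (C * eigenval k ^ (-(3 / 4) : ℝ)) * t ^ r := by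
    intro k t ht
    rw [hK, hr]
    exact hM T _ _ (fun s hs => hC _ (eigenval_pos k) s hs) t ht
  -- `I^γ u_k = K k * g_k` with `g_k = g_k(0) + I^1 (d k)`, and `I^1` is taken out
  obtain ⟨ψ, hψ⟩ : ∃ ψ : ℕ → ℝ → ℝ, ψ = fun k t =>
      sineCoeff g (k + 1) 0 * K k t + causalConv (K k) (d k) t := ⟨_, rfl⟩
  have hψs : ∀ k, Sing T (ψ k) := fun k =>
    hψ ▸ ((hKs k).const_mul _).add ((hKs k).causalConv (hd k).1)
  obtain ⟨β, hβ⟩ : ∃ β, β = ProbabilityTheory.beta (p + 1) (r + 1) := ⟨_, rfl⟩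
  have hβ0 : 0 ≤ β := hβ ▸ (ProbabilityTheory.beta_pos (by linarith) (by linarith)).le
  obtain ⟨L, hL⟩ : ∃ L, L = M * C * (B + D * β * T ^ (p + 1)) := ⟨_, rfl⟩
  have hψb : ∀ k, ∀ t ∈ Ioc 0 T, |ψ k t| ≤ L * eigenval k ^ (-(3 / 4) : ℝ) * t ^ r := by
    intro k t ht
    have hl := eigenval_pos k
    have hl1 := Real.rpow_nonneg hl.le (-(3 / 4))
    have htr := Real.rpow_nonneg ht.1.le r
    have h1 := abs_causalConv_le hr1 hp (hKb k) (hd k).2.1 ht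
    rw [← hβ] at h1
    have h2 : t ^ (r + p + 1) ≤ T ^ (p + 1) * t ^ r := by
      have := rpow_le_mul_rpow (p := r + p + 1) (r := r) (by linarith) ht
      rwa [show r + p + 1 - r = p + 1 by ring] at this
    have h3 : |sineCoeff g (k + 1) 0| ≤ B := (hB k 0 ⟨le_rfl, hT.le⟩).trans
      (mul_le_of_le_one_right hB0 (inv_le_one_of_one_le₀ (one_le_eigenval k)))
    rw [hψ]
    calc |sineCoeff g (k + 1) 0 * K k t + causalConv (K k) (d k) t|
        ≤ |sineCoeff g (k + 1) 0| * |K k t| + |causalConv (K k) (d k) t| := by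
          rw [← abs_mul]
          exact abs_add_le _ _
      _ ≤ B * (M * (C * eigenval k ^ (-(3 / 4) : ℝ)) * t ^ r) +
          M * (C * eigenval k ^ (-(3 / 4) : ℝ)) * D * β * (T ^ (p + 1) * t ^ r) :=
          add_le_add (mul_le_mul h3 (hKb k t ht) (abs_nonneg _) hB0)
            (h1.trans (mul_le_mul_of_nonneg_left h2 (by positivity)))
      _ = _ := by rw [hL]; ring
  have hsL := summable_eigenval_rpow.mul_left L
  refine ⟨fun t x => ∑' k, sineMode k x * ψ k t,
    memC_tsum hr1 hψs hψb hsL continuous_sineMode abs_sineMode_le, fun x hx t ht => ?_⟩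
  have ht' := Ioc_subset_Icc_self ht
  have hterm : ∀ k, fracInt γ (modalSolution a c μ g k) t = fracInt 1 (ψ k) t := by
    intro k
    have hdk := (hd k).1
    rw [modalSolution, (hY k).fracInt_causalConv hγ (hg.continuousOn_sineCoeff (k + 1)).sing ht',
      show fracInt γ (mlKernel a c μ (eigenval k) a) = K k by rw [hK],
      causalConv_congr (f' := K k) (g' := fun s => sineCoeff g (k + 1) 0 * rlKernel 1 s +
        causalConv (rlKernel 1) (d k) s) ht' (fun _ _ => rfl) (fun s hs => by
          rw [(hd k).2.2 s ⟨hs.1, hs.2.le⟩, rlKernel_one, mul_one,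
            fracInt_eq_causalConv one_pos]),
      (hKs k).causalConv_add (hk1.const_mul _) (hk1.causalConv hdk) ht',
      causalConv_const_mul_right, (hKs k).causalConv_left_comm hk1 hdk ht',
      causalConv_comm (K k), hψ, Sing.fracInt_add zero_le_one ((hKs k).const_mul _)
        ((hKs k).causalConv hdk) ht', fracInt_const_mul zero_le_one,
      fracInt_eq_causalConv one_pos, fracInt_eq_causalConv one_pos]
  have h1 := hasSum_fracInt (p := 0) (c := fun k => B₁ * eigenval k ^ (-(3 / 4) : ℝ))
    (by norm_num)
    (fun k => (sing_modalSolution hT hc hca hg μ k).const_mul (sineMode k x))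
    (fun k t ht => by simpa using (abs_sineMode_mul_le k x _).trans (hB₁ k t ht).1)
    (summable_eigenval_rpow.mul_left B₁) hγ ht
  have h2 := hasSum_fracInt hr1 (fun k => (hψs k).const_mul (sineMode k x))
    (fun k t ht => (abs_sineMode_mul_le k x _).trans (hψb k t ht)) hsL zero_le_one ht
  refine h1.unique (h2.congr_fun fun k => ?_)
  rw [fracInt_const_mul hγ, fracInt_const_mul zero_le_one, hterm]

lemma isDirectSolution_seriesSolution {b₁ b₂ : ℝ} (hT : 0 < T) (hc : 0 < c) (hca : c < a)
    (ha1 : a < 1) (hb₁ : b₁ ∈ Icc (0:ℝ) 1) (hb₂ : b₂ ∈ Icc (0:ℝ) 1) (hg : SourceCondition T g)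
    (hgt : (0 < b₁ ∨ a - c < b₂ * (1 - c)) → MemCOne T g) :
    IsDirectSolution a c b₁ b₂ μ T g (seriesSolution a c μ g) := by
  have ha : 0 < a := hc.trans hca
  obtain ⟨h, hh, hu⟩ := exists_eq_fracInt_seriesSolution hT hc hca ha1 hg μ
  have huI : ∀ t ∈ Ioc 0 T, ∀ x ∈ Icc (0:ℝ) 1, seriesSolution a c μ g t x =
      fracInt a (fun s => h s x) t := fun t ht x hx => (hu t ht x hx).1
  obtain ⟨γ₁, hγ₁⟩ : ∃ γ, γ = (1 - b₁) * (1 - a) := ⟨_, rfl⟩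
  obtain ⟨γ₂, hγ₂⟩ : ∃ γ, γ = (1 - b₂) * (1 - c) := ⟨_, rfl⟩
  have hγ₁0 : 0 ≤ γ₁ := hγ₁ ▸ mul_nonneg (by linarith [hb₁.2]) (by linarith)
  have hγ₂0 : 0 ≤ γ₂ := hγ₂ ▸ mul_nonneg (by linarith [hb₂.2]) (by linarith)
  obtain ⟨ψ₁, hψ₁, hV₁⟩ : ∃ ψ : ℝ → ℝ → ℝ, MemC T ψ ∧ ∀ x ∈ Icc (0:ℝ) 1, ∀ t ∈ Ioc 0 T,
      fracInt γ₁ (fun s => seriesSolution a c μ g s x) t = fracInt 1 (fun s => ψ s x) t := by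
    by_cases hcase : 0 < b₁
    · exact exists_fracInt_seriesSolution_eq_of_memCOne hT hc hca ha1 hγ₁0 hg
        (hgt (Or.inl hcase)) μ
    · have hb0 : b₁ = 0 := le_antisymm (not_lt.1 hcase) hb₁.1
      refine exists_fracInt_eq_of_one_le_add ha.le hγ₁0 ?_ hh huI
      rw [hγ₁, hb0]
      linarith
  obtain ⟨ψ₂, hψ₂, hV₂⟩ : ∃ ψ : ℝ → ℝ → ℝ, MemC T ψ ∧ ∀ x ∈ Icc (0:ℝ) 1, ∀ t ∈ Ioc 0 T,
      fracInt γ₂ (fun s => seriesSolution a c μ g s x) t = fracInt 1 (fun s => ψ s x) t := by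
    by_cases hcase : a - c < b₂ * (1 - c)
    · exact exists_fracInt_seriesSolution_eq_of_memCOne hT hc hca ha1 hγ₂0 hg
        (hgt (Or.inr hcase)) μ
    · refine exists_fracInt_eq_of_one_le_add ha.le hγ₂0 ?_ hh huI
      rw [hγ₂]
      linarith [not_lt.1 hcase]
  rw [hγ₁] at hV₁
  rw [hγ₂] at hV₂
  obtain ⟨B, -, hB⟩ := exists_eigenval_mul_modalSolution_bound hT hc hca ha1 hg μ
  refine ⟨(hh.fracInt ha.le).congr huI, ?_, fun t ht => ?_, fun x hx => ?_, fun t ht x hx => ?_,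
    fun t _ => ?_, fun x hx => ?_, fun x hx => ?_⟩
  · have hψ₁' := hψ₁
    obtain ⟨p, hp, F, hF, hψF⟩ := hψ₁'
    refine ⟨p, hp, F, hF, fun t ht x hx => ?_⟩
    rw [← hψF t ⟨ht.1, ht.2.le⟩ x hx]
    exact hasDerivAt_of_eq_fracInt_one
      (hψ₁.slice hx) (hV₁ x hx) ht
  · have hs : Summable fun k => eigenval k * modalSolution a c μ g k t :=
      Summable.of_norm_bounded (summable_eigenval_rpow.mul_left B) fun k => (hB k t ht).2
    exact (contDiff_sine_series hs).1.contDiffOn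
  · exact hilferDifferentiable_of_eq (hψ₂.slice (Ioo_subset_Icc_self hx))
      (hV₂ x (Ioo_subset_Icc_self hx))
  · have hx' := Ioo_subset_Icc_self hx
    have ht' : t ∈ Ioc 0 T := ⟨ht.1, ht.2.le⟩
    rw [hilferDeriv_fracInt le_rfl ha ha1 hb₁ (hh.slice hx') (fun s hs => huI s hs x hx')
        (hψ₁.slice hx') (hV₁ x hx') ht,
      hilferDeriv_fracInt hca.le hc (hca.trans ha1) hb₂ (hh.slice hx') (fun s hs => huI s hs x hx')
        (hψ₂.slice hx') (hV₂ x hx') ht, sub_self, fracInt_zero]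
    linarith [(hu t ht' x hx').2]
  · simp only [seriesSolution, sineMode_zero, sineMode_one, zero_mul, tsum_zero, and_self]
  · exact tendsto_of_eq_fracInt_one hT (hψ₁.slice hx) (hV₁ x hx)
  · exact tendsto_of_eq_fracInt_one hT (hψ₂.slice hx) (hV₂ x hx)

end Existence

end Hilfer

theorem theorem2 (α₁ α₂ β₁ β₂ μ T : ℝ) (hT : 0 < T)
    (hα₂ : 0 < α₂) (hα : α₂ < α₁) (hα₁ : α₁ < 1)
    (hβ₁ : β₁ ∈ Set.Icc (0 : ℝ) 1) (hβ₂ : β₂ ∈ Set.Icc (0 : ℝ) 1)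
    (g : ℝ → ℝ → ℝ) (hg : SourceCondition T g)
    (hgt : (0 < β₁ ∨ α₁ - α₂ < β₂ * (1 - α₂)) → MemCOne T g) :
    -- existence
    (∃ u : ℝ → ℝ → ℝ, IsDirectSolution α₁ α₂ β₁ β₂ μ T g u) ∧
    -- uniqueness
    (∀ u v : ℝ → ℝ → ℝ, IsDirectSolution α₁ α₂ β₁ β₂ μ T g u →
      IsDirectSolution α₁ α₂ β₁ β₂ μ T g v →
      ∀ t ∈ Set.Ioc 0 T, ∀ x ∈ Set.Icc (0 : ℝ) 1, u t x = v t x) ∧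
    -- representation of the solution
    (∀ u : ℝ → ℝ → ℝ, IsDirectSolution α₁ α₂ β₁ β₂ μ T g u →
      ∀ t ∈ Set.Ioc 0 T,
        (∀ k : ℕ, IntervalIntegrable (directIntegrand α₁ α₂ μ g (k + 1) t)
          MeasureTheory.volume 0 t) ∧
        ∀ x ∈ Set.Icc (0 : ℝ) 1,
          HasSum (fun k : ℕ => Real.sin (((k + 1 : ℕ) : ℝ) * Real.pi * x) *
            ∫ z in (0 : ℝ)..t, directIntegrand α₁ α₂ μ g (k + 1) t z) (u t x)) := by
  have hsum := fun u (hu : IsDirectSolution α₁ α₂ β₁ β₂ μ T g u) t (ht : t ∈ Set.Ioc 0 T) x hx =>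
    Hilfer.hasSum_of_isDirectSolution hT hα₂ hα hα₁ hβ₁ hβ₂ hg hu (t := t) (x := x) ht hx
  refine ⟨⟨_, Hilfer.isDirectSolution_seriesSolution hT hα₂ hα hα₁ hβ₁ hβ₂ hg hgt⟩,
    fun u v hu hv t ht x hx => (hsum u hu t ht x hx).unique (hsum v hv t ht x hx),
    fun u hu t ht => ⟨fun k => ?_, fun x hx => ?_⟩⟩
  · rw [funext (Hilfer.directIntegrand_eq α₁ α₂ μ g k t)]
    exact Hilfer.causalConv_integrand_intervalIntegrable (hg.continuousOn_sineCoeff (k + 1)).sing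
      (Hilfer.sing_mlKernel hT hα₂.le hα (hα₂.trans hα) μ _) (Set.Ioc_subset_Icc_self ht)
  · simpa only [Hilfer.integral_directIntegrand] using hsum u hu t ht x hx
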